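/- Let $\eta,\sigma:(0,\infty)\to(0,\infty)$ be twice continuously differentiable, let $S_0,V_0>0$ and $\rho\in(-1,1)$. For absolutely continuous $g,h:[0,1]\to\mathbb R$ put $$\Lambda_\rho[g,h]=\frac{1}{2(1-\rho^2)}\int_0^1\left(\frac{g'(t)}{\eta(e^{g(t)})\sqrt{e^{h(t)}}}-\frac{\rho h'(t)}{\sigma(e^{h(t)})}\right)^2dt+\frac12\int_0^1\left(\frac{h'(t)}{\sigma(e^{h(t)})}\right)^2dt\in[0,\infty],$$ and let $\mathcal I_\rho(S_0,V_0,K)$ be the infimum of $\Lambda_\rho[g,h]$ over all absolutely continuous $g,h$ with $g(0)=\log S_0$, $h(0)=\log V_0$ and $\int_0^1e^{h(t)}\eta^2(e^{g(t)})\,dt=K$. Suppose that, as $S\to S_0$ and $V\to V_0$, $$\eta(S)=\eta_0+\eta_1\log\tfrac{S}{S_0}+\eta_2\log^2\tfrac{S}{S_0}+O\left(\left|\log\tfrac{S}{S_0}\right|^3\right),\qquad \sigma(V)=\sigma_0+\sigma_1\log\tfrac{V}{V_0}+\sigma_2\log^2\tfrac{V}{V_0}+O\left(\left|\log\tfrac{V}{V_0}\right|^3\right),$$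 where $\eta_0=\eta(S_0)$, $\eta_1=S_0\eta'(S_0)$, $\sigma_0=\sigma(V_0)$, $\sigma_1=V_0\sigma'(V_0)$. Put $$D=\sigma_0^2+4\rho\sigma_0\sqrt{V_0}\,\eta_1+4\eta_1^2V_0,$$ $$\beta_0=16\eta_1^2V_0^2(\eta_1^2+6\eta_0\eta_2),\qquad \beta_1=8\eta_1\rho V_0\left(3\eta_1\rho\sigma_1+7\eta_1^2\sqrt{V_0}+12\eta_0\eta_2\sqrt{V_0}\right),$$ $$\beta_2=4\left(6\eta_1\rho\sigma_1\sqrt{V_0}+6\eta_0\eta_2\rho^2V_0+\eta_1^2(5+7\rho^2)V_0\right).$$ Then $D>0$ and, with the log-moneyness $x=\log\frac{K}{V_0\eta_0^2}$, as $x\to0$ the rate function is finite and $$\mathcal I_\rho(S_0,V_0,V_0\eta_0^2e^x)=\frac{3}{2D}x^2-\frac{3}{10D^3}\left(\sigma_0^4+2\sigma_0^3\left(3\sigma_1+7\eta_1\rho\sqrt{V_0}\right)+\beta_2\sigma_0^2+\beta_1\sigma_0+\beta_0\right)x^3+O(x^4).$$ Moreover, for all sufficiently small $|x|$ the infimum at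 $K=V_0\eta_0^2e^x$ is attained, and all optimal $g,h$ satisfy, as $x\to0$ and uniformly in $t\in[0,1]$, $$g(t)=\log S_0+x\,g_1(t)+O(x^2),\qquad h(t)=\log V_0+x\,h_1(t)+O(x^2),$$ where $$g_1(t)=\frac32\,\frac{(2\eta_1\sqrt{V_0}+\rho\sigma_0)\sqrt{V_0}\,\eta_0}{D}(2t-t^2),\qquad h_1(t)=\frac32\,\frac{\sigma_0(\sigma_0+2\eta_1\rho\sqrt{V_0})}{D}(2t-t^2).$$ -/

import Mathlib

open Set Filter Topology MeasureTheory Asymptotics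
open scoped ENNReal

/-- The energy functional `Λ_ρ[g,h]` on paths `[0,1] → ℝ`, with values in `[0,∞]`:
`1/(2(1-ρ²)) ∫₀¹ (g'/(η(e^g) √(e^h)) - ρ h'/σ(e^h))² dt + 1/2 ∫₀¹ (h'/σ(e^h))² dt`. -/
noncomputable def energyFunctional (η σ : ℝ → ℝ) (ρ : ℝ) (g h : ℝ → ℝ) : ℝ≥0∞ :=
  ENNReal.ofReal (1 / (2 * (1 - ρ ^ 2))) *
      (∫⁻ t in Icc (0 : ℝ) 1, ENNReal.ofReal
        ((deriv g t / (η (Real.exp (g t)) * Real.sqrt (Real.exp (h t)))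
          - ρ * deriv h t / σ (Real.exp (h t))) ^ 2))
    + ENNReal.ofReal (1 / 2) *
      (∫⁻ t in Icc (0 : ℝ) 1, ENNReal.ofReal ((deriv h t / σ (Real.exp (h t))) ^ 2))

/-- Admissible pairs of paths of the variational problem: absolutely continuous on `[0,1]`,
started at `(log S₀, log V₀)`, with `∫₀¹ e^{h(t)} η²(e^{g(t)}) dt = K`. -/
structure IsAdmissiblePair (η : ℝ → ℝ) (S₀ V₀ K : ℝ) (g h : ℝ → ℝ) : Prop where
  ac_g : AbsolutelyContinuousOnInterval g 0 1
  ac_h : AbsolutelyContinuousOnInterval h 0 1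
  g_zero : g 0 = Real.log S₀
  h_zero : h 0 = Real.log V₀
  integral_eq : ∫ t in (0 : ℝ)..1, Real.exp (h t) * η (Real.exp (g t)) ^ 2 = K

/-- The rate function `I_ρ(S₀,V₀,K)`: the infimum of the energy over admissible pairs
(`∞` if there is none of finite energy). -/
noncomputable def rateFunction (η σ : ℝ → ℝ) (ρ S₀ V₀ K : ℝ) : ℝ≥0∞ :=
  ⨅ (g : ℝ → ℝ) (h : ℝ → ℝ) (_ : IsAdmissiblePair η S₀ V₀ K g h), energyFunctional η σ ρ g h

/-- `(g,h)` solves the variational problem: it is admissible and attains the infimum. -/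
def IsOptimalPair (η σ : ℝ → ℝ) (ρ S₀ V₀ K : ℝ) (g h : ℝ → ℝ) : Prop :=
  IsAdmissiblePair η S₀ V₀ K g h ∧ energyFunctional η σ ρ g h = rateFunction η σ ρ S₀ V₀ K

/-! Put `h'/σ(e^h) = β` and `g'/(η(e^g)√(e^h)) = ρβ + √(1-ρ²)α`. The energy becomes `‖w‖²/2` for the
control `w = (α, β)` in the Hilbert space `L² × L²`. Both equations separate: if `θ` and `ζ` invert
the primitives of `1/σ(V₀e^v)` and `1/η(S₀e^u)`, then for small `w` one has `h = log V₀ + θ(y)` with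
`y = ∫β`, and `g = log S₀ + ζ(z)` with `z = ∫ √(V₀e^{θ(y)}) (ρβ + √(1-ρ²)α)`. The constraint reads
`G(w) = c`, where `G(w) = ∫ P(z) W(y) dt - 1`, `P` is the normalized squared local volatility, `W =
e^θ` and `c = e^x - 1`. Near the money the problem is therefore to minimize a Hilbert norm on a
level set of a smooth functional near the origin.

Let `k` be the gradient of `G` at `0`, `κ = ‖k‖²`, and `G(s k) = sκ + s²q + O(s³)`. Write a point of
the level set as `w = s k + v` with `v ⟂ k`. Since `v` affects `G` only at order `|c|‖v‖`, the level
equation gives `s²κ = c²/κ - 2qc³/κ³ + O(c²‖v‖ + c⁴)`, while `‖w‖² = s²κ + ‖v‖²`. Comparison with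
the point of the level set on the ray through `k` forces `‖v‖ = O(c²)` at a minimizer, so `min ‖w‖²
= c²/κ - 2qc³/κ³ + O(c⁴)` and every minimizer is `(c/κ)k + O(c²)`
(`QuadControl.constrained_minimum`). Existence needs no compactness: the midpoint of two points of
the level set can be pushed back to it at a cost smaller than the gain from the parallelogram law,
so minimizing sequences are Cauchy. All that is used of `G` is a quadratic control, a substitute for
second Fréchet derivatives that is stable under composition, products and integration.

The gradient is explicit: averaging `∫₀ᵗ` over `t` is the inner product with `1 - s`, so both
components of `k` are multiples of `1 - s`, and `κ = D/3`. Along the ray `s k` the states depend on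
`t` only through `s(t - t²/2)`, so `q` follows from one-variable expansions and `∫(t - t²/2)² dt =
2/15`. Finally `c = x + x²/2 + O(x³)` turns the expansion in `c` into the one in `x`, and the flows
carry `w = (c/κ)k + O(c²)` to the expansion of the paths. -/

/-! ### Quadratic control: a second-order bound without derivatives -/

/-- On the ball of radius `r`, the function `F` is bounded and Lipschitz, deviates from midpoint
affinity at most quadratically, and has increments close to those of the linear map `l`. -/
structure QuadControl {X : Type*} [NormedAddCommGroup X] [NormedSpace ℝ X]
    (F : X → ℝ) (l : X →L[ℝ] ℝ) (r L : ℝ) : Prop where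
  bound : ∀ a, ‖a‖ ≤ r → |F a| ≤ L
  map : ∀ v, |l v| ≤ L * ‖v‖
  lip : ∀ a b, ‖a‖ ≤ r → ‖b‖ ≤ r → |F a - F b| ≤ L * ‖a - b‖
  mid : ∀ a b, ‖a‖ ≤ r → ‖b‖ ≤ r →
    |F ((1 / 2 : ℝ) • (a + b)) - (F a + F b) / 2| ≤ L * ‖a - b‖ ^ 2
  lin : ∀ a b, ‖a‖ ≤ r → ‖b‖ ≤ r →
    |F a - F b - l (a - b)| ≤ L * (‖a‖ + ‖b‖) * ‖a - b‖

namespace QuadControl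

variable {X : Type*} [NormedAddCommGroup X] [NormedSpace ℝ X] {F : X → ℝ} {l : X →L[ℝ] ℝ}
  {r L : ℝ}

theorem nonneg (h : QuadControl F l r L) (hr : 0 ≤ r) : 0 ≤ L :=
  (abs_nonneg _).trans (h.bound 0 (by simpa using hr))

theorem mono (h : QuadControl F l r L) {r' L' : ℝ} (hr : r' ≤ r) (hL : L ≤ L') :
    QuadControl F l r' L' where
  bound a ha := (h.bound a (ha.trans hr)).trans hL
  map v := (h.map v).trans (by gcongr)
  lip a b ha hb := (h.lip a b (ha.trans hr) (hb.trans hr)).trans (by gcongr)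
  mid a b ha hb := (h.mid a b (ha.trans hr) (hb.trans hr)).trans (by gcongr)
  lin a b ha hb := (h.lin a b (ha.trans hr) (hb.trans hr)).trans (by gcongr)

theorem continuousOn (h : QuadControl F l r L) (hr : 0 ≤ r) :
    ContinuousOn F (Metric.closedBall 0 r) := by
  have : LipschitzOnWith (Real.toNNReal L) F (Metric.closedBall 0 r) := by
    refine LipschitzOnWith.of_dist_le_mul fun a ha b hb => ?_
    rw [Real.coe_toNNReal _ (h.nonneg hr), Real.dist_eq, dist_eq_norm]
    exact h.lip a b (by simpa using ha) (by simpa using hb)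
  exact this.continuousOn

theorem midpoint_norm_le {a b : X} (ha : ‖a‖ ≤ r) (hb : ‖b‖ ≤ r) :
    ‖(1 / 2 : ℝ) • (a + b)‖ ≤ r := by
  rw [norm_smul]
  have := norm_add_le a b
  norm_num
  linarith

end QuadControl

/-! ### Minimal norm on the level sets of a functional on a Hilbert space -/

section ConstrainedMinimum

variable {H : Type*} [NormedAddCommGroup H] [InnerProductSpace ℝ H]
  {G : H → ℝ} {k : H} {r L : ℝ}

/-- Moving along `k` reaches every nearby level of `G`, at a cost proportional to the defect. -/
theorem QuadControl.exists_level_correction (hG : QuadControl G (innerSL ℝ k) r L) (hr : 0 < r)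
    (hk : k ≠ 0) :
    ∃ ε > 0, ε ≤ r ∧ ∀ m : H, ‖m‖ ≤ ε → ∀ c : ℝ, |G m - c| ≤ ε →
      ∃ s : ℝ, |s| ≤ 2 / ‖k‖ ^ 2 * |G m - c| ∧ ‖m + s • k‖ ≤ r ∧ G (m + s • k) = c := by
  have hk0 : 0 < ‖k‖ := norm_pos_iff.mpr hk
  have hL := hG.nonneg hr.le
  -- The factor 2 makes the linear part of the move along `k` twice the defect `|G m - c|`. With the
  -- remainder kept below half of that by `e2`, the values at `s = ±S` enclose `c`, and the
  -- intermediate value theorem applies.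
  set K := 2 / ‖k‖ ^ 2 with hK
  have hK0 : 0 < K := by positivity
  have hKk : K * ‖k‖ ^ 2 = 2 := by rw [hK]; field_simp
  have e1 : ∀ᶠ ε : ℝ in 𝓝[>] 0, ε + K * ε * ‖k‖ < r := by
    have : Tendsto (fun ε : ℝ => ε + K * ε * ‖k‖) (𝓝 0) (𝓝 (0 + K * 0 * ‖k‖)) := by
      apply Continuous.tendsto; fun_prop
    exact nhdsWithin_le_nhds (this.eventually_lt_const (by simpa using hr))
  have e2 : ∀ᶠ ε : ℝ in 𝓝[>] 0, L * (2 * ε + K * ε * ‖k‖) * ‖k‖ < ‖k‖ ^ 2 / 2 := by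
    have : Tendsto (fun ε : ℝ => L * (2 * ε + K * ε * ‖k‖) * ‖k‖) (𝓝 0)
        (𝓝 (L * (2 * 0 + K * 0 * ‖k‖) * ‖k‖)) := by
      apply Continuous.tendsto; fun_prop
    refine nhdsWithin_le_nhds (this.eventually_lt_const ?_)
    simp only [mul_zero, zero_mul, add_zero]; positivity
  obtain ⟨ε, ⟨h1, h2⟩, h0⟩ := ((e1.and e2).and self_mem_nhdsWithin).exists
  have h0 : 0 < ε := h0
  refine ⟨ε, h0, ?_, fun m hm c hc => ?_⟩
  · have : 0 ≤ K * ε * ‖k‖ := by positivity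
    linarith
  set S := K * |G m - c| with hS
  have hS0 : 0 ≤ S := by positivity
  have hSε : S ≤ K * ε := by rw [hS]; gcongr
  have hball : ∀ s : ℝ, |s| ≤ S → ‖m + s • k‖ ≤ r := by
    intro s hs
    calc ‖m + s • k‖ ≤ ‖m‖ + ‖s • k‖ := norm_add_le _ _
      _ = ‖m‖ + |s| * ‖k‖ := by rw [norm_smul, Real.norm_eq_abs]
      _ ≤ ε + K * ε * ‖k‖ := by gcongr; exact hs.trans hSε
      _ ≤ r := h1.le
  have hmr : ‖m‖ ≤ r := by simpa using hball 0 (by simpa using hS0)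
  have hstep : ∀ s : ℝ, |s| = S → |G (m + s • k) - G m - s * ‖k‖ ^ 2| ≤ |G m - c| := by
    intro s hs
    have := hG.lin (m + s • k) m (hball s hs.le) hmr
    have hin : (innerSL ℝ k) (m + s • k - m) = s * ‖k‖ ^ 2 := by
      simp
    rw [hin, add_sub_cancel_left, norm_smul, Real.norm_eq_abs, hs] at this
    have h3 : ‖m + s • k‖ + ‖m‖ ≤ 2 * ε + K * ε * ‖k‖ := by
      have h4 := norm_add_le m (s • k)
      rw [norm_smul, Real.norm_eq_abs, hs] at h4
      have : S * ‖k‖ ≤ K * ε * ‖k‖ := by gcongr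
      linarith
    calc _ ≤ _ := this
      _ ≤ L * (2 * ε + K * ε * ‖k‖) * (S * ‖k‖) := by gcongr
      _ = L * (2 * ε + K * ε * ‖k‖) * ‖k‖ * S := by ring
      _ ≤ ‖k‖ ^ 2 / 2 * S := by gcongr
      _ = K * ‖k‖ ^ 2 * |G m - c| / 2 := by rw [hS]; ring
      _ = |G m - c| := by rw [hKk]; ring
  have hSk : S * ‖k‖ ^ 2 = 2 * |G m - c| := by
    rw [hS, mul_right_comm, hKk]
  have hp := abs_le.mp (hstep S (abs_of_nonneg hS0))
  have hn := abs_le.mp (hstep (-S) (by rw [abs_neg, abs_of_nonneg hS0]))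
  have hcont : ContinuousOn (fun s : ℝ => G (m + s • k)) (Icc (-S) S) := by
    refine (hG.continuousOn hr.le).comp (by fun_prop) fun s hs => ?_
    simpa using hball s (abs_le.mpr hs)
  have ha := abs_le.mp (le_refl |G m - c|)
  obtain ⟨s, hs, hsc⟩ := intermediate_value_Icc (by linarith) hcont
    (show c ∈ Icc (G (m + (-S) • k)) (G (m + S • k)) by constructor <;> linarith)
  exact ⟨s, abs_le.mpr hs, hball s (abs_le.mpr hs), hsc⟩

/-- Near the origin the level sets of `G` are uniformly round enough for midpoints to be
projected back to the level set without losing strict convexity of the norm. -/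
theorem QuadControl.exists_level_midpoint (hG : QuadControl G (innerSL ℝ k) r L) (hr : 0 < r)
    (hk : k ≠ 0) :
    ∃ ε > 0, ε ≤ r ∧ ∀ a b : H, ‖a‖ ≤ ε → ‖b‖ ≤ ε → G a = G b →
      ∃ m : H, ‖m‖ ≤ r ∧ G m = G a ∧
        ‖m‖ ^ 2 ≤ (‖a‖ ^ 2 + ‖b‖ ^ 2) / 2 - ‖a - b‖ ^ 2 / 8 := by
  obtain ⟨ε, hε, hεr, hcorr⟩ := hG.exists_level_correction hr hk
  have hk0 : 0 < ‖k‖ := norm_pos_iff.mpr hk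
  have hL := hG.nonneg hr.le
  set K := 2 / ‖k‖ ^ 2 with hK
  have hK0 : 0 < K := by positivity
  have e1 : ∀ᶠ δ : ℝ in 𝓝[>] 0, L * (2 * δ) ^ 2 < ε := by
    have : Tendsto (fun δ : ℝ => L * (2 * δ) ^ 2) (𝓝 0) (𝓝 (L * (2 * 0) ^ 2)) := by
      apply Continuous.tendsto; fun_prop
    exact nhdsWithin_le_nhds (this.eventually_lt_const (by simpa using hε))
  -- Since `G a = G b`, the midpoint misses the level by `O(d²)`, so the correction has `s = O(d²)`
  -- and raises the squared norm by at most this expression times `d²`. The parallelogram law gains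
  -- `d²/4`; the bound `1/8` keeps half of it.
  have e2 : ∀ᶠ δ : ℝ in 𝓝[>] 0,
      2 * (K * L) * δ * ‖k‖ + (K * L) ^ 2 * (2 * δ) ^ 2 * ‖k‖ ^ 2 < 1 / 8 := by
    have : Tendsto (fun δ : ℝ => 2 * (K * L) * δ * ‖k‖ + (K * L) ^ 2 * (2 * δ) ^ 2 * ‖k‖ ^ 2)
        (𝓝 0) (𝓝 (2 * (K * L) * 0 * ‖k‖ + (K * L) ^ 2 * (2 * 0) ^ 2 * ‖k‖ ^ 2)) := by
      apply Continuous.tendsto; fun_prop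
    exact nhdsWithin_le_nhds (this.eventually_lt_const (by norm_num))
  have e3 : ∀ᶠ δ : ℝ in 𝓝[>] 0, δ < ε := nhdsWithin_le_nhds (eventually_lt_nhds hε)
  obtain ⟨δ, ⟨⟨h1, h2⟩, h3⟩, h0⟩ := (((e1.and e2).and e3).and self_mem_nhdsWithin).exists
  have h0 : 0 < δ := h0
  refine ⟨δ, h0, h3.le.trans hεr, fun a b ha hb hab => ?_⟩
  set m := (1 / 2 : ℝ) • (a + b) with hm
  set d := ‖a - b‖ with hd
  have hd0 : 0 ≤ d := norm_nonneg _
  have hd2 : d ≤ 2 * δ := (norm_sub_le a b).trans (by linarith)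
  have hmδ : ‖m‖ ≤ δ := QuadControl.midpoint_norm_le ha hb
  have hmid : |G m - G a| ≤ L * d ^ 2 := by
    have := hG.mid a b (ha.trans (h3.le.trans hεr)) (hb.trans (h3.le.trans hεr))
    rwa [← hab, add_self_div_two] at this
  have hLd : L * d ^ 2 ≤ L * (2 * δ) ^ 2 := by gcongr
  obtain ⟨s, hs, hsr, hsG⟩ := hcorr m (hmδ.trans h3.le) (G a) (by linarith)
  refine ⟨m + s • k, hsr, hsG, ?_⟩
  have hs' : |s| ≤ K * L * d ^ 2 := by
    calc |s| ≤ K * |G m - G a| := hs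
      _ ≤ K * (L * d ^ 2) := by gcongr
      _ = _ := by ring
  have hpar : ‖m‖ ^ 2 = (‖a‖ ^ 2 + ‖b‖ ^ 2) / 2 - d ^ 2 / 4 := by
    have := parallelogram_law_with_norm ℝ a b
    rw [hm, norm_smul, hd]
    norm_num
    nlinarith
  have hexp : ‖m + s • k‖ ^ 2 = ‖m‖ ^ 2 + 2 * (s * inner ℝ m k) + s ^ 2 * ‖k‖ ^ 2 := by
    rw [norm_add_sq_real, inner_smul_right, norm_smul s k, mul_pow, Real.norm_eq_abs, sq_abs]
  have hi : s * inner ℝ m k ≤ K * L * d ^ 2 * (δ * ‖k‖) := by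
    calc s * inner ℝ m k ≤ |s * inner ℝ m k| := le_abs_self _
      _ = |s| * |inner ℝ m k| := abs_mul _ _
      _ ≤ K * L * d ^ 2 * (δ * ‖k‖) := by
        gcongr
        exact (abs_real_inner_le_norm m k).trans (by gcongr)
  have hs2 : s ^ 2 ≤ (K * L) ^ 2 * (2 * δ) ^ 2 * d ^ 2 := by
    calc s ^ 2 = |s| ^ 2 := (sq_abs s).symm
      _ ≤ (K * L * d ^ 2) ^ 2 := by gcongr
      _ = (K * L) ^ 2 * d ^ 2 * d ^ 2 := by ring
      _ ≤ (K * L) ^ 2 * (2 * δ) ^ 2 * d ^ 2 := by gcongr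
  have h4 : s ^ 2 * ‖k‖ ^ 2 ≤ (K * L) ^ 2 * (2 * δ) ^ 2 * d ^ 2 * ‖k‖ ^ 2 := by gcongr
  have h5 : (2 * (K * L) * δ * ‖k‖ + (K * L) ^ 2 * (2 * δ) ^ 2 * ‖k‖ ^ 2) * d ^ 2
      ≤ 1 / 8 * d ^ 2 := by gcongr
  rw [hexp, hpar]
  nlinarith

/-- Existence of norm minimizers on the level sets of `G` close to the origin. -/
theorem QuadControl.exists_level_minimizer [CompleteSpace H]
    (hG : QuadControl G (innerSL ℝ k) r L) (hr : 0 < r) (hk : k ≠ 0) (hG0 : G 0 = 0) :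
    ∃ ε > 0, ∀ c : ℝ, |c| ≤ ε → ∃ s : ℝ, |s| ≤ 2 / ‖k‖ ^ 2 * |c| ∧ ‖s • k‖ ≤ r ∧
      G (s • k) = c ∧ ∃ w : H, ‖w‖ ≤ r ∧ G w = c ∧
        ∀ w' : H, ‖w'‖ ≤ r → G w' = c → ‖w‖ ≤ ‖w'‖ := by
  obtain ⟨ε, hε, hεr, hcorr⟩ := hG.exists_level_correction hr hk
  obtain ⟨δ, hδ, hδr, hmid⟩ := hG.exists_level_midpoint hr hk
  have hk0 : 0 < ‖k‖ := norm_pos_iff.mpr hk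
  have e1 : ∀ᶠ e : ℝ in 𝓝[>] 0, (2 / ‖k‖ ^ 2 * e) * ‖k‖ < δ := by
    have : Tendsto (fun e : ℝ => (2 / ‖k‖ ^ 2 * e) * ‖k‖) (𝓝 0)
        (𝓝 ((2 / ‖k‖ ^ 2 * 0) * ‖k‖)) := by
      apply Continuous.tendsto; fun_prop
    exact nhdsWithin_le_nhds (this.eventually_lt_const (by simpa using hδ))
  have e3 : ∀ᶠ e : ℝ in 𝓝[>] 0, e < ε := nhdsWithin_le_nhds (eventually_lt_nhds hε)
  obtain ⟨e, ⟨h1, h3⟩, h0⟩ := ((e1.and e3).and self_mem_nhdsWithin).exists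
  refine ⟨e, h0, fun c hc => ?_⟩
  obtain ⟨s, hs, hsr, hsG⟩ := hcorr 0 (by simpa using hε.le) c
    (by rw [hG0, zero_sub, abs_neg]; linarith)
  rw [hG0, zero_sub, abs_neg] at hs
  rw [zero_add] at hsr hsG
  refine ⟨s, hs, hsr, hsG, ?_⟩
  set A : Set ℝ := (fun w : H => ‖w‖ ^ 2) '' {w : H | ‖w‖ ≤ r ∧ G w = c} with hA
  have hAne : A.Nonempty := ⟨_, s • k, ⟨hsr, hsG⟩, rfl⟩
  have hAbdd : BddBelow A := ⟨0, by rintro _ ⟨w, -, rfl⟩; positivity⟩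
  set I := sInf A with hI
  have hle : ∀ w : H, ‖w‖ ≤ r → G w = c → I ≤ ‖w‖ ^ 2 := fun w hw hwc =>
    csInf_le hAbdd ⟨w, ⟨hw, hwc⟩, rfl⟩
  have hIδ : I < δ ^ 2 := by
    refine (hle _ hsr hsG).trans_lt ?_
    have : ‖s • k‖ < δ := by
      rw [norm_smul, Real.norm_eq_abs]
      refine lt_of_le_of_lt ?_ h1
      gcongr
      exact hs.trans (by gcongr)
    gcongr
  -- The tolerance equals `δ² - I` at `n = 0`, so the whole minimizing sequence lies in the ball
  -- where level midpoints are available.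
  have hseq : ∀ n : ℕ, ∃ w : H, (‖w‖ ≤ r ∧ G w = c) ∧
      ‖w‖ ^ 2 < I + (δ ^ 2 - I) / ((n : ℝ) + 1) := by
    intro n
    have hpos : 0 < (δ ^ 2 - I) / ((n : ℝ) + 1) := by
      have : 0 < δ ^ 2 - I := by linarith
      positivity
    obtain ⟨_, ⟨w, hw, rfl⟩, hlt⟩ := exists_lt_of_csInf_lt hAne
      (show sInf A < I + (δ ^ 2 - I) / ((n : ℝ) + 1) by linarith)
    exact ⟨w, hw, hlt⟩
  choose w hw hwlt using hseq
  have hwδ : ∀ n, ‖w n‖ ≤ δ := by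
    intro n
    have h2 : (δ ^ 2 - I) / ((n : ℝ) + 1) ≤ δ ^ 2 - I :=
      div_le_self (by linarith) (by linarith [(Nat.cast_nonneg n : (0 : ℝ) ≤ n)])
    have := hwlt n
    exact le_of_sq_le_sq (by linarith) hδ.le
  have htend : Tendsto (fun n : ℕ => (δ ^ 2 - I) / ((n : ℝ) + 1)) atTop (𝓝 0) := by
    have := (tendsto_one_div_add_atTop_nhds_zero_nat (𝕜 := ℝ)).const_mul (δ ^ 2 - I)
    simpa [div_eq_mul_inv] using this
  -- The corrected midpoint is a competitor, so its squared norm is at least `I`; hence `‖w n - w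
  -- m‖²/8` is at most the mean excess of `‖w n‖²` and `‖w m‖²` over `I`.
  have hcauchy : CauchySeq w := by
    refine cauchySeq_of_le_tendsto_0 (fun n : ℕ => Real.sqrt (8 * ((δ ^ 2 - I) / ((n : ℝ) + 1))))
      (fun n m N hn hm => ?_) ?_
    · obtain ⟨p, hpr, hpG, hp⟩ := hmid (w n) (w m) (hwδ n) (hwδ m)
        ((hw n).2.trans (hw m).2.symm)
      have h5 := hle p hpr (hpG.trans (hw n).2)
      have hδI : 0 ≤ δ ^ 2 - I := by linarith
      have h6 : (δ ^ 2 - I) / ((n : ℝ) + 1) ≤ (δ ^ 2 - I) / ((N : ℝ) + 1) := by gcongr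
      have h7 : (δ ^ 2 - I) / ((m : ℝ) + 1) ≤ (δ ^ 2 - I) / ((N : ℝ) + 1) := by gcongr
      have := hwlt n
      have := hwlt m
      rw [dist_eq_norm]
      apply Real.le_sqrt_of_sq_le
      linarith
    · have := (htend.const_mul 8).sqrt
      simpa using this
  obtain ⟨w₀, hw₀⟩ := cauchySeq_tendsto_of_complete hcauchy
  have hw₀r : ‖w₀‖ ≤ r := le_of_tendsto hw₀.norm (Eventually.of_forall fun n => (hw n).1)
  refine ⟨w₀, hw₀r, ?_, fun w' hw' hw'c => ?_⟩
  · have hc1 : Tendsto (fun n => G (w n)) atTop (𝓝 (G w₀)) :=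
      ((hG.continuousOn hr.le) w₀ (by simpa using hw₀r)).tendsto.comp
        (tendsto_nhdsWithin_iff.mpr ⟨hw₀, Eventually.of_forall fun n => by simpa using (hw n).1⟩)
    exact tendsto_nhds_unique hc1 (by simp only [fun n => (hw n).2]; exact tendsto_const_nhds)
  · have h8 : ‖w₀‖ ^ 2 ≤ I := by
      refine le_of_tendsto_of_tendsto (hw₀.norm.pow 2) (htend.const_add I |>.trans_eq ?_)
        (Eventually.of_forall fun n => (hwlt n).le)
      simp
    exact le_of_sq_le_sq (h8.trans (hle w' hw' hw'c)) (norm_nonneg _)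

end ConstrainedMinimum

/-- Solves `c = sκ + s²q + e` perturbatively. With `δ = c - sκ = s²q + e`, squaring gives `s²κ² = c²
- 2cδ + δ²`; replacing `s²` by `c²/κ²` in the cross term leaves the cubic correction. Here `ρ`
stands for the norm of the component orthogonal to the gradient, not for a correlation. -/
theorem quadratic_level_estimate {κ : ℝ} (hκ : 0 < κ) {q B N : ℝ} (hB : 0 ≤ B) (hN : 0 ≤ N) :
    ∃ A : ℝ, 0 ≤ A ∧ ∀ c s ρ : ℝ, |c| ≤ 1 → |s| ≤ N * |c| → 0 ≤ ρ → ρ ≤ N * |c| →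
      |c - s * κ - s ^ 2 * q| ≤ B * (|c| * ρ + |c| ^ 3) →
      |s ^ 2 * κ - (c ^ 2 / κ - 2 * q * c ^ 3 / κ ^ 3)| ≤ A * (c ^ 2 * ρ + c ^ 4) ∧
        |s - c / κ| ≤ A * c ^ 2 := by
  set B' := N ^ 2 * |q| + B * (N + 1) with hB'
  have hB'0 : 0 ≤ B' := by positivity
  set A₁ := 2 * B + B' ^ 2 + 2 * |q| / κ ^ 2 * (2 * B' + B' ^ 2) with hA₁
  have hA₁0 : 0 ≤ A₁ := by positivity
  refine ⟨(A₁ + B') / κ, by positivity, fun c s ρ hc hs hρ hρN he => ?_⟩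
  set e := c - s * κ - s ^ 2 * q with he'
  have hc0 := abs_nonneg c
  have hc3 : |c| ^ 3 ≤ c ^ 2 := by
    rw [← sq_abs c]; nlinarith [sq_nonneg |c|]
  have hcρ : |c| * ρ ≤ N * c ^ 2 := by
    rw [← sq_abs c]; nlinarith
  have hs2 : s ^ 2 ≤ N ^ 2 * c ^ 2 := by
    rw [← sq_abs s, ← sq_abs c, ← mul_pow]; gcongr
  have he2 : |e| ≤ B * (N + 1) * c ^ 2 := by
    refine he.trans ?_
    rw [mul_assoc]; gcongr; linarith
  have hδ : |c - s * κ| ≤ B' * c ^ 2 := by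
    have h1 : c - s * κ = s ^ 2 * q + e := by rw [he']; ring
    rw [h1]
    calc |s ^ 2 * q + e| ≤ |s ^ 2 * q| + |e| := abs_add_le _ _
      _ = s ^ 2 * |q| + |e| := by rw [abs_mul, abs_of_nonneg (sq_nonneg s)]
      _ ≤ N ^ 2 * c ^ 2 * |q| + B * (N + 1) * c ^ 2 := by gcongr
      _ = B' * c ^ 2 := by rw [hB']; ring
  set δ := c - s * κ with hδ'
  have hδ2 : δ ^ 2 ≤ B' ^ 2 * c ^ 4 := by
    calc δ ^ 2 = |δ| ^ 2 := (sq_abs _).symm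
      _ ≤ (B' * c ^ 2) ^ 2 := by gcongr
      _ = _ := by ring
  have hc4 : c ^ 4 ≤ |c| ^ 3 := by
    have : c ^ 4 = |c| ^ 4 := by rw [← abs_pow, abs_of_nonneg (by positivity)]
    rw [this]
    calc |c| ^ 4 = |c| ^ 3 * |c| := by ring
      _ ≤ |c| ^ 3 * 1 := by gcongr
      _ = _ := by ring
  have hsc : |s ^ 2 * κ ^ 2 - c ^ 2| ≤ (2 * B' + B' ^ 2) * |c| ^ 3 := by
    have h1 : s ^ 2 * κ ^ 2 - c ^ 2 = -(2 * c * δ) + δ ^ 2 := by rw [hδ']; ring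
    rw [h1]
    calc |-(2 * c * δ) + δ ^ 2| ≤ |-(2 * c * δ)| + |δ ^ 2| := abs_add_le _ _
      _ = 2 * |c| * |δ| + δ ^ 2 := by
        rw [abs_neg, abs_mul, abs_mul, abs_of_nonneg (sq_nonneg δ)]; norm_num
      _ ≤ 2 * |c| * (B' * c ^ 2) + B' ^ 2 * |c| ^ 3 := by
        gcongr; exact hδ2.trans (by gcongr)
      _ = _ := by rw [← sq_abs c]; ring
  have hmain : |s ^ 2 * κ ^ 2 - (c ^ 2 - 2 * q * c ^ 3 / κ ^ 2)| ≤ A₁ * (c ^ 2 * ρ + c ^ 4) := by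
    clear_value B'
    have h1 : s ^ 2 * κ ^ 2 - (c ^ 2 - 2 * q * c ^ 3 / κ ^ 2)
        = -(2 * c * e) + δ ^ 2 + -(2 * c * q / κ ^ 2 * (s ^ 2 * κ ^ 2 - c ^ 2)) := by
      rw [hδ', he']; field_simp; ring
    rw [h1]
    have h2 : |2 * c * e| ≤ 2 * B * (c ^ 2 * ρ + c ^ 4) := by
      rw [abs_mul, abs_mul, abs_two]
      calc 2 * |c| * |e| ≤ 2 * |c| * (B * (|c| * ρ + |c| ^ 3)) := by gcongr
        _ = 2 * B * (|c| ^ 2 * ρ + (|c| ^ 2) ^ 2) := by ring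
        _ = _ := by rw [sq_abs]; ring
    have h3 : |2 * c * q / κ ^ 2 * (s ^ 2 * κ ^ 2 - c ^ 2)|
        ≤ 2 * |q| / κ ^ 2 * (2 * B' + B' ^ 2) * c ^ 4 := by
      rw [abs_mul, abs_div, abs_mul, abs_mul, abs_two, abs_of_pos (by positivity : 0 < κ ^ 2)]
      calc 2 * |c| * |q| / κ ^ 2 * |s ^ 2 * κ ^ 2 - c ^ 2|
          ≤ 2 * |c| * |q| / κ ^ 2 * ((2 * B' + B' ^ 2) * |c| ^ 3) := by gcongr
        _ = 2 * |q| / κ ^ 2 * (2 * B' + B' ^ 2) * (|c| ^ 2) ^ 2 := by ring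
        _ = _ := by rw [sq_abs]; ring
    have h4 : 0 ≤ c ^ 2 * ρ := by positivity
    have h5 : 0 ≤ B' ^ 2 * (c ^ 2 * ρ) := by positivity
    have h6 : 0 ≤ 2 * |q| / κ ^ 2 * (2 * B' + B' ^ 2) * (c ^ 2 * ρ) := by positivity
    calc _ ≤ |-(2 * c * e) + δ ^ 2| + |-(2 * c * q / κ ^ 2 * (s ^ 2 * κ ^ 2 - c ^ 2))| :=
          abs_add_le _ _
      _ ≤ |2 * c * e| + δ ^ 2 + |2 * c * q / κ ^ 2 * (s ^ 2 * κ ^ 2 - c ^ 2)| := by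
          rw [abs_neg]
          gcongr
          refine (abs_add_le _ _).trans ?_
          rw [abs_neg, abs_of_nonneg (sq_nonneg δ)]
      _ ≤ 2 * B * (c ^ 2 * ρ + c ^ 4) + B' ^ 2 * c ^ 4
          + 2 * |q| / κ ^ 2 * (2 * B' + B' ^ 2) * c ^ 4 := by gcongr
      _ ≤ 2 * B * (c ^ 2 * ρ + c ^ 4) + B' ^ 2 * c ^ 4
          + 2 * |q| / κ ^ 2 * (2 * B' + B' ^ 2) * c ^ 4 + B' ^ 2 * (c ^ 2 * ρ)
          + 2 * |q| / κ ^ 2 * (2 * B' + B' ^ 2) * (c ^ 2 * ρ) := by linarith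
      _ = _ := by rw [hA₁]; ring
  clear_value A₁ B' e δ
  constructor
  · have h1 : s ^ 2 * κ - (c ^ 2 / κ - 2 * q * c ^ 3 / κ ^ 3)
        = (s ^ 2 * κ ^ 2 - (c ^ 2 - 2 * q * c ^ 3 / κ ^ 2)) / κ := by field_simp
    rw [h1, abs_div, abs_of_pos hκ, div_mul_eq_mul_div]
    gcongr
    refine hmain.trans ?_
    gcongr; linarith
  · have h1 : s - c / κ = -(δ / κ) := by rw [hδ']; field_simp; ring
    rw [h1, abs_neg, abs_div, abs_of_pos hκ, div_mul_eq_mul_div]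
    gcongr
    refine hδ.trans ?_
    gcongr; linarith

/-- For `y > 0` and `u = v/y`, the inequality `u² ≤ Au + 2A` fails once `u > 2A + 1`. It serves with
`y = c²` to bound the orthogonal component of a minimizer. -/
theorem le_of_sq_le_linear {A y v : ℝ} (hA : 0 ≤ A) (hy : 0 ≤ y)
    (h : v ^ 2 ≤ A * y * v + 2 * A * y ^ 2) : v ≤ (2 * A + 1) * y := by
  by_contra! hlt
  have hv0 : 0 < v := lt_of_le_of_lt (by positivity) hlt
  have h1 : 0 < (v - (2 * A + 1) * y) * (v + (A + 1) * y) :=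
    mul_pos (by linarith) (by positivity)
  have h2 : 0 ≤ (2 * A ^ 2 + A + 1) * y ^ 2 := by positivity
  nlinarith

section ConstrainedMinimum

variable {H : Type*} [NormedAddCommGroup H] [InnerProductSpace ℝ H]
  {G : H → ℝ} {k : H} {r L : ℝ}

/-- Decompose `w = s k + v` with `v ⟂ k`. The linear part of `G` does not see `v`, so `G w` and `G
(s k)` differ by `O(|c|‖v‖)`, and `s` solves the scalar equation of `quadratic_level_estimate`. The
clause on multiples of `k` lets the same expansion be applied to a competitor on the ray, where `v =
0`. -/
theorem QuadControl.level_norm_expansion (hG : QuadControl G (innerSL ℝ k) r L) (hr : 0 < r)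
    (hk : k ≠ 0) {q C : ℝ} (hC : 0 ≤ C)
    (hray : ∀ s : ℝ, ‖s • k‖ ≤ r → |G (s • k) - s * ‖k‖ ^ 2 - s ^ 2 * q| ≤ C * |s| ^ 3)
    {N : ℝ} (hN : 0 ≤ N) :
    ∃ A : ℝ, 0 ≤ A ∧ ∀ (c : ℝ) (w : H), |c| ≤ 1 → ‖w‖ ≤ r → ‖w‖ ≤ N * |c| → G w = c →
      ∃ (s : ℝ) (v : H), w = s • k + v ∧ (∀ s' : ℝ, w = s' • k → v = 0) ∧
        |‖w‖ ^ 2 - ‖v‖ ^ 2 - (c ^ 2 / ‖k‖ ^ 2 - 2 * q * c ^ 3 / (‖k‖ ^ 2) ^ 3)|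
          ≤ A * (c ^ 2 * ‖v‖ + c ^ 4) ∧ |s - c / ‖k‖ ^ 2| ≤ A * c ^ 2 := by
  have hk0 : 0 < ‖k‖ := norm_pos_iff.mpr hk
  have hL := hG.nonneg hr.le
  have hκ : 0 < ‖k‖ ^ 2 := by positivity
  set N' := N + N / ‖k‖ with hN'
  have hN'0 : 0 ≤ N' := by positivity
  obtain ⟨A, hA, hmain⟩ := quadratic_level_estimate (κ := ‖k‖ ^ 2) hκ (q := q)
    (B := 2 * L * N + C * N' ^ 3) (N := N') (by positivity) hN'0
  refine ⟨A, hA, fun c w hc hwr hwN hGw => ?_⟩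
  set s := inner ℝ k w / ‖k‖ ^ 2 with hs
  set v := w - s • k with hv
  have hsκ : s * ‖k‖ ^ 2 = inner ℝ k w := by rw [hs]; field_simp
  have horth : inner ℝ k v = 0 := by
    rw [hv, inner_sub_right, inner_smul_right, real_inner_self_eq_norm_sq, hsκ, sub_self]
  have hwv : w = s • k + v := by rw [hv]; abel
  have hnorm : ‖w‖ ^ 2 = s ^ 2 * ‖k‖ ^ 2 + ‖v‖ ^ 2 := by
    conv_lhs => rw [hwv]
    rw [norm_add_sq_real, inner_smul_left, horth, norm_smul, mul_pow, Real.norm_eq_abs, sq_abs]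
    simp
  have hvw : ‖v‖ ≤ ‖w‖ :=
    le_of_sq_le_sq (by rw [hnorm]; nlinarith [sq_nonneg (s * ‖k‖)]) (norm_nonneg _)
  have hskw : ‖s • k‖ ≤ ‖w‖ := by
    refine le_of_sq_le_sq ?_ (norm_nonneg _)
    rw [hnorm, norm_smul, mul_pow, Real.norm_eq_abs, sq_abs]
    nlinarith [sq_nonneg ‖v‖]
  have hc0 := abs_nonneg c
  have hsN : |s| ≤ N' * |c| := by
    have h1 : |s| * ‖k‖ ≤ N * |c| := by
      rw [← Real.norm_eq_abs s, ← norm_smul]; exact hskw.trans hwN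
    calc |s| = |s| * ‖k‖ / ‖k‖ := by field_simp
      _ ≤ N * |c| / ‖k‖ := by gcongr
      _ = N / ‖k‖ * |c| := by ring
      _ ≤ N' * |c| := by gcongr; rw [hN']; linarith
  have hvN : ‖v‖ ≤ N' * |c| := by
    refine hvw.trans (hwN.trans ?_)
    gcongr
    have : 0 ≤ N / ‖k‖ := by positivity
    linarith
  have hlin := hG.lin w (s • k) hwr (hskw.trans hwr)
  have hinv : (innerSL ℝ k) (w - s • k) = 0 := by simpa using horth
  rw [hinv, hGw, sub_zero, ← hv] at hlin
  have hrays := hray s (hskw.trans hwr)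
  have hest : |c - s * ‖k‖ ^ 2 - s ^ 2 * q|
      ≤ (2 * L * N + C * N' ^ 3) * (|c| * ‖v‖ + |c| ^ 3) := by
    have h1 : c - s * ‖k‖ ^ 2 - s ^ 2 * q
        = (c - G (s • k)) + (G (s • k) - s * ‖k‖ ^ 2 - s ^ 2 * q) := by ring
    rw [h1]
    have h2 : L * (‖w‖ + ‖s • k‖) * ‖v‖ ≤ L * (N * |c| + N * |c|) * ‖v‖ := by
      gcongr; exact hskw.trans hwN
    have h3 : C * |s| ^ 3 ≤ C * (N' * |c|) ^ 3 := by gcongr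
    have h4 : 0 ≤ 2 * L * N * |c| ^ 3 := by positivity
    have h5 : 0 ≤ C * N' ^ 3 * (|c| * ‖v‖) := by positivity
    calc _ ≤ |c - G (s • k)| + |G (s • k) - s * ‖k‖ ^ 2 - s ^ 2 * q| := abs_add_le _ _
      _ ≤ L * (N * |c| + N * |c|) * ‖v‖ + C * (N' * |c|) ^ 3 :=
        add_le_add (hlin.trans h2) (hrays.trans h3)
      _ ≤ _ := by rw [mul_pow]; nlinarith
  obtain ⟨h1, h2⟩ := hmain c s ‖v‖ hc hsN (norm_nonneg _) hvN hest
  refine ⟨s, v, hwv, fun s' hs' => ?_, ?_, h2⟩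
  · have : s = s' := by
      rw [hs, hs', inner_smul_right, real_inner_self_eq_norm_sq]; field_simp
    rw [hv, hs', this, sub_self]
  · rw [hnorm]
    convert h1 using 2
    ring

/-- Second order expansion of the minimal squared norm on the level sets of `G` near the origin,
with existence of the minimizers and their first order expansion. -/
theorem QuadControl.constrained_minimum [CompleteSpace H]
    (hG : QuadControl G (innerSL ℝ k) r L) (hr : 0 < r) (hk : k ≠ 0) {q C : ℝ} (hC : 0 ≤ C)
    (hray : ∀ s : ℝ, ‖s • k‖ ≤ r → |G (s • k) - s * ‖k‖ ^ 2 - s ^ 2 * q| ≤ C * |s| ^ 3) :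
    ∃ ε > 0, ∃ A : ℝ, 0 ≤ A ∧ ∀ c : ℝ, |c| ≤ ε → ∃ w : H, ‖w‖ ≤ r ∧ G w = c ∧
      (∀ w' : H, ‖w'‖ ≤ r → G w' = c → ‖w‖ ≤ ‖w'‖) ∧
      |‖w‖ ^ 2 - (c ^ 2 / ‖k‖ ^ 2 - 2 * q * c ^ 3 / (‖k‖ ^ 2) ^ 3)| ≤ A * c ^ 4 ∧
      ‖w‖ ≤ A * |c| ∧
      ∀ w' : H, ‖w'‖ ≤ r → G w' = c → ‖w'‖ ≤ ‖w‖ → ‖w' - (c / ‖k‖ ^ 2) • k‖ ≤ A * c ^ 2 := by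
  have hk0 : 0 < ‖k‖ := norm_pos_iff.mpr hk
  have hG0 : G 0 = 0 := by
    have := hray 0 (by simpa using hr.le)
    simpa using this
  obtain ⟨ε, hε, hmin⟩ := hG.exists_level_minimizer hr hk hG0
  set N := 2 / ‖k‖ ^ 2 * ‖k‖ with hN
  have hN0 : 0 ≤ N := by positivity
  obtain ⟨A, hA, hexp⟩ := hG.level_norm_expansion hr hk hC hray hN0
  set A₂ := 2 * A + 1 with hA₂
  have hkey : ∀ c : ℝ, |c| ≤ min ε 1 → ∀ (s₀ : ℝ), ‖s₀ • k‖ ≤ N * |c| → ‖s₀ • k‖ ≤ r →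
      G (s₀ • k) = c → ∀ w : H, ‖w‖ ≤ r → G w = c → ‖w‖ ≤ ‖s₀ • k‖ →
      |‖w‖ ^ 2 - (c ^ 2 / ‖k‖ ^ 2 - 2 * q * c ^ 3 / (‖k‖ ^ 2) ^ 3)|
        ≤ (A * (A₂ + 1) + A₂ ^ 2) * c ^ 4 ∧
      ‖w - (c / ‖k‖ ^ 2) • k‖ ≤ (A₂ + A * ‖k‖) * c ^ 2 := by
    intro c hc s₀ hs₀N hs₀r hs₀G w hwr hwG hws
    have hc1 : |c| ≤ 1 := hc.trans (min_le_right _ _)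
    obtain ⟨s₁, v₁, -, hv₁, h1, -⟩ := hexp c (s₀ • k) hc1 hs₀r hs₀N hs₀G
    rw [hv₁ s₀ rfl] at h1
    obtain ⟨s, v, hwsv, -, h2, h3⟩ := hexp c w hc1 hwr (hws.trans hs₀N) hwG
    simp only [norm_zero, mul_zero, zero_add, ne_eq, OfNat.ofNat_ne_zero, not_false_eq_true,
      zero_pow, sub_zero] at h1
    have hsq : ‖w‖ ^ 2 ≤ ‖s₀ • k‖ ^ 2 := by gcongr
    have hc4 : 0 ≤ c ^ 4 := by positivity
    have hv : ‖v‖ ≤ A₂ * c ^ 2 := by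
      have h1' := (abs_le.mp h1).2
      have h2' := (abs_le.mp h2).1
      -- Both expansions have the same main part in `c`; as `‖w‖` does not exceed the norm of the
      -- ray point, subtraction leaves only the error terms above `‖v‖²`.
      have h4 : ‖v‖ ^ 2 ≤ A * c ^ 2 * ‖v‖ + 2 * A * c ^ 4 := by nlinarith
      exact le_of_sq_le_linear hA (sq_nonneg c) (by rw [← pow_mul]; exact h4)
    have hA₂0 : 0 ≤ A₂ := by positivity
    constructor
    · have hsplit : ‖w‖ ^ 2 - (c ^ 2 / ‖k‖ ^ 2 - 2 * q * c ^ 3 / (‖k‖ ^ 2) ^ 3)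
          = (‖w‖ ^ 2 - ‖v‖ ^ 2 - (c ^ 2 / ‖k‖ ^ 2 - 2 * q * c ^ 3 / (‖k‖ ^ 2) ^ 3)) + ‖v‖ ^ 2 := by
        ring
      rw [hsplit]
      calc _ ≤ _ := abs_add_le _ _
        _ ≤ A * (c ^ 2 * ‖v‖ + c ^ 4) + ‖v‖ ^ 2 := by
          rw [abs_of_nonneg (sq_nonneg ‖v‖)]; gcongr
        _ ≤ A * (c ^ 2 * (A₂ * c ^ 2) + c ^ 4) + (A₂ * c ^ 2) ^ 2 := by gcongr
        _ = _ := by ring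
    · have hsplit : w - (c / ‖k‖ ^ 2) • k = v + (s - c / ‖k‖ ^ 2) • k := by
        conv_lhs => rw [hwsv]
        rw [sub_smul]; abel
      rw [hsplit]
      calc _ ≤ ‖v‖ + ‖(s - c / ‖k‖ ^ 2) • k‖ := norm_add_le _ _
        _ = ‖v‖ + |s - c / ‖k‖ ^ 2| * ‖k‖ := by rw [norm_smul, Real.norm_eq_abs]
        _ ≤ A₂ * c ^ 2 + A * c ^ 2 * ‖k‖ := by gcongr
        _ = _ := by ring
  have hA₂0 : 0 ≤ A₂ := by positivity
  refine ⟨min ε 1, by positivity, N + (A * (A₂ + 1) + A₂ ^ 2) + (A₂ + A * ‖k‖), by positivity,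
    fun c hc => ?_⟩
  obtain ⟨s₀, hs₀, hs₀r, hs₀G, w, hwr, hwG, hwmin⟩ := hmin c (hc.trans (min_le_left _ _))
  have hs₀N : ‖s₀ • k‖ ≤ N * |c| := by
    rw [norm_smul, Real.norm_eq_abs, hN, mul_right_comm]
    gcongr
  have hws := hwmin _ hs₀r hs₀G
  have hc2 : 0 ≤ c ^ 2 := by positivity
  have hc4 : 0 ≤ c ^ 4 := by positivity
  have hc0 := abs_nonneg c
  have p1 : 0 ≤ A * (A₂ + 1) + A₂ ^ 2 := by positivity
  have p2 : 0 ≤ A₂ + A * ‖k‖ := by positivity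
  refine ⟨w, hwr, hwG, hwmin, ?_, ?_, fun w' hw'r hw'G hw' => ?_⟩
  · exact (hkey c hc s₀ hs₀N hs₀r hs₀G w hwr hwG hws).1.trans
      (mul_le_mul_of_nonneg_right (by linarith) hc4)
  · exact (hws.trans hs₀N).trans (mul_le_mul_of_nonneg_right (by linarith) hc0)
  · exact (hkey c hc s₀ hs₀N hs₀r hs₀G w' hw'r hw'G (hw'.trans hws)).2.trans
      (mul_le_mul_of_nonneg_right (by linarith) hc2)

end ConstrainedMinimum

/-! ### Stability of quadratic control under composition, product and integration -/

namespace QuadControl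

variable {X : Type*} [NormedAddCommGroup X] [NormedSpace ℝ X] {F F₁ F₂ : X → ℝ}
  {l l₁ l₂ : X →L[ℝ] ℝ} {r L L₁ L₂ : ℝ}

theorem abs_le_of_map_zero (h : QuadControl F l r L) (hr : 0 ≤ r) (h0 : F 0 = 0) {a : X}
    (ha : ‖a‖ ≤ r) : |F a| ≤ L * ‖a‖ := by
  simpa [h0] using h.lip a 0 ha (by simpa using hr)

/-- As `F 0 = 0`, both functions are linearized at the origin and the chain rule gives `p • l`. The
factor `(1 + L)²` dominates the constants `1`, `L` and `L + L²` of the separate estimates. -/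
theorem comp (h : QuadControl F l r L) (hr : 0 ≤ r) (h0 : F 0 = 0) {f : ℝ → ℝ} {p r' L' : ℝ}
    (hf : QuadControl f (p • ContinuousLinearMap.id ℝ ℝ) r' L') (hrr : L * r ≤ r') :
    QuadControl (fun a => f (F a)) (p • l) r (L' * (1 + L) ^ 2) := by
  have hL := h.nonneg hr
  have hr' : 0 ≤ r' := (mul_nonneg hL hr).trans hrr
  have hL' := hf.nonneg hr'
  have hF : ∀ a, ‖a‖ ≤ r → ‖F a‖ ≤ r' := fun a ha => by
    rw [Real.norm_eq_abs]
    exact (h.abs_le_of_map_zero hr h0 ha).trans (le_trans (by gcongr) hrr)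
  have hp : ∀ x : ℝ, |p * x| ≤ L' * |x| := fun x => by simpa using hf.map x
  have k1 : L' ≤ L' * (1 + L) ^ 2 := le_mul_of_one_le_right hL' (by nlinarith)
  have k2 : L' * L ≤ L' * (1 + L) ^ 2 := by gcongr; nlinarith
  have k3 : L' * L + L' * L ^ 2 ≤ L' * (1 + L) ^ 2 := by nlinarith [mul_nonneg hL' hL]
  refine ⟨fun a ha => (hf.bound _ (hF a ha)).trans k1, fun v => ?_, fun a b ha hb => ?_,
    fun a b ha hb => ?_, fun a b ha hb => ?_⟩
  · calc |(p • l) v| = |p * l v| := by simp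
      _ ≤ L' * |l v| := hp _
      _ ≤ L' * (L * ‖v‖) := by gcongr; exact h.map v
      _ = L' * L * ‖v‖ := by ring
      _ ≤ _ := by gcongr
  · have := hf.lip _ _ (hF a ha) (hF b hb)
    rw [Real.norm_eq_abs] at this
    calc _ ≤ _ := this
      _ ≤ L' * (L * ‖a - b‖) := by gcongr; exact h.lip a b ha hb
      _ = L' * L * ‖a - b‖ := by ring
      _ ≤ _ := by gcongr
  · have hm := midpoint_norm_le ha hb
    have hmF : ‖(1 / 2 : ℝ) • (F a + F b)‖ ≤ r' := midpoint_norm_le (hF a ha) (hF b hb)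
    have h1 := hf.lip _ _ (hF _ hm) hmF
    have h2 := hf.mid _ _ (hF a ha) (hF b hb)
    have h3 : ‖F ((1 / 2 : ℝ) • (a + b)) - (1 / 2 : ℝ) • (F a + F b)‖ ≤ L * ‖a - b‖ ^ 2 := by
      have := h.mid a b ha hb
      rw [Real.norm_eq_abs, smul_eq_mul]
      convert this using 3; ring
    have h4 : ‖F a - F b‖ ≤ L * ‖a - b‖ := h.lip a b ha hb
    calc _ ≤ |f (F ((1 / 2 : ℝ) • (a + b))) - f ((1 / 2 : ℝ) • (F a + F b))|
          + |f ((1 / 2 : ℝ) • (F a + F b)) - (f (F a) + f (F b)) / 2| := abs_sub_le _ _ _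
      _ ≤ L' * (L * ‖a - b‖ ^ 2) + L' * (L * ‖a - b‖) ^ 2 := by
        refine add_le_add (h1.trans ?_) (h2.trans ?_) <;> gcongr
      _ = (L' * L + L' * L ^ 2) * ‖a - b‖ ^ 2 := by ring
      _ ≤ _ := by gcongr
  · have h1 := hf.lin _ _ (hF a ha) (hF b hb)
    have h2 := h.lin a b ha hb
    have h4 : ‖F a - F b‖ ≤ L * ‖a - b‖ := h.lip a b ha hb
    have h5 : ‖F a‖ ≤ L * ‖a‖ := h.abs_le_of_map_zero hr h0 ha
    have h6 : ‖F b‖ ≤ L * ‖b‖ := h.abs_le_of_map_zero hr h0 hb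
    have e : f (F a) - f (F b) - (p • l) (a - b)
        = (f (F a) - f (F b) - (p • ContinuousLinearMap.id ℝ ℝ) (F a - F b))
          + p * (F a - F b - l (a - b)) := by simp; ring
    rw [e]
    calc _ ≤ _ := abs_add_le _ _
      _ ≤ L' * (L * ‖a‖ + L * ‖b‖) * (L * ‖a - b‖)
          + L' * (L * (‖a‖ + ‖b‖) * ‖a - b‖) := by
        refine add_le_add (h1.trans ?_) ((hp _).trans ?_) <;> gcongr
      _ = (L' * L + L' * L ^ 2) * (‖a‖ + ‖b‖) * ‖a - b‖ := by ring
      _ ≤ _ := by gcongr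

/-- The midpoint defect of a product is that of each factor plus `-1/4` of the product of the
increments, hence the constant `9/4`. The linearization, where the other factor is frozen at `0`, is
what requires `3`. -/
theorem mul (h₁ : QuadControl F₁ l₁ r L₁) (h₂ : QuadControl F₂ l₂ r L₂) (hr : 0 ≤ r) :
    QuadControl (fun a => F₁ a * F₂ a) (F₂ 0 • l₁ + F₁ 0 • l₂) r (3 * (L₁ * L₂)) := by
  have hL₁ := h₁.nonneg hr
  have hL₂ := h₂.nonneg hr
  have hLL : 0 ≤ L₁ * L₂ := by positivity
  have hz : ‖(0 : X)‖ ≤ r := by simpa using hr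
  refine ⟨fun a ha => ?_, fun v => ?_, fun a b ha hb => ?_,
    fun a b ha hb => ?_, fun a b ha hb => ?_⟩
  · rw [abs_mul]
    calc _ ≤ L₁ * L₂ := by gcongr; exacts [h₁.bound a ha, h₂.bound a ha]
      _ ≤ _ := by linarith
  · calc |(F₂ 0 • l₁ + F₁ 0 • l₂) v| = |F₂ 0 * l₁ v + F₁ 0 * l₂ v| := by simp
      _ ≤ |F₂ 0 * l₁ v| + |F₁ 0 * l₂ v| := abs_add_le _ _
      _ = |F₂ 0| * |l₁ v| + |F₁ 0| * |l₂ v| := by rw [abs_mul, abs_mul]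
      _ ≤ L₂ * (L₁ * ‖v‖) + L₁ * (L₂ * ‖v‖) := by
        gcongr
        exacts [h₂.bound 0 hz, h₁.map v, h₁.bound 0 hz, h₂.map v]
      _ = 2 * (L₁ * L₂) * ‖v‖ := by ring
      _ ≤ _ := by gcongr; norm_num
  · have e : F₁ a * F₂ a - F₁ b * F₂ b = (F₁ a - F₁ b) * F₂ a + F₁ b * (F₂ a - F₂ b) := by ring
    rw [e]
    calc _ ≤ _ := abs_add_le _ _
      _ = |F₁ a - F₁ b| * |F₂ a| + |F₁ b| * |F₂ a - F₂ b| := by rw [abs_mul, abs_mul]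
      _ ≤ (L₁ * ‖a - b‖) * L₂ + L₁ * (L₂ * ‖a - b‖) := by
        gcongr
        exacts [h₁.lip a b ha hb, h₂.bound a ha, h₁.bound b hb, h₂.lip a b ha hb]
      _ = 2 * (L₁ * L₂) * ‖a - b‖ := by ring
      _ ≤ _ := by gcongr; norm_num
  · have hm := midpoint_norm_le ha hb
    set m := (1 / 2 : ℝ) • (a + b)
    have e : F₁ m * F₂ m - (F₁ a * F₂ a + F₁ b * F₂ b) / 2
        = (F₁ m - (F₁ a + F₁ b) / 2) * F₂ m + (F₁ a + F₁ b) / 2 * (F₂ m - (F₂ a + F₂ b) / 2)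
          + -(1 / 4 * ((F₁ a - F₁ b) * (F₂ a - F₂ b))) := by ring
    have havg : |(F₁ a + F₁ b) / 2| ≤ L₁ := by
      have h1 := abs_le.mp (h₁.bound a ha)
      have h2 := abs_le.mp (h₁.bound b hb)
      exact abs_le.mpr ⟨by linarith, by linarith⟩
    rw [e]
    calc _ ≤ |(F₁ m - (F₁ a + F₁ b) / 2) * F₂ m|
          + |(F₁ a + F₁ b) / 2 * (F₂ m - (F₂ a + F₂ b) / 2)|
          + |-(1 / 4 * ((F₁ a - F₁ b) * (F₂ a - F₂ b)))| := abs_add_three _ _ _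
      _ = |F₁ m - (F₁ a + F₁ b) / 2| * |F₂ m|
          + |(F₁ a + F₁ b) / 2| * |F₂ m - (F₂ a + F₂ b) / 2|
          + 1 / 4 * (|F₁ a - F₁ b| * |F₂ a - F₂ b|) := by
        rw [abs_neg, abs_mul, abs_mul, abs_mul (1 / 4), abs_mul (F₁ a - F₁ b)]; norm_num
      _ ≤ (L₁ * ‖a - b‖ ^ 2) * L₂ + L₁ * (L₂ * ‖a - b‖ ^ 2)
          + 1 / 4 * ((L₁ * ‖a - b‖) * (L₂ * ‖a - b‖)) := by
        gcongr
        exacts [h₁.mid a b ha hb, h₂.bound m hm, h₂.mid a b ha hb, h₁.lip a b ha hb,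
          h₂.lip a b ha hb]
      _ = 9 / 4 * (L₁ * L₂) * ‖a - b‖ ^ 2 := by ring
      _ ≤ _ := by gcongr; norm_num
  · have e : F₁ a * F₂ a - F₁ b * F₂ b - (F₂ 0 • l₁ + F₁ 0 • l₂) (a - b)
        = F₂ a * (F₁ a - F₁ b - l₁ (a - b)) + F₁ b * (F₂ a - F₂ b - l₂ (a - b))
          + ((F₂ a - F₂ 0) * l₁ (a - b) + (F₁ b - F₁ 0) * l₂ (a - b)) := by simp; ring
    have z1 : |F₂ a - F₂ 0| ≤ L₂ * ‖a‖ := by simpa using h₂.lip a 0 ha hz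
    have z2 : |F₁ b - F₁ 0| ≤ L₁ * ‖b‖ := by simpa using h₁.lip b 0 hb hz
    rw [e]
    calc _ ≤ (|F₂ a * (F₁ a - F₁ b - l₁ (a - b))| + |F₁ b * (F₂ a - F₂ b - l₂ (a - b))|)
          + (|(F₂ a - F₂ 0) * l₁ (a - b)| + |(F₁ b - F₁ 0) * l₂ (a - b)|) :=
        (abs_add_le _ _).trans (add_le_add (abs_add_le _ _) (abs_add_le _ _))
      _ = (|F₂ a| * |F₁ a - F₁ b - l₁ (a - b)| + |F₁ b| * |F₂ a - F₂ b - l₂ (a - b)|)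
          + (|F₂ a - F₂ 0| * |l₁ (a - b)| + |F₁ b - F₁ 0| * |l₂ (a - b)|) := by
        simp only [abs_mul]
      _ ≤ (L₂ * (L₁ * (‖a‖ + ‖b‖) * ‖a - b‖) + L₁ * (L₂ * (‖a‖ + ‖b‖) * ‖a - b‖))
          + ((L₂ * ‖a‖) * (L₁ * ‖a - b‖) + (L₁ * ‖b‖) * (L₂ * ‖a - b‖)) := by
        gcongr
        exacts [h₂.bound a ha, h₁.lin a b ha hb, h₁.bound b hb, h₂.lin a b ha hb, h₁.map _,
          h₂.map _]
      _ = _ := by ring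

theorem sub_const (h : QuadControl F l r L) (c : ℝ) :
    QuadControl (fun a => F a - c) l r (L + |c|) := by
  have hL : L ≤ L + |c| := by linarith [abs_nonneg c]
  have h' := h.mono le_rfl hL
  refine ⟨fun a ha => (abs_sub _ _).trans (by linarith [h.bound a ha]), h'.map,
    fun a b ha hb => ?_, fun a b ha hb => ?_, fun a b ha hb => ?_⟩
  · simpa using h'.lip a b ha hb
  · convert h'.mid a b ha hb using 2; ring
  · convert h'.lin a b ha hb using 2; ring

theorem integral {F : ℝ → X → ℝ} {l : ℝ → X →L[ℝ] ℝ} {l' : X →L[ℝ] ℝ}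
    (h : ∀ t ∈ Icc (0 : ℝ) 1, QuadControl (F t) (l t) r L)
    (hF : ∀ a, ‖a‖ ≤ r → IntervalIntegrable (fun t => F t a) volume 0 1)
    (hl : ∀ v, IntervalIntegrable (fun t => l t v) volume 0 1)
    (hl' : ∀ v, l' v = ∫ t in (0 : ℝ)..1, l t v) :
    QuadControl (fun a => ∫ t in (0 : ℝ)..1, F t a) l' r L := by
  have key : ∀ {φ : ℝ → ℝ} {C : ℝ}, (∀ t ∈ Icc (0 : ℝ) 1, |φ t| ≤ C) →
      |∫ t in (0 : ℝ)..1, φ t| ≤ C := by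
    intro φ C hφ
    have := intervalIntegral.norm_integral_le_of_norm_le_const (a := (0 : ℝ)) (b := 1) (f := φ)
      (C := C) fun t ht => hφ t (by
        rw [uIoc_of_le zero_le_one] at ht; exact Ioc_subset_Icc_self ht)
    simpa using this
  refine ⟨fun a ha => key fun t ht => (h t ht).bound a ha, fun v => ?_, fun a b ha hb => ?_,
    fun a b ha hb => ?_, fun a b ha hb => ?_⟩
  · rw [hl']; exact key fun t ht => (h t ht).map v
  · rw [← intervalIntegral.integral_sub (hF a ha) (hF b hb)]
    exact key fun t ht => (h t ht).lip a b ha hb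
  · have hm := midpoint_norm_le ha hb
    rw [← intervalIntegral.integral_add (hF a ha) (hF b hb), ← intervalIntegral.integral_div,
      ← intervalIntegral.integral_sub (hF _ hm) (((hF a ha).add (hF b hb)).div_const 2)]
    exact key fun t ht => (h t ht).mid a b ha hb
  · rw [hl', ← intervalIntegral.integral_sub (hF a ha) (hF b hb),
      ← intervalIntegral.integral_sub ((hF a ha).sub (hF b hb)) (hl _)]
    exact key fun t ht => (h t ht).lin a b ha hb

end QuadControl

/-! ### Scalar `C²` functions and autonomous scalar flows -/

/-- A function that is `C²` at the origin satisfies a quadratic control near the origin. -/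
theorem ContDiffAt.exists_quadControl {f : ℝ → ℝ} {p : ℝ} (hf : ContDiffAt ℝ 2 f 0)
    (hp : HasDerivAt f p 0) :
    ∃ r > 0, ∃ L, QuadControl f (p • ContinuousLinearMap.id ℝ ℝ) r L := by
  have hd1 : ContDiffAt ℝ 1 (deriv f) 0 :=
    (hf.fderiv_right (m := 1) (by norm_num)).clm_apply contDiffAt_const
  obtain ⟨K, s, hs, hK⟩ := hd1.exists_lipschitzOnWith
  have hdiff : ∀ᶠ x in 𝓝 (0 : ℝ), DifferentiableAt ℝ f x := by
    filter_upwards [hf.eventually (by simp)] with x hx using hx.differentiableAt (by simp)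
  obtain ⟨r, hr, hball⟩ := Metric.nhds_basis_closedBall.mem_iff.mp (inter_mem hs hdiff)
  have hmem : ∀ x : ℝ, |x| ≤ r → x ∈ s ∧ HasDerivAt f (deriv f x) x := fun x hx =>
    ⟨(hball (by simpa using hx)).1, (hball (a := x) (by simpa using hx)).2.hasDerivAt⟩
  have hdK : ∀ x y : ℝ, |x| ≤ r → |y| ≤ r → |deriv f x - deriv f y| ≤ K * |x - y| := by
    intro x y hx hy
    simpa [Real.dist_eq] using hK.dist_le_mul x (hmem x hx).1 y (hmem y hy).1
  -- Mean value inequality for `f` minus its linear part at `x₀`, using that `f'` is Lipschitz. The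
  -- base point `x₀ = 0` yields `lin`, and the midpoint of `a` and `b` yields `mid`.
  have hmv : ∀ (a b x₀ M : ℝ), |a| ≤ r → |b| ≤ r → |x₀| ≤ r →
      (∀ x ∈ uIcc a b, |x - x₀| ≤ M) →
      |f a - f b - deriv f x₀ * (a - b)| ≤ K * M * |a - b| := by
    intro a b x₀ M ha hb hx₀ hM
    have hsub : ∀ x ∈ uIcc a b, |x| ≤ r := by
      intro x hx
      have : x ∈ Icc (-r) r := (convex_Icc (-r) r).ordConnected.uIcc_subset
        (abs_le.mp ha) (abs_le.mp hb) hx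
      exact abs_le.mpr this
    have := (convex_uIcc a b).norm_image_sub_le_of_norm_hasDerivWithin_le
      (f := fun x => f x - deriv f x₀ * x) (f' := fun x => deriv f x - deriv f x₀) (C := K * M)
      (x := b) (y := a)
      (fun x hx => ((hmem x (hsub x hx)).2.sub
        (by simpa using (hasDerivAt_id x).const_mul (deriv f x₀))).hasDerivWithinAt)
      (fun x hx => (hdK x x₀ (hsub x hx) hx₀).trans (by gcongr; exact hM x hx))
      right_mem_uIcc left_mem_uIcc
    simp only [Real.norm_eq_abs] at this
    convert this using 2; ring
  have h0 : deriv f 0 = p := hp.deriv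
  have hr0 : |(0 : ℝ)| ≤ r := by simpa using hr.le
  have hlin : ∀ a b : ℝ, |a| ≤ r → |b| ≤ r →
      |f a - f b - p * (a - b)| ≤ K * (|a| + |b|) * |a - b| := by
    intro a b ha hb
    rw [← h0]
    refine hmv a b 0 _ ha hb hr0 fun x hx => ?_
    rw [sub_zero]
    rcases mem_uIcc.mp hx with hx | hx <;>
    · refine abs_le.mpr ⟨?_, ?_⟩ <;>
      linarith [le_abs_self a, le_abs_self b, neg_abs_le a, neg_abs_le b, abs_nonneg a,
        abs_nonneg b]
  have hlip : ∀ a b : ℝ, |a| ≤ r → |b| ≤ r → |f a - f b| ≤ (|p| + K * (2 * r)) * |a - b| := by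
    intro a b ha hb
    have e : f a - f b = p * (a - b) + (f a - f b - p * (a - b)) := by ring
    rw [e]
    calc _ ≤ _ := abs_add_le _ _
      _ ≤ |p| * |a - b| + K * (|a| + |b|) * |a - b| := by
        rw [abs_mul]; gcongr; exact hlin a b ha hb
      _ ≤ |p| * |a - b| + K * (r + r) * |a - b| := by gcongr
      _ = _ := by ring
  have hK0 : (0 : ℝ) ≤ K := K.2
  set M := |p| + K * (2 * r) with hM
  have hM0 : 0 ≤ M := by positivity
  refine ⟨r, hr, |f 0| + M * r + M + K, ⟨fun a ha => ?_, fun v => ?_, fun a b ha hb => ?_,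
    fun a b ha hb => ?_, fun a b ha hb => ?_⟩⟩
  · rw [Real.norm_eq_abs] at ha
    have h1 := hlip a 0 ha hr0
    rw [sub_zero] at h1
    have h2 : |f a| ≤ |f 0| + |f a - f 0| := by
      have := abs_add_le (f 0) (f a - f 0); simpa using this
    have h3 : M * |a| ≤ M * r := by gcongr
    linarith
  · have : |p| ≤ |f 0| + M * r + M + K := by
      have : 0 ≤ K * (2 * r) := by positivity
      have : 0 ≤ M * r := by positivity
      linarith [abs_nonneg (f 0)]
    simp only [FunLike.coe_smul, Pi.smul_apply, ContinuousLinearMap.coe_id', id_eq, smul_eq_mul, abs_mul, Real.norm_eq_abs]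
    gcongr
  · refine (hlip a b ha hb).trans ?_
    rw [Real.norm_eq_abs]
    gcongr
    have : 0 ≤ M * r := by positivity
    linarith [abs_nonneg (f 0)]
  · rw [Real.norm_eq_abs] at *
    set m := (1 / 2 : ℝ) • (a + b) with hm
    have hm' : m = (a + b) / 2 := by rw [hm, smul_eq_mul]; ring
    have hmr : |m| ≤ r := by
      rw [← Real.norm_eq_abs] at *
      exact QuadControl.midpoint_norm_le ha hb
    have hx : ∀ x ∈ uIcc a b, |x - m| ≤ |a - b| := by
      intro x hx
      rw [hm']
      rcases mem_uIcc.mp hx with hx | hx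
      · rw [abs_sub_comm a b, abs_of_nonneg (by linarith : 0 ≤ b - a)]
        exact abs_le.mpr ⟨by linarith, by linarith⟩
      · rw [abs_of_nonneg (by linarith : 0 ≤ a - b)]
        exact abs_le.mpr ⟨by linarith, by linarith⟩
    have hmab : m ∈ uIcc a b := by
      rw [hm', mem_uIcc]
      rcases le_total a b with h | h
      · left; constructor <;> linarith
      · right; constructor <;> linarith
    have h1 := hmv a m m |a - b| ha hmr hmr fun x hxx =>
      hx x (uIcc_subset_uIcc left_mem_uIcc hmab hxx)
    have h2 := hmv b m m |a - b| hb hmr hmr fun x hxx =>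
      hx x (uIcc_subset_uIcc right_mem_uIcc hmab hxx)
    have e1 : |a - m| = |a - b| / 2 := by
      rw [hm', show a - (a + b) / 2 = (a - b) / 2 by ring, abs_div, abs_two]
    have e2 : |b - m| = |a - b| / 2 := by
      rw [hm', show b - (a + b) / 2 = -((a - b) / 2) by ring, abs_neg, abs_div, abs_two]
    rw [e1] at h1
    rw [e2] at h2
    have e : f m - (f a + f b) / 2 = -((f a - f m - deriv f m * (a - m))
        + (f b - f m - deriv f m * (b - m))) / 2 := by rw [hm']; ring
    rw [e, abs_div, abs_neg, abs_two]
    have h3 := abs_add_le (f a - f m - deriv f m * (a - m)) (f b - f m - deriv f m * (b - m))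
    have h4 : 0 ≤ (|f 0| + M * r + M) * |a - b| ^ 2 := by positivity
    have h5 : 0 ≤ K * |a - b| ^ 2 := by positivity
    nlinarith
  · simp only [Real.norm_eq_abs] at *
    have : f a - f b - (p • ContinuousLinearMap.id ℝ ℝ) (a - b) = f a - f b - p * (a - b) := by
      simp
    rw [this]
    refine (hlin a b ha hb).trans ?_
    gcongr
    have : 0 ≤ M * r := by positivity
    linarith [abs_nonneg (f 0)]

/-- The flow of an autonomous scalar equation `θ' = p(θ)`, `θ(0) = 0` with `p > 0`, together with
a globally defined primitive `B` of `1 / p` of which it is a local right inverse. -/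
theorem exists_local_flow {p : ℝ → ℝ} (hp : ContDiff ℝ 2 p) (hpos : ∀ v, 0 < p v) :
    ∃ B θ : ℝ → ℝ, (∀ v, HasDerivAt B (1 / p v) v) ∧ StrictMono B ∧ B 0 = 0 ∧ θ 0 = 0 ∧
      ContDiffAt ℝ 2 θ 0 ∧
      ∀ᶠ y in 𝓝 0, B (θ y) = y ∧ HasDerivAt θ (p (θ y)) y := by
  have hc : ContDiff ℝ 2 (fun v => 1 / p v) :=
    contDiff_const.div hp fun v => (hpos v).ne'
  set B : ℝ → ℝ := fun v => ∫ s in (0 : ℝ)..v, 1 / p s with hB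
  have hBd : ∀ v, HasDerivAt B (1 / p v) v := fun v =>
    hc.continuous.integral_hasStrictDerivAt 0 v |>.hasDerivAt
  have hmono : StrictMono B := strictMono_of_deriv_pos fun v => by
    rw [(hBd v).deriv]; exact one_div_pos.mpr (hpos v)
  have hBC : ContDiff ℝ 2 B := by
    have hd : deriv B = fun v => 1 / p v := funext fun v => (hBd v).deriv
    rw [show (2 : WithTop ℕ∞) = 1 + 1 by norm_num, contDiff_succ_iff_deriv]
    refine ⟨fun v => (hBd v).differentiableAt, by simp, ?_⟩
    rw [hd]; exact hc.of_le (by norm_num)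
  have hB0 : B 0 = 0 := by simp [hB]
  have hne : (1 / p 0) ≠ 0 := (one_div_pos.mpr (hpos 0)).ne'
  -- The inverse function theorem for the primitive: its local inverse is `C²` and has derivative `1
  -- / B' = p(θ)`, so it solves the equation.
  set e := hBC.contDiffAt.toOpenPartialHomeomorph B (a := 0)
    ((hBd 0).hasFDerivAt_equiv hne) (by norm_num) with he
  have heB : (e : ℝ → ℝ) = B := rfl
  have hsrc : (0 : ℝ) ∈ e.source := ContDiffAt.mem_toOpenPartialHomeomorph_source _ _ _
  have htgt : (0 : ℝ) ∈ e.target := by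
    have := e.map_source hsrc
    rwa [heB, hB0] at this
  have hsymm0 : e.symm 0 = 0 := by
    have := e.left_inv hsrc
    rwa [heB, hB0] at this
  refine ⟨B, e.symm, hBd, hmono, hB0, hsymm0, ?_, ?_⟩
  · exact e.contDiffAt_symm_deriv hne htgt (by rw [hsymm0]; exact hBd 0) hBC.contDiffAt
  · filter_upwards [e.open_target.mem_nhds htgt] with y hy
    refine ⟨e.right_inv hy, ?_⟩
    have := e.hasDerivAt_symm hy (one_div_pos.mpr (hpos (e.symm y))).ne' (hBd _)
    simpa using this

/-! ### Second-order expansions at the origin -/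

theorem isBigO_pow_succ_of_hasDerivAt {f f' : ℝ → ℝ} {n : ℕ}
    (hd : ∀ᶠ y in 𝓝 0, HasDerivAt f (f' y) y) (h0 : f 0 = 0)
    (hf' : f' =O[𝓝 0] fun y : ℝ => y ^ n) : f =O[𝓝 0] fun y : ℝ => y ^ (n + 1) := by
  obtain ⟨C, hC⟩ := hf'.bound
  obtain ⟨r, hr, hball⟩ := Metric.nhds_basis_closedBall.mem_iff.mp (inter_mem hd hC)
  refine IsBigO.of_bound C ?_
  filter_upwards [Metric.closedBall_mem_nhds (0 : ℝ) hr] with y hy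
  have hy' : |y| ≤ r := by simpa using hy
  have hmem : ∀ x ∈ Icc (-|y|) |y|, HasDerivAt f (f' x) x ∧ ‖f' x‖ ≤ C * ‖x ^ n‖ := fun x hx =>
    hball (a := x) (by simpa using (abs_le.mpr hx).trans hy')
  have hC0 : 0 ≤ C * |y| ^ n := by
    have := (hmem y ⟨neg_abs_le y, le_abs_self y⟩).2
    rw [norm_pow, Real.norm_eq_abs y] at this
    exact (norm_nonneg _).trans this
  have := (convex_Icc (-|y|) |y|).norm_image_sub_le_of_norm_hasDerivWithin_le
    (f := f) (f' := f') (C := C * |y| ^ n) (x := 0) (y := y)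
    (fun x hx => (hmem x hx).1.hasDerivWithinAt) (fun x hx => by
      refine (hmem x hx).2.trans ?_
      rw [norm_pow, Real.norm_eq_abs]
      -- The constant taken from the `O` bound has no known sign; a negative one forces `|y| ^ n =
      -- 0`, hence `y = 0` and `x = 0`.
      rcases le_or_gt 0 C with h | h
      · have := abs_le.mpr hx
        gcongr
      · have h1 : |y| ^ n ≤ 0 := nonpos_of_mul_nonneg_right hC0 h
        have h2 : |y| ^ n = 0 := le_antisymm h1 (by positivity)
        have hn : n ≠ 0 := by rintro rfl; simp at h2
        have h3 : |y| = 0 := by simpa [hn] using h2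
        have h4 : x = 0 := by
          have := abs_le.mpr hx
          rw [h3] at this
          exact abs_nonpos_iff.mp this
        simp [h3, h4])
    ⟨by simp, by simp⟩ ⟨neg_abs_le y, le_abs_self y⟩
  rw [h0, sub_zero, sub_zero, Real.norm_eq_abs y] at this
  rw [norm_pow, Real.norm_eq_abs y, pow_succ, ← mul_assoc]
  exact this

theorem isBigO_pow_of_le {m n : ℕ} (h : m ≤ n) :
    (fun y : ℝ => y ^ n) =O[𝓝 0] fun y : ℝ => y ^ m := by
  obtain ⟨d, rfl⟩ := Nat.exists_eq_add_of_le h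
  have h1 : (fun y : ℝ => y ^ d) =O[𝓝 0] fun _ : ℝ => (1 : ℝ) :=
    ((continuous_pow d).tendsto _).isBigO_one ℝ
  simpa [pow_add] using (isBigO_refl (fun y : ℝ => y ^ m) (𝓝 0)).mul h1

/-- `F` agrees with `a₀ + a₁ y + a₂ y²` up to `O(y³)` at the origin. -/
def HasQuadExpansion (F : ℝ → ℝ) (a₀ a₁ a₂ : ℝ) : Prop :=
  (fun y => F y - (a₀ + a₁ * y + a₂ * y ^ 2)) =O[𝓝 0] fun y : ℝ => y ^ 3

namespace HasQuadExpansion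

variable {F G : ℝ → ℝ} {a₀ a₁ a₂ b₀ b₁ b₂ : ℝ}

theorem isBigO_one (h : HasQuadExpansion F a₀ a₁ a₂) : F =O[𝓝 0] fun _ : ℝ => (1 : ℝ) := by
  have h1 : (fun y : ℝ => a₀ + a₁ * y + a₂ * y ^ 2) =O[𝓝 0] fun _ : ℝ => (1 : ℝ) := by
    refine Tendsto.isBigO_one ℝ (c := a₀ + a₁ * 0 + a₂ * 0 ^ 2) ?_
    exact Continuous.tendsto (by fun_prop) 0
  have h2 := h.trans (isBigO_pow_of_le (Nat.zero_le 3))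
  simpa using h2.add h1

theorem isBigO_id (h : HasQuadExpansion F 0 a₁ a₂) : F =O[𝓝 0] fun y : ℝ => y := by
  have h1 : (fun y : ℝ => 0 + a₁ * y + a₂ * y ^ 2) =O[𝓝 0] fun y : ℝ => y := by
    simp only [zero_add]
    refine ((isBigO_refl _ _).const_mul_left a₁).add (IsBigO.const_mul_left ?_ a₂)
    simpa using isBigO_pow_of_le (m := 1) (n := 2) (by norm_num)
  have h2 : _ =O[𝓝 0] fun y : ℝ => y ^ 1 := h.trans (isBigO_pow_of_le (by norm_num : 1 ≤ 3))
  simp only [pow_one] at h2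
  refine (h2.add h1).congr_left fun y => ?_
  ring

theorem mul (hF : HasQuadExpansion F a₀ a₁ a₂) (hG : HasQuadExpansion G b₀ b₁ b₂) :
    HasQuadExpansion (fun y => F y * G y) (a₀ * b₀) (a₀ * b₁ + a₁ * b₀)
      (a₀ * b₂ + a₁ * b₁ + a₂ * b₀) := by
  have h1 := IsBigO.mul hF hG.isBigO_one
  have hp : (fun y : ℝ => a₀ + a₁ * y + a₂ * y ^ 2) =O[𝓝 0] fun _ : ℝ => (1 : ℝ) :=
    (Continuous.tendsto (by fun_prop) 0 :
      Tendsto (fun y : ℝ => a₀ + a₁ * y + a₂ * y ^ 2) (𝓝 0) _).isBigO_one ℝ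
  have h2 := IsBigO.mul hp hG
  have h3 : (fun y : ℝ => (a₁ * b₂ + a₂ * b₁) * y ^ 3 + a₂ * b₂ * y ^ 4)
      =O[𝓝 0] fun y : ℝ => y ^ 3 :=
    ((isBigO_refl _ _).const_mul_left _).add ((isBigO_pow_of_le (by norm_num)).const_mul_left _)
  simp only [mul_one, one_mul] at h1 h2
  refine ((h1.add h2).add h3).congr_left fun y => ?_
  ring

theorem comp (hF : HasQuadExpansion F a₀ a₁ a₂) (hG : HasQuadExpansion G 0 b₁ b₂)
    (hG0 : Tendsto G (𝓝 0) (𝓝 0)) :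
    HasQuadExpansion (fun y => F (G y)) a₀ (a₁ * b₁) (a₁ * b₂ + a₂ * b₁ ^ 2) := by
  have h1 : (fun y => F (G y) - (a₀ + a₁ * G y + a₂ * G y ^ 2)) =O[𝓝 0] fun y : ℝ => y ^ 3 :=
    (hF.comp_tendsto hG0).trans (hG.isBigO_id.pow 3)
  have h2 := hG.mul hG
  refine ((h1.add (hG.const_mul_left a₁)).add (h2.const_mul_left a₂)).congr_left fun y => ?_
  ring

theorem const_mul (hF : HasQuadExpansion F a₀ a₁ a₂) (c : ℝ) :
    HasQuadExpansion (fun y => c * F y) (c * a₀) (c * a₁) (c * a₂) := by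
  refine (IsBigO.const_mul_left hF c).congr_left fun y => ?_
  ring

theorem exists_bound (hF : HasQuadExpansion F a₀ a₁ a₂) :
    ∃ r > 0, ∃ C, 0 ≤ C ∧ ∀ y : ℝ, |y| ≤ r →
      |F y - (a₀ + a₁ * y + a₂ * y ^ 2)| ≤ C * |y| ^ 3 := by
  obtain ⟨C, hC0, hC⟩ := hF.exists_pos
  obtain ⟨r, hr, hball⟩ := Metric.nhds_basis_closedBall.mem_iff.mp hC.bound
  refine ⟨r, hr, C, hC0.le, fun y hy => ?_⟩
  have : y ∈ Metric.closedBall (0 : ℝ) r := by simpa using hy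
  simpa using hball this

end HasQuadExpansion

theorem Real.hasQuadExpansion_exp : HasQuadExpansion Real.exp 1 1 (1 / 2) := by
  refine (Real.exp_sub_sum_range_isBigO_pow 3).congr_left fun y => ?_
  simp [Finset.sum_range_succ, Nat.factorial]
  ring

theorem ContDiffAt.isBigO_sub_linear {f : ℝ → ℝ} {p : ℝ} (hf : ContDiffAt ℝ 2 f 0)
    (hp : HasDerivAt f p 0) :
    (fun y => f y - f 0 - p * y) =O[𝓝 0] fun y : ℝ => y ^ 2 := by
  obtain ⟨r, hr, L, h⟩ := hf.exists_quadControl hp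
  refine IsBigO.of_bound L ?_
  filter_upwards [Metric.closedBall_mem_nhds (0 : ℝ) hr] with y hy
  have := h.lin y 0 (by simpa using hy) (by simpa using hr.le)
  simp only [sub_zero, norm_zero, add_zero, mul_assoc] at this
  rw [norm_pow, pow_two]
  simpa using this

/-- Bootstrap in `θ' = p(θ)`: from `θ = O(y)` comes `p(θ) = p(0) + O(y)`, integrated to `θ = p(0)y +
O(y²)`; inserted once more, `p(θ) = p(0) + p' p(0) y + O(y²)`, which integrates to the claim. -/
theorem hasQuadExpansion_flow {p θ : ℝ → ℝ} {p' : ℝ} (hp : ContDiff ℝ 2 p)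
    (hp' : HasDerivAt p p' 0) (h0 : θ 0 = 0)
    (hθ : ∀ᶠ y in 𝓝 0, HasDerivAt θ (p (θ y)) y) :
    HasQuadExpansion θ 0 (p 0) (p 0 * p' / 2) := by
  have hd0 : HasDerivAt θ (p (θ 0)) 0 := hθ.self_of_nhds
  have ht : Tendsto θ (𝓝 0) (𝓝 0) := by
    have := hd0.continuousAt.tendsto
    rwa [h0] at this
  have hθO : θ =O[𝓝 0] fun y : ℝ => y := by
    have := hd0.differentiableAt.isBigO_sub
    simpa [h0] using this
  have h1 : (fun y => p (θ y) - p 0 - p' * θ y) =O[𝓝 0] fun y : ℝ => y ^ 2 :=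
    (hp.contDiffAt.isBigO_sub_linear hp' |>.comp_tendsto ht).trans (hθO.pow 2)
  have h2 : (fun y => p (θ y) - p 0) =O[𝓝 0] fun y : ℝ => y ^ 1 := by
    have h2a : (fun y => p (θ y) - p 0 - p' * θ y) =O[𝓝 0] fun y : ℝ => y := by
      simpa using h1.trans (isBigO_pow_of_le (m := 1) (n := 2) (by norm_num))
    simp only [pow_one]
    refine (h2a.add (hθO.const_mul_left p')).congr_left fun y => ?_
    ring
  have h3 : (fun y => θ y - p 0 * y) =O[𝓝 0] fun y : ℝ => y ^ 2 := by
    refine isBigO_pow_succ_of_hasDerivAt (f' := fun y => p (θ y) - p 0) ?_ (by simp [h0]) h2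
    filter_upwards [hθ] with y hy
    exact hy.fun_sub (by simpa using (hasDerivAt_id y).const_mul (p 0))
  have h4 : (fun y => p (θ y) - p 0 - p' * (p 0 * y)) =O[𝓝 0] fun y : ℝ => y ^ 2 := by
    refine (h1.add (h3.const_mul_left p')).congr_left fun y => ?_
    ring
  refine isBigO_pow_succ_of_hasDerivAt (f' := fun y => p (θ y) - p 0 - p' * (p 0 * y)) ?_
    (by simp [h0]) h4
  filter_upwards [hθ] with y hy
  have h5 : HasDerivAt (fun y : ℝ => 0 + p 0 * y + p 0 * p' / 2 * y ^ 2)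
      (p 0 + p 0 * p' / 2 * (2 * y)) y := by
    have ha : HasDerivAt (fun y : ℝ => 0 + p 0 * y) (p 0) y := by
      simpa using (hasDerivAt_id y).const_mul (p 0)
    exact ha.fun_add (by simpa using (hasDerivAt_pow 2 y).const_mul (p 0 * p' / 2))
  have h6 : p (θ y) - p 0 - p' * (p 0 * y)
      = p (θ y) - (p 0 + p 0 * p' / 2 * (2 * y)) := by ring
  rw [h6]
  exact hy.fun_sub h5

/-! ### Square integrable controls and their primitives -/

/-- Square integrable functions on the unit interval. -/
abbrev UnitL2 : Type := Lp ℝ 2 (volume.restrict (Icc (0 : ℝ) 1))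

/-- The Hilbert space of pairs of controls: the driver orthogonal to the volatility noise, and the
driver of the volatility. -/
abbrev ControlSpace : Type := WithLp 2 (UnitL2 × UnitL2)

instance isProbabilityMeasure_unitInterval :
    IsProbabilityMeasure (volume.restrict (Icc (0 : ℝ) 1)) := ⟨by simp⟩

namespace UnitL2

theorem integrable (γ : UnitL2) : Integrable γ (volume.restrict (Icc (0 : ℝ) 1)) :=
  (Lp.memLp γ).integrable (by norm_num)

theorem integral_abs_le_norm (γ : UnitL2) : ∫ s in Icc (0 : ℝ) 1, |γ s| ≤ ‖γ‖ := by
  have h1 : ∫ s in Icc (0 : ℝ) 1, |γ s|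
      = (eLpNorm γ 1 (volume.restrict (Icc (0 : ℝ) 1))).toReal := by
    rw [eLpNorm_one_eq_lintegral_enorm, ← integral_norm_eq_lintegral_enorm
      (Lp.aestronglyMeasurable γ)]
    rfl
  rw [h1, Lp.norm_def]
  exact ENNReal.toReal_mono (Lp.eLpNorm_ne_top γ)
    (eLpNorm_le_eLpNorm_of_exponent_le (by norm_num) (Lp.aestronglyMeasurable γ))

theorem intervalIntegrable_one (γ : UnitL2) : IntervalIntegrable γ volume 0 1 :=
  (intervalIntegrable_iff_integrableOn_Icc_of_le zero_le_one).mpr γ.integrable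

theorem intervalIntegrable_mul (γ : UnitL2) {ψ : ℝ → ℝ} (hψ : ContinuousOn ψ (Icc 0 1)) :
    IntervalIntegrable (fun s => ψ s * γ s) volume 0 1 :=
  γ.intervalIntegrable_one.continuousOn_mul (by rwa [uIcc_of_le zero_le_one])

theorem intervalIntegrable_mul_of_mem (γ : UnitL2) {ψ : ℝ → ℝ} (hψ : ContinuousOn ψ (Icc 0 1))
    {t : ℝ} (ht : t ∈ Icc (0 : ℝ) 1) :
    IntervalIntegrable (fun s => ψ s * γ s) volume 0 t :=
  (γ.intervalIntegrable_mul hψ).mono_set (by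
    rw [uIcc_of_le ht.1, uIcc_of_le zero_le_one]; exact Icc_subset_Icc_right ht.2)

theorem ae_restrict_interval {p : ℝ → Prop} {t : ℝ} (ht : t ∈ Icc (0 : ℝ) 1)
    (h : ∀ᵐ s ∂(volume.restrict (Icc (0 : ℝ) 1)), p s) : ∀ᵐ s, s ∈ uIoc 0 t → p s := by
  rw [ae_restrict_iff' measurableSet_Icc] at h
  filter_upwards [h] with s hs hst
  rw [uIoc_of_le ht.1] at hst
  exact hs ⟨hst.1.le, hst.2.trans ht.2⟩

theorem abs_integral_mul_le (γ : UnitL2) {ψ : ℝ → ℝ} (hψ : ContinuousOn ψ (Icc 0 1)) {M : ℝ}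
    (hM : ∀ s ∈ Icc (0 : ℝ) 1, |ψ s| ≤ M) {t : ℝ} (ht : t ∈ Icc (0 : ℝ) 1) :
    |∫ s in (0 : ℝ)..t, ψ s * γ s| ≤ M * ‖γ‖ := by
  have hM0 : 0 ≤ M := (abs_nonneg _).trans (hM 0 ⟨le_rfl, zero_le_one⟩)
  have hsub : Ioc 0 t ⊆ Icc (0 : ℝ) 1 := fun s hs => ⟨hs.1.le, hs.2.trans ht.2⟩
  have hint : IntegrableOn (fun s => |γ s|) (Icc (0 : ℝ) 1) := γ.integrable.abs
  have hint' : IntegrableOn (fun s => M * |γ s|) (Icc (0 : ℝ) 1) := hint.const_mul M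
  rw [intervalIntegral.integral_of_le ht.1]
  calc |∫ s in Ioc 0 t, ψ s * γ s| ≤ ∫ s in Ioc 0 t, |ψ s * γ s| :=
        abs_integral_le_integral_abs
    _ ≤ ∫ s in Ioc 0 t, M * |γ s| := by
        refine setIntegral_mono_on ?_ (hint'.mono_set hsub) measurableSet_Ioc fun s hs => ?_
        · have := (γ.intervalIntegrable_mul_of_mem hψ ht).abs
          exact (intervalIntegrable_iff_integrableOn_Ioc_of_le ht.1).mp this
        · rw [abs_mul]; gcongr; exact hM s (hsub hs)
    _ ≤ ∫ s in Icc (0 : ℝ) 1, M * |γ s| :=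
        setIntegral_mono_set hint' (ae_of_all _ fun s => by positivity) hsub.eventuallyLE
    _ = M * ∫ s in Icc (0 : ℝ) 1, |γ s| := integral_const_mul _ _
    _ ≤ M * ‖γ‖ := by gcongr; exact γ.integral_abs_le_norm

/-- The continuous linear functional `γ ↦ ∫₀ᵗ γ`, with `t` clamped to the unit interval. -/
noncomputable def primitive (t : ℝ) : UnitL2 →L[ℝ] ℝ :=
  LinearMap.mkContinuous
    { toFun := fun γ => ∫ s in (0 : ℝ)..(projIcc 0 1 zero_le_one t : Icc (0 : ℝ) 1), γ s
      map_add' := fun γ₁ γ₂ => by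
        have ht := (projIcc 0 1 zero_le_one t : Icc (0 : ℝ) 1).2
        have h1 := γ₁.intervalIntegrable_mul_of_mem (ψ := fun _ => 1) continuousOn_const ht
        have h2 := γ₂.intervalIntegrable_mul_of_mem (ψ := fun _ => 1) continuousOn_const ht
        simp only [one_mul] at h1 h2
        rw [← intervalIntegral.integral_add h1 h2]
        refine intervalIntegral.integral_congr_ae (ae_restrict_interval ht ?_)
        filter_upwards [Lp.coeFn_add γ₁ γ₂] with s hs using by simpa using hs
      map_smul' := fun c γ => by
        simp only [RingHom.id_apply]
        rw [← intervalIntegral.integral_smul]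
        refine intervalIntegral.integral_congr_ae
          (ae_restrict_interval (projIcc 0 1 zero_le_one t : Icc (0 : ℝ) 1).2 ?_)
        filter_upwards [Lp.coeFn_smul c γ] with s hs using by simpa using hs }
    1 fun γ => by
      simpa using γ.abs_integral_mul_le (ψ := fun _ => 1) continuousOn_const (M := 1)
        (fun s _ => by simp) (projIcc 0 1 zero_le_one t : Icc (0 : ℝ) 1).2

theorem primitive_apply {t : ℝ} (ht : t ∈ Icc (0 : ℝ) 1) (γ : UnitL2) :
    primitive t γ = ∫ s in (0 : ℝ)..t, γ s := by
  change ∫ s in (0 : ℝ)..(projIcc 0 1 zero_le_one t : Icc (0 : ℝ) 1), γ s = _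
  rw [projIcc_of_mem _ ht]

theorem abs_primitive_le (t : ℝ) (γ : UnitL2) : |primitive t γ| ≤ ‖γ‖ := by
  have := γ.abs_integral_mul_le (ψ := fun _ => 1) continuousOn_const (M := 1)
    (fun s _ => by simp) (projIcc 0 1 zero_le_one t : Icc (0 : ℝ) 1).2
  simp only [one_mul] at this
  exact this

theorem continuousOn_integral_mul (γ : UnitL2) {ψ : ℝ → ℝ} (hψ : ContinuousOn ψ (Icc 0 1)) :
    ContinuousOn (fun t => ∫ s in (0 : ℝ)..t, ψ s * γ s) (Icc 0 1) := by
  have := intervalIntegral.continuousOn_primitive_interval (a := (0 : ℝ)) (b := 1)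
    (f := fun s => ψ s * γ s) (μ := volume) (by
      rw [uIcc_of_le zero_le_one]
      exact (intervalIntegrable_iff_integrableOn_Icc_of_le zero_le_one).mp
        (γ.intervalIntegrable_mul hψ))
  rwa [uIcc_of_le zero_le_one] at this

theorem continuousOn_integral (γ : UnitL2) :
    ContinuousOn (fun t => ∫ s in (0 : ℝ)..t, γ s) (Icc 0 1) := by
  simpa using γ.continuousOn_integral_mul (ψ := fun _ => 1) continuousOn_const

theorem continuousOn_primitive (γ : UnitL2) :
    ContinuousOn (fun t => primitive t γ) (Icc 0 1) :=
  γ.continuousOn_integral.congr fun _ ht => primitive_apply ht γ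

/-- Product rule for increments under the integral; the asymmetric splitting leaves each term with a
single increment. -/
theorem integral_mul_sub (γ₁ γ₂ : UnitL2) {ψ₁ ψ₂ : ℝ → ℝ} (h₁ : ContinuousOn ψ₁ (Icc 0 1))
    (h₂ : ContinuousOn ψ₂ (Icc 0 1)) {t : ℝ} (ht : t ∈ Icc (0 : ℝ) 1) :
    (∫ s in (0 : ℝ)..t, ψ₁ s * γ₁ s) - ∫ s in (0 : ℝ)..t, ψ₂ s * γ₂ s
      = (∫ s in (0 : ℝ)..t, (ψ₁ s - ψ₂ s) * γ₂ s)
        + ∫ s in (0 : ℝ)..t, ψ₁ s * (γ₁ - γ₂ : UnitL2) s := by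
  rw [← intervalIntegral.integral_sub (γ₁.intervalIntegrable_mul_of_mem h₁ ht)
    (γ₂.intervalIntegrable_mul_of_mem h₂ ht), ← intervalIntegral.integral_add
    (γ₂.intervalIntegrable_mul_of_mem (h₁.fun_sub h₂) ht)
    ((γ₁ - γ₂).intervalIntegrable_mul_of_mem h₁ ht)]
  refine intervalIntegral.integral_congr_ae (ae_restrict_interval ht ?_)
  filter_upwards [Lp.coeFn_sub γ₁ γ₂] with s hs
  rw [hs, Pi.sub_apply]
  ring

/-- The midpoint identity for products: since the second factor is exactly affine, only the defect
of `ψ` and a quarter of the product of increments remain. -/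
theorem integral_mul_midpoint (γ₁ γ₂ : UnitL2) {ψ₁ ψ₂ ψ : ℝ → ℝ}
    (h₁ : ContinuousOn ψ₁ (Icc 0 1)) (h₂ : ContinuousOn ψ₂ (Icc 0 1))
    (h : ContinuousOn ψ (Icc 0 1)) {t : ℝ} (ht : t ∈ Icc (0 : ℝ) 1) :
    (∫ s in (0 : ℝ)..t, ψ s * ((1 / 2 : ℝ) • (γ₁ + γ₂) : UnitL2) s)
        - ((∫ s in (0 : ℝ)..t, ψ₁ s * γ₁ s) + ∫ s in (0 : ℝ)..t, ψ₂ s * γ₂ s) / 2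
      = (∫ s in (0 : ℝ)..t, (ψ s - (ψ₁ s + ψ₂ s) / 2) * ((1 / 2 : ℝ) • (γ₁ + γ₂) : UnitL2) s)
        - ∫ s in (0 : ℝ)..t, (ψ₁ s - ψ₂ s) / 4 * (γ₁ - γ₂ : UnitL2) s := by
  rw [← intervalIntegral.integral_add (γ₁.intervalIntegrable_mul_of_mem h₁ ht)
    (γ₂.intervalIntegrable_mul_of_mem h₂ ht), ← intervalIntegral.integral_div,
    ← intervalIntegral.integral_sub (UnitL2.intervalIntegrable_mul_of_mem _ h ht)
    (((γ₁.intervalIntegrable_mul_of_mem h₁ ht).add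
      (γ₂.intervalIntegrable_mul_of_mem h₂ ht)).div_const 2),
    ← intervalIntegral.integral_sub
      (UnitL2.intervalIntegrable_mul_of_mem _ (h.fun_sub ((h₁.fun_add h₂).div_const 2)) ht)
      (UnitL2.intervalIntegrable_mul_of_mem _ ((h₁.fun_sub h₂).div_const 4) ht)]
  refine intervalIntegral.integral_congr_ae (ae_restrict_interval ht ?_)
  filter_upwards [Lp.coeFn_sub γ₁ γ₂, Lp.coeFn_smul (1 / 2 : ℝ) (γ₁ + γ₂), Lp.coeFn_add γ₁ γ₂]
    with s hs1 hs2 hs3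
  rw [hs1, hs2, Pi.smul_apply, hs3, Pi.sub_apply, Pi.add_apply, smul_eq_mul]
  ring

end UnitL2

/-! ### State variables and payoff as functionals of the controls -/

namespace ControlSpace

/-- The combined driver `ρ β + √(1 - ρ²) α` of the price. -/
noncomputable def priceDriver (ρ : ℝ) : ControlSpace →L[ℝ] UnitL2 :=
  ρ • WithLp.sndL 2 ℝ UnitL2 UnitL2 + Real.sqrt (1 - ρ ^ 2) • WithLp.fstL 2 ℝ UnitL2 UnitL2

theorem priceDriver_apply (ρ : ℝ) (w : ControlSpace) :
    priceDriver ρ w = ρ • w.snd + Real.sqrt (1 - ρ ^ 2) • w.fst := rfl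

theorem norm_sq_eq (w : ControlSpace) : ‖w‖ ^ 2 = ‖w.fst‖ ^ 2 + ‖w.snd‖ ^ 2 :=
  WithLp.prod_norm_sq_eq_of_L2 w

theorem norm_snd_le (w : ControlSpace) : ‖w.snd‖ ≤ ‖w‖ :=
  le_of_sq_le_sq (by rw [norm_sq_eq]; nlinarith [sq_nonneg ‖w.fst‖]) (norm_nonneg _)

theorem norm_fst_le (w : ControlSpace) : ‖w.fst‖ ≤ ‖w‖ :=
  le_of_sq_le_sq (by rw [norm_sq_eq]; nlinarith [sq_nonneg ‖w.snd‖]) (norm_nonneg _)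

theorem norm_priceDriver_le {ρ : ℝ} (hρ : |ρ| ≤ 1) (w : ControlSpace) :
    ‖priceDriver ρ w‖ ≤ 2 * ‖w‖ := by
  have h1 : |Real.sqrt (1 - ρ ^ 2)| ≤ 1 := by
    rw [abs_of_nonneg (Real.sqrt_nonneg _)]
    exact Real.sqrt_le_one.mpr (by nlinarith [sq_nonneg ρ])
  rw [priceDriver_apply]
  calc _ ≤ ‖ρ • w.snd‖ + ‖Real.sqrt (1 - ρ ^ 2) • w.fst‖ := norm_add_le _ _
    _ = |ρ| * ‖w.snd‖ + |Real.sqrt (1 - ρ ^ 2)| * ‖w.fst‖ := by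
      rw [norm_smul, norm_smul, Real.norm_eq_abs, Real.norm_eq_abs]
    _ ≤ 1 * ‖w‖ + 1 * ‖w‖ := by
      gcongr
      exacts [norm_snd_le w, norm_fst_le w]
    _ = _ := by ring

/-- The volatility coordinate `∫₀ᵗ β`. -/
noncomputable def volState (t : ℝ) : ControlSpace →L[ℝ] ℝ :=
  (UnitL2.primitive t).comp (WithLp.sndL 2 ℝ UnitL2 UnitL2)

theorem volState_apply {t : ℝ} (ht : t ∈ Icc (0 : ℝ) 1) (w : ControlSpace) :
    volState t w = ∫ s in (0 : ℝ)..t, w.snd s := UnitL2.primitive_apply ht _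

theorem abs_volState_le (t : ℝ) (w : ControlSpace) : |volState t w| ≤ ‖w‖ :=
  (UnitL2.abs_primitive_le t w.snd).trans (norm_snd_le w)

theorem continuousOn_volState (w : ControlSpace) :
    ContinuousOn (fun t => volState t w) (Icc 0 1) := w.snd.continuousOn_primitive

theorem quadControl_volState {r : ℝ} (hr : r ≤ 1) (t : ℝ) :
    QuadControl (volState t) (volState t) r 1 where
  bound a ha := (abs_volState_le t a).trans (ha.trans hr)
  map v := by simpa using abs_volState_le t v
  lip a b _ _ := by rw [← map_sub, one_mul]; exact abs_volState_le t _
  mid a b _ _ := by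
    have : volState t ((1 / 2 : ℝ) • (a + b)) - (volState t a + volState t b) / 2 = 0 := by
      rw [map_smul, map_add, smul_eq_mul]; ring
    rw [this]; simp
  lin a b _ _ := by
    rw [← map_sub, sub_self, abs_zero]; positivity

/-- The price coordinate `∫₀ᵗ φ(∫₀ˢ β) (ρ β + √(1 - ρ²) α) ds`. -/
noncomputable def priceState (φ : ℝ → ℝ) (ρ : ℝ) (t : ℝ) (w : ControlSpace) : ℝ :=
  ∫ s in (0 : ℝ)..t, φ (volState s w) * priceDriver ρ w s

variable {φ : ℝ → ℝ} {ρ r K : ℝ}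

theorem continuousOn_comp_volState {f : ℝ → ℝ} {p L : ℝ}
    (hf : QuadControl f (p • ContinuousLinearMap.id ℝ ℝ) r L) (hr : 0 ≤ r) {w : ControlSpace}
    (hw : ‖w‖ ≤ r) : ContinuousOn (fun t => f (volState t w)) (Icc 0 1) :=
  (hf.continuousOn hr).comp (continuousOn_volState w) fun t _ => by
    simpa using (abs_volState_le t w).trans hw

theorem continuousOn_priceState {p : ℝ}
    (hf : QuadControl φ (p • ContinuousLinearMap.id ℝ ℝ) r K) (hr : 0 ≤ r) {w : ControlSpace}
    (hw : ‖w‖ ≤ r) : ContinuousOn (fun t => priceState φ ρ t w) (Icc 0 1) :=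
  UnitL2.continuousOn_integral_mul _ (continuousOn_comp_volState hf hr hw)

theorem priceState_zero (φ : ℝ → ℝ) (ρ : ℝ) {t : ℝ} (ht : t ∈ Icc (0 : ℝ) 1) :
    priceState φ ρ t 0 = 0 := by
  have := (0 : UnitL2).abs_integral_mul_le (ψ := fun _ => φ 0) continuousOn_const
    (fun s _ => le_rfl) ht
  rw [norm_zero, mul_zero, abs_nonpos_iff] at this
  simpa only [priceState, map_zero] using this

/-- The integrand is a controlled factor times a linear one. The volatility state is a functional of
norm at most 1, so `φ (volState s w)` is controlled by `(1 + 1)² K = 4K` uniformly in `s`; the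
driver has norm at most `2‖w‖`. The Lipschitz estimate, `8K + 8K`, fixes the constant 16. -/
theorem quadControl_priceState {p : ℝ}
    (hφ : QuadControl φ (p • ContinuousLinearMap.id ℝ ℝ) r K) (hr : 0 ≤ r) (hr1 : r ≤ 1)
    (hρ : |ρ| ≤ 1) {t : ℝ} (ht : t ∈ Icc (0 : ℝ) 1) :
    QuadControl (priceState φ ρ t) (φ 0 • (UnitL2.primitive t).comp (priceDriver ρ)) r
      (16 * K) := by
  have hK := hφ.nonneg hr
  have hq : ∀ s, QuadControl (fun w => φ (volState s w)) (p • volState s) r (4 * K) := fun s =>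
    ((quadControl_volState hr1 s).comp hr (map_zero _) hφ (by simp)).mono le_rfl (by
      norm_num; linarith)
  have hc : ∀ {w : ControlSpace}, ‖w‖ ≤ r →
      ContinuousOn (fun s => φ (volState s w)) (Icc 0 1) :=
    fun hw => continuousOn_comp_volState hφ hr hw
  have hd := norm_priceDriver_le hρ
  refine ⟨fun a ha => ?_, fun v => ?_, fun a b ha hb => ?_, fun a b ha hb => ?_,
    fun a b ha hb => ?_⟩
  · calc _ ≤ 4 * K * ‖priceDriver ρ a‖ :=
          UnitL2.abs_integral_mul_le _ (hc ha) (fun s _ => (hq s).bound a ha) ht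
      _ ≤ 4 * K * (2 * 1) := by gcongr; exact (hd a).trans (by linarith)
      _ ≤ _ := by linarith
  · have h0 : |φ 0| ≤ K := hφ.bound 0 (by simpa using hr)
    simp only [FunLike.coe_smul, Pi.smul_apply, ContinuousLinearMap.comp_apply, smul_eq_mul,
      abs_mul]
    calc _ ≤ K * (2 * ‖v‖) := by
          gcongr; exact (UnitL2.abs_primitive_le t _).trans (hd v)
      _ ≤ _ := by nlinarith [norm_nonneg v]
  · have e := UnitL2.integral_mul_sub (priceDriver ρ a) (priceDriver ρ b) (hc ha) (hc hb) ht
    rw [priceState, priceState, e, ← map_sub]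
    calc _ ≤ _ := abs_add_le _ _
      _ ≤ (4 * K * ‖a - b‖) * ‖priceDriver ρ b‖ + 4 * K * ‖priceDriver ρ (a - b)‖ := by
        refine add_le_add ?_ ?_
        · exact UnitL2.abs_integral_mul_le _ ((hc ha).sub (hc hb))
            (fun s _ => (hq s).lip a b ha hb) ht
        · exact UnitL2.abs_integral_mul_le _ (hc ha) (fun s _ => (hq s).bound a ha) ht
      _ ≤ (4 * K * ‖a - b‖) * (2 * 1) + 4 * K * (2 * ‖a - b‖) := by
        gcongr
        exacts [(hd b).trans (by linarith), hd _]
      _ = _ := by ring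
  · have hm := QuadControl.midpoint_norm_le ha hb
    have e := UnitL2.integral_mul_midpoint (priceDriver ρ a) (priceDriver ρ b) (hc ha) (hc hb)
      (hc hm) ht
    rw [← map_add, ← map_smul, ← map_sub] at e
    rw [priceState, priceState, priceState, e]
    calc _ ≤ _ := abs_sub _ _
      _ ≤ (4 * K * ‖a - b‖ ^ 2) * ‖priceDriver ρ ((1 / 2 : ℝ) • (a + b))‖
          + (4 * K * ‖a - b‖ / 4) * ‖priceDriver ρ (a - b)‖ := by
        refine add_le_add ?_ ?_
        · exact UnitL2.abs_integral_mul_le _ ((hc hm).sub (((hc ha).add (hc hb)).div_const 2))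
            (fun s _ => (hq s).mid a b ha hb) ht
        · refine UnitL2.abs_integral_mul_le _ (((hc ha).sub (hc hb)).div_const 4)
            (fun s _ => ?_) ht
          rw [abs_div, abs_of_pos (by norm_num : (0 : ℝ) < 4)]
          gcongr
          exact (hq s).lip a b ha hb
      _ ≤ (4 * K * ‖a - b‖ ^ 2) * (2 * 1) + (4 * K * ‖a - b‖ / 4) * (2 * ‖a - b‖) := by
        gcongr
        exacts [(hd _).trans (by linarith), hd _]
      _ = 10 * K * ‖a - b‖ ^ 2 := by ring
      _ ≤ _ := by gcongr; norm_num
  · have e := UnitL2.integral_mul_sub (priceDriver ρ a) (priceDriver ρ b) (hc ha) (hc hb) ht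
    have e2 : (φ 0 • (UnitL2.primitive t).comp (priceDriver ρ)) (a - b)
        = ∫ s in (0 : ℝ)..t, φ 0 * priceDriver ρ (a - b) s := by
      rw [intervalIntegral.integral_const_mul, ← UnitL2.primitive_apply ht]
      rfl
    rw [priceState, priceState, e, ← map_sub, e2, add_sub_assoc,
      ← intervalIntegral.integral_sub (UnitL2.intervalIntegrable_mul_of_mem _ (hc ha) ht)
        (UnitL2.intervalIntegrable_mul_of_mem _ (ψ := fun _ => φ 0) continuousOn_const ht)]
    simp only [← sub_mul]
    have hz : ∀ s, |φ (volState s a) - φ 0| ≤ 4 * K * ‖a‖ := fun s => by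
      simpa using (hq s).lip a 0 ha (by simpa using hr)
    calc _ ≤ _ := abs_add_le _ _
      _ ≤ (4 * K * ‖a - b‖) * ‖priceDriver ρ b‖ + (4 * K * ‖a‖) * ‖priceDriver ρ (a - b)‖ := by
        refine add_le_add ?_ ?_
        · exact UnitL2.abs_integral_mul_le _ ((hc ha).sub (hc hb))
            (fun s _ => (hq s).lip a b ha hb) ht
        · exact UnitL2.abs_integral_mul_le _ ((hc ha).sub continuousOn_const)
            (fun s _ => hz s) ht
      _ ≤ (4 * K * ‖a - b‖) * (2 * ‖b‖) + (4 * K * ‖a‖) * (2 * ‖a - b‖) := by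
        gcongr
        exacts [hd b, hd _]
      _ = 8 * K * (‖a‖ + ‖b‖) * ‖a - b‖ := by ring
      _ ≤ _ := by gcongr; norm_num

/-- The normalized payoff constraint `∫₀¹ P(z_t) W(y_t) dt - 1` in terms of the controls. -/
noncomputable def payoff (φ P W : ℝ → ℝ) (ρ : ℝ) (w : ControlSpace) : ℝ :=
  (∫ t in (0 : ℝ)..1, P (priceState φ ρ t w) * W (volState t w)) - 1

theorem intervalIntegrable_payoff {φ P W : ℝ → ℝ} {p₁ w₁ φ₁ δ L : ℝ} (hδ : 0 ≤ δ)
    (hφ : QuadControl φ (φ₁ • ContinuousLinearMap.id ℝ ℝ) δ L)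
    (hP : QuadControl P (p₁ • ContinuousLinearMap.id ℝ ℝ) δ L)
    (hW : QuadControl W (w₁ • ContinuousLinearMap.id ℝ ℝ) δ L) {w : ControlSpace} (hw : ‖w‖ ≤ δ)
    (hz : ∀ t ∈ Icc (0 : ℝ) 1, |priceState φ ρ t w| ≤ δ) :
    IntervalIntegrable (fun t => P (priceState φ ρ t w) * W (volState t w)) volume 0 1 := by
  apply ContinuousOn.intervalIntegrable
  rw [uIcc_of_le zero_le_one]
  refine ContinuousOn.mul ?_ (continuousOn_comp_volState hW hδ hw)
  refine (hP.continuousOn hδ).comp (continuousOn_priceState hφ hδ hw) fun t ht => ?_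
  simpa using hz t ht

/-- The first variation of the payoff at the origin. -/
noncomputable def payoffDeriv (ρ a b : ℝ) (t : ℝ) : ControlSpace →L[ℝ] ℝ :=
  a • (UnitL2.primitive t).comp (priceDriver ρ) + b • volState t

theorem continuousOn_payoffDeriv {a b : ℝ} (v : ControlSpace) :
    ContinuousOn (fun t => payoffDeriv ρ a b t v) (Icc 0 1) :=
  ((UnitL2.continuousOn_primitive _).const_smul a).add ((continuousOn_volState v).const_smul b)

theorem exists_quadControl_payoff {φ P W : ℝ → ℝ} {p₁ w₁ φ₁ δ L : ℝ} (hδ : 0 < δ)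
    (hφ : QuadControl φ (φ₁ • ContinuousLinearMap.id ℝ ℝ) δ L)
    (hP : QuadControl P (p₁ • ContinuousLinearMap.id ℝ ℝ) δ L)
    (hW : QuadControl W (w₁ • ContinuousLinearMap.id ℝ ℝ) δ L)
    (hP0 : P 0 = 1) (hW0 : W 0 = 1) (hρ : |ρ| ≤ 1) {l : ControlSpace →L[ℝ] ℝ}
    (hl : ∀ v, l v = ∫ t in (0 : ℝ)..1, payoffDeriv ρ (p₁ * φ 0) w₁ t v) :
    ∃ r > 0, r ≤ δ ∧ (∀ w, ‖w‖ ≤ r → ∀ t ∈ Icc (0 : ℝ) 1, |priceState φ ρ t w| ≤ δ) ∧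
      (∀ t ∈ Icc (0 : ℝ) 1, QuadControl (priceState φ ρ t)
        (φ 0 • (UnitL2.primitive t).comp (priceDriver ρ)) r (16 * L)) ∧
      ∃ M, QuadControl (payoff φ P W ρ) l r M := by
  have hL := hφ.nonneg hδ.le
  -- The denominator `1 + 16L` secures both `r ≤ δ`, for the volatility state, and `16 L r ≤ δ`, for
  -- the price state.
  set r := min 1 (δ / (1 + 16 * L)) with hr
  have hr0 : 0 < r := by positivity
  have hr1 : r ≤ 1 := min_le_left _ _
  have hr2 : (1 + 16 * L) * r ≤ δ := by
    calc _ ≤ (1 + 16 * L) * (δ / (1 + 16 * L)) := by gcongr; exact min_le_right _ _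
      _ = δ := by field_simp
  have hrL : 0 ≤ 16 * L * r := by positivity
  have hrδ : r ≤ δ := by nlinarith
  have hrδ' : 16 * L * r ≤ δ := by nlinarith
  have hφ' := hφ.mono hrδ le_rfl
  have hz := fun t (ht : t ∈ Icc (0 : ℝ) 1) => quadControl_priceState (ρ := ρ) hφ' hr0.le hr1 hρ ht
  have hz0 := fun t (ht : t ∈ Icc (0 : ℝ) 1) => priceState_zero φ ρ ht
  have hzδ : ∀ w, ‖w‖ ≤ r → ∀ t ∈ Icc (0 : ℝ) 1, |priceState φ ρ t w| ≤ δ := fun w hw t ht =>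
    ((hz t ht).abs_le_of_map_zero hr0.le (hz0 t ht) hw).trans (le_trans (by gcongr) hrδ')
  refine ⟨r, hr0, hrδ, hzδ, hz, ?_⟩
  refine ⟨_, QuadControl.sub_const (QuadControl.integral (l := fun t => payoffDeriv ρ (p₁ * φ 0) w₁ t)
    (L := 3 * (L * (1 + 16 * L) ^ 2 * (L * (1 + 1) ^ 2)))
    (fun t ht => ?_) (fun w hw => ?_) (fun v => ?_) hl) 1⟩
  · have h1 := (hz t ht).comp hr0.le (hz0 t ht) hP hrδ'
    have h2 := (quadControl_volState hr1 t).comp hr0.le (map_zero _) hW (by linarith)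
    have h3 := h1.mul h2 hr0.le
    simp only [hz0 t ht, map_zero, hP0, hW0] at h3
    convert h3 using 1
    rw [payoffDeriv, one_smul, one_smul, smul_smul]
  · exact intervalIntegrable_payoff hδ.le hφ hP hW (hw.trans hrδ) (hzδ w hw)
  · apply ContinuousOn.intervalIntegrable
    rw [uIcc_of_le zero_le_one]
    exact continuousOn_payoffDeriv v

end ControlSpace

/-! ### The gradient of the payoff and the expansion along it -/

namespace UnitL2

/-- The function `s ↦ 1 - s`. -/
noncomputable def ramp : UnitL2 :=
  MemLp.toLp (fun s : ℝ => 1 - s) (p := 2) <| MemLp.of_bound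
    (by fun_prop : Continuous fun s : ℝ => 1 - s).aestronglyMeasurable 1 <| by
      filter_upwards [ae_restrict_mem measurableSet_Icc] with s hs
      exact abs_le.mpr ⟨by linarith [hs.2], by linarith [hs.1]⟩

theorem coeFn_ramp : ∀ᵐ s ∂(volume.restrict (Icc (0 : ℝ) 1)), ramp s = 1 - s :=
  MemLp.coeFn_toLp _

theorem integral_mul_ramp (ψ : ℝ → ℝ) {t : ℝ} (ht : t ∈ Icc (0 : ℝ) 1) :
    ∫ s in (0 : ℝ)..t, ψ s * ramp s = ∫ s in (0 : ℝ)..t, ψ s * (1 - s) := by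
  refine intervalIntegral.integral_congr_ae (ae_restrict_interval ht ?_)
  filter_upwards [coeFn_ramp] with s hs using by rw [hs]

/-- Integration by parts against `s - 1`: this factor vanishes at `1` and the primitive at `0`, so
there is no boundary term. -/
theorem integral_primitive (γ : UnitL2) :
    ∫ t in (0 : ℝ)..1, primitive t γ = ∫ s in (0 : ℝ)..1, (1 - s) * γ s := by
  set F : ℝ → ℝ := fun t => ∫ s in (0 : ℝ)..t, γ s with hF
  have hγ := γ.intervalIntegrable_one
  have hac : AbsolutelyContinuousOnInterval F 0 1 :=
    hγ.absolutelyContinuousOnInterval_intervalIntegral (by simp)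
  have hlin : AbsolutelyContinuousOnInterval (fun s : ℝ => s - 1) 0 1 :=
    (by fun_prop : ContDiff ℝ 1 fun s : ℝ => s - 1).contDiffOn.absolutelyContinuousOnInterval
  have hparts := hac.integral_mul_deriv_eq_deriv_mul hlin
  have hd : ∀ s : ℝ, deriv (fun s : ℝ => s - 1) s = 1 := fun s => by simp
  simp only [hd, mul_one, sub_self, mul_zero, zero_sub] at hparts
  have hF0 : F 0 = 0 := by simp [hF]
  rw [hF0] at hparts
  have h1 : ∫ t in (0 : ℝ)..1, primitive t γ = ∫ t in (0 : ℝ)..1, F t := by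
    refine intervalIntegral.integral_congr fun t ht => ?_
    rw [uIcc_of_le zero_le_one] at ht
    exact primitive_apply ht γ
  rw [h1, hparts, zero_mul, neg_zero, zero_sub, ← intervalIntegral.integral_neg]
  refine intervalIntegral.integral_congr_ae ?_
  filter_upwards [hγ.ae_hasDerivAt_integral] with s hs hs'
  rw [(hs (uIoc_subset_uIcc hs') 0 (by simp)).deriv]
  ring

/-- The Riesz representative of the averaged primitive. It is the source of the profile `2t - t²`,
twice the primitive of `1 - s`, in the first-order paths. -/
theorem inner_ramp (γ : UnitL2) : inner ℝ ramp γ = ∫ t in (0 : ℝ)..1, primitive t γ := by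
  rw [integral_primitive, L2.inner_def, intervalIntegral.integral_of_le zero_le_one,
    ← integral_Icc_eq_integral_Ioc]
  refine integral_congr_ae ?_
  filter_upwards [coeFn_ramp] with s hs
  rw [hs]
  simp [mul_comm]

theorem primitive_ramp {t : ℝ} (ht : t ∈ Icc (0 : ℝ) 1) : primitive t ramp = t - t ^ 2 / 2 := by
  rw [primitive_apply ht]
  have := integral_mul_ramp (fun _ => 1) ht
  simp only [one_mul] at this
  rw [this, intervalIntegral.integral_sub (by simp) (by simp), integral_id]
  simp

theorem norm_ramp_sq : ‖ramp‖ ^ 2 = 1 / 3 := by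
  rw [← real_inner_self_eq_norm_sq, inner_ramp]
  have : ∫ t in (0 : ℝ)..1, primitive t ramp = ∫ t in (0 : ℝ)..1, (t - t ^ 2 / 2) := by
    refine intervalIntegral.integral_congr fun t ht => ?_
    rw [uIcc_of_le zero_le_one] at ht
    exact primitive_ramp ht
  rw [this, intervalIntegral.integral_sub (by simp) (by
    apply Continuous.intervalIntegrable; fun_prop), integral_id, intervalIntegral.integral_div, integral_pow]
  norm_num

end UnitL2

namespace ControlSpace

open UnitL2

/-- The Riesz representative of the first variation of the payoff. -/
noncomputable def payoffGradient (ρ a b : ℝ) : ControlSpace :=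
  WithLp.toLp 2 ((a * Real.sqrt (1 - ρ ^ 2)) • ramp, (a * ρ + b) • ramp)

theorem inner_payoffGradient (ρ a b : ℝ) (v : ControlSpace) :
    inner ℝ (payoffGradient ρ a b) v = ∫ t in (0 : ℝ)..1, payoffDeriv ρ a b t v := by
  have h1 : ∀ t, payoffDeriv ρ a b t v
      = primitive t ((a * Real.sqrt (1 - ρ ^ 2)) • v.fst + (a * ρ + b) • v.snd) := by
    intro t
    have : payoffDeriv ρ a b t v = a * primitive t (ρ • v.snd + Real.sqrt (1 - ρ ^ 2) • v.fst)
        + b * primitive t v.snd := rfl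
    rw [this]
    simp only [map_add, map_smul, smul_eq_mul]
    ring
  simp only [h1]
  rw [← inner_ramp, WithLp.prod_inner_apply, payoffGradient, inner_add_right, inner_smul_right,
    inner_smul_right, inner_smul_left, inner_smul_left]
  simp

/-- For `a = 2η₁√V₀` and `b = σ₀` this is `D/3`, the denominator of the leading term. -/
theorem norm_payoffGradient_sq {ρ : ℝ} (hρ : |ρ| ≤ 1) (a b : ℝ) :
    ‖payoffGradient ρ a b‖ ^ 2 = (a ^ 2 + 2 * a * b * ρ + b ^ 2) / 3 := by
  have h1 : 0 ≤ 1 - ρ ^ 2 := by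
    have := (sq_le_one_iff_abs_le_one ρ).mpr hρ
    linarith
  have h2 : (payoffGradient ρ a b).fst = (a * Real.sqrt (1 - ρ ^ 2)) • ramp := rfl
  have h3 : (payoffGradient ρ a b).snd = (a * ρ + b) • ramp := rfl
  rw [norm_sq_eq, h2, h3, norm_smul, norm_smul, mul_pow, mul_pow, norm_ramp_sq,
    Real.norm_eq_abs, Real.norm_eq_abs, sq_abs, sq_abs, mul_pow, Real.sq_sqrt h1]
  ring

theorem priceDriver_payoffGradient {ρ : ℝ} (hρ : |ρ| ≤ 1) (a b : ℝ) :
    priceDriver ρ (payoffGradient ρ a b) = (a + ρ * b) • ramp := by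
  have h1 : 0 ≤ 1 - ρ ^ 2 := by
    have := (sq_le_one_iff_abs_le_one ρ).mpr hρ
    linarith
  have h2 : (payoffGradient ρ a b).fst = (a * Real.sqrt (1 - ρ ^ 2)) • ramp := rfl
  have h3 : (payoffGradient ρ a b).snd = (a * ρ + b) • ramp := rfl
  rw [priceDriver_apply, h2, h3, smul_smul, smul_smul, ← add_smul]
  congr 1
  have := Real.mul_self_sqrt h1
  linear_combination a * this

theorem volState_payoffGradient (ρ a b : ℝ) {t : ℝ} (ht : t ∈ Icc (0 : ℝ) 1) :
    volState t (payoffGradient ρ a b) = (a * ρ + b) * (t - t ^ 2 / 2) := by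
  have : volState t (payoffGradient ρ a b) = primitive t ((a * ρ + b) • ramp) := rfl
  rw [this, map_smul, primitive_ramp ht, smul_eq_mul]

theorem hasQuadExpansion_integral {φ : ℝ → ℝ} {φ₁ δ L : ℝ} (hδ : 0 < δ)
    (hφ : QuadControl φ (φ₁ • ContinuousLinearMap.id ℝ ℝ) δ L) (B : ℝ) :
    HasQuadExpansion (fun x => ∫ u in (0 : ℝ)..x, φ (B * u)) 0 (φ 0) (φ₁ * B / 2) := by
  have hcont : ∀ᶠ y in 𝓝 (0 : ℝ), |B * y| < δ := by
    have : Tendsto (fun y : ℝ => |B * y|) (𝓝 0) (𝓝 |B * 0|) :=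
      Continuous.tendsto (by fun_prop) 0
    exact this.eventually_lt_const (by simpa using hδ)
  obtain ⟨e, he, hball⟩ := Metric.nhds_basis_ball.mem_iff.mp hcont
  have hco : ContinuousOn (fun u => φ (B * u)) (Metric.ball 0 e) := by
    refine (hφ.continuousOn hδ.le).comp (by fun_prop) fun u hu => ?_
    have : |B * u| < δ := hball hu
    simpa using this.le
  have hd : ∀ᶠ y in 𝓝 (0 : ℝ),
      HasDerivAt (fun x => ∫ u in (0 : ℝ)..x, φ (B * u)) (φ (B * y)) y := by
    filter_upwards [Metric.ball_mem_nhds (0 : ℝ) he] with y hy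
    have hsub : uIcc 0 y ⊆ Metric.ball (0 : ℝ) e :=
      (convex_ball (0 : ℝ) e).ordConnected.uIcc_subset (Metric.mem_ball_self he) hy
    exact intervalIntegral.integral_hasDerivAt_right (hco.mono hsub).intervalIntegrable
      (hco.stronglyMeasurableAtFilter Metric.isOpen_ball _ hy)
      (hco.continuousAt (Metric.isOpen_ball.mem_nhds hy))
  have hO : (fun y => φ (B * y) - (φ 0 + φ₁ * (B * y))) =O[𝓝 0] fun y : ℝ => y ^ 2 := by
    refine IsBigO.of_bound (L * B ^ 2) ?_
    filter_upwards [hcont] with y hy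
    have := hφ.lin (B * y) 0 (by simpa using hy.le) (by simpa using hδ.le)
    simp only [sub_zero, norm_zero, add_zero, Real.norm_eq_abs] at this
    rw [norm_pow, Real.norm_eq_abs, Real.norm_eq_abs, sq_abs]
    calc _ = |φ (B * y) - φ 0 - (φ₁ • ContinuousLinearMap.id ℝ ℝ) (B * y)| := by
          congr 1; simp; ring
      _ ≤ _ := this
      _ = L * |B * y| ^ 2 := by ring
      _ = _ := by rw [sq_abs]; ring
  refine isBigO_pow_succ_of_hasDerivAt (f' := fun y => φ (B * y) - (φ 0 + φ₁ * (B * y)))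
    ?_ (by simp) hO
  filter_upwards [hd] with y hy
  have ha : HasDerivAt (fun y : ℝ => 0 + φ 0 * y) (φ 0) y := by
    simpa using (hasDerivAt_id y).const_mul (φ 0)
  have hb := ha.fun_add ((hasDerivAt_pow 2 y).const_mul (φ₁ * B / 2))
  refine (hy.fun_sub hb).congr_deriv ?_
  norm_num
  ring

/-- Along the ray the controls are multiples of `1 - r`, so everything runs on the clock `r - r²/2`,
whose derivative is `1 - r`. The substitution `u = s(r - r²/2)` removes `t` except through the upper
limit. -/
theorem priceState_smul_payoffGradient {φ : ℝ → ℝ} {φ₁ δ L ρ : ℝ} (hδ : 0 < δ)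
    (hφ : QuadControl φ (φ₁ • ContinuousLinearMap.id ℝ ℝ) δ L) (hρ : |ρ| ≤ 1) {a b s : ℝ}
    (hs : |s * (a * ρ + b)| ≤ δ) {t : ℝ} (ht : t ∈ Icc (0 : ℝ) 1) :
    priceState φ ρ t (s • payoffGradient ρ a b)
      = (a + ρ * b) * ∫ u in (0 : ℝ)..(s * (t - t ^ 2 / 2)), φ ((a * ρ + b) * u) := by
  set B := a * ρ + b
  set C := a + ρ * b
  have hτ : ∀ r ∈ Icc (0 : ℝ) 1, |r - r ^ 2 / 2| ≤ 1 := fun r hr =>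
    abs_le.mpr ⟨by nlinarith [hr.1, hr.2], by nlinarith [hr.1, hr.2]⟩
  have hdr : priceDriver ρ (s • payoffGradient ρ a b) = (s * C) • ramp := by
    rw [map_smul, priceDriver_payoffGradient hρ, smul_smul]
  have h1 : priceState φ ρ t (s • payoffGradient ρ a b)
      = ∫ r in (0 : ℝ)..t, C * (((fun u => φ (B * u)) ∘ fun r => s * (r - r ^ 2 / 2)) r
        * (s * (1 - r))) := by
    rw [priceState, hdr]
    refine intervalIntegral.integral_congr_ae ?_
    filter_upwards [ae_restrict_interval ht coeFn_ramp,
      ae_restrict_interval ht (Lp.coeFn_smul (s * C) ramp)] with r hr1 hr2 hr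
    have hr' : r ∈ Icc (0 : ℝ) 1 := by
      rw [uIoc_of_le ht.1] at hr
      exact ⟨hr.1.le, hr.2.trans ht.2⟩
    rw [hr2 hr, Pi.smul_apply, hr1 hr, map_smul, volState_payoffGradient _ _ _ hr']
    simp only [smul_eq_mul, Function.comp]
    rw [show s * (B * (r - r ^ 2 / 2)) = B * (s * (r - r ^ 2 / 2)) by ring]
    ring
  rw [h1, intervalIntegral.integral_const_mul]
  congr 1
  have hd : ∀ r : ℝ, HasDerivAt (fun r => s * (r - r ^ 2 / 2)) (s * (1 - r)) r := fun r => by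
    refine (((hasDerivAt_id r).fun_sub
      ((hasDerivAt_pow 2 r).div_const 2)).const_mul s).congr_deriv ?_
    norm_num
  have hg : ContinuousOn (fun u => φ (B * u)) ((fun r => s * (r - r ^ 2 / 2)) '' uIcc 0 t) := by
    refine (hφ.continuousOn hδ.le).comp (by fun_prop) ?_
    rintro _ ⟨r, hr, rfl⟩
    rw [uIcc_of_le ht.1] at hr
    have h3 := hτ r ⟨hr.1, hr.2.trans ht.2⟩
    simp only [Metric.mem_closedBall, dist_zero_right, Real.norm_eq_abs]
    calc |B * (s * (r - r ^ 2 / 2))| = |s * B| * |r - r ^ 2 / 2| := by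
          rw [← abs_mul]; congr 1; ring
      _ ≤ |s * B| * 1 := by gcongr
      _ ≤ δ := by rw [mul_one]; exact hs
  rw [intervalIntegral.integral_comp_mul_deriv'' (by fun_prop)
    (fun r _ => (hd r).hasDerivWithinAt) (by fun_prop) hg]
  simp

/-- Second order expansion of the payoff along its gradient at the origin. -/
theorem exists_payoff_ray_expansion {φ P W : ℝ → ℝ} {φ₁ p₁ p₂ w₁ w₂ δ L ρ r : ℝ} (hδ : 0 < δ)
    (hr : 0 < r) (hφ : QuadControl φ (φ₁ • ContinuousLinearMap.id ℝ ℝ) δ L)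
    (hP : HasQuadExpansion P 1 p₁ p₂) (hW : HasQuadExpansion W 1 w₁ w₂) (hρ : |ρ| ≤ 1)
    (hint : ∀ w, ‖w‖ ≤ r → IntervalIntegrable
      (fun t => P (priceState φ ρ t w) * W (volState t w)) volume 0 1) (a b : ℝ) :
    ∃ s₀ > 0, ∃ M, 0 ≤ M ∧ ∀ s : ℝ, |s| ≤ s₀ →
      |payoff φ P W ρ (s • payoffGradient ρ a b)
        - s * ((w₁ * (a * ρ + b) + p₁ * ((a + ρ * b) * φ 0)) / 3)
        - s ^ 2 * (2 / 15 * (w₂ * (a * ρ + b) ^ 2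
            + p₁ * ((a + ρ * b) * φ 0) * (w₁ * (a * ρ + b))
            + (p₁ * ((a + ρ * b) * (φ₁ * (a * ρ + b) / 2)) + p₂ * ((a + ρ * b) * φ 0) ^ 2)))|
        ≤ M * |s| ^ 3 := by
  set B := a * ρ + b with hB
  set C := a + ρ * b with hC
  set k := payoffGradient ρ a b with hk
  set Θ : ℝ → ℝ := fun x => C * ∫ u in (0 : ℝ)..x, φ (B * u) with hΘ
  have hΘ1 : HasQuadExpansion Θ 0 (C * φ 0) (C * (φ₁ * B / 2)) := by
    have := (hasQuadExpansion_integral hδ hφ B).const_mul C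
    rwa [mul_zero] at this
  have hB1 : HasQuadExpansion (fun x => B * x) 0 B 0 := by
    refine (isBigO_zero _ _).congr_left fun y => ?_
    ring
  -- The integrand of the payoff on the ray as a function of the single variable `x = s(t - t²/2)`.
  have hQ := (hP.comp hΘ1 (hΘ1.isBigO_id.trans_tendsto tendsto_id)).mul
    (hW.comp hB1 (hB1.isBigO_id.trans_tendsto tendsto_id))
  obtain ⟨e, he, M, hM, hbound⟩ := hQ.exists_bound
  refine ⟨min e (min (δ / (1 + |B|)) (r / (1 + ‖k‖))), by positivity, M, hM, fun s hs => ?_⟩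
  have hs1 : |s| ≤ e := hs.trans (min_le_left _ _)
  have hs2 : |s * B| ≤ δ := by
    have h1 : |s| ≤ δ / (1 + |B|) := hs.trans ((min_le_right _ _).trans (min_le_left _ _))
    rw [le_div_iff₀ (by positivity)] at h1
    rw [abs_mul]; nlinarith [abs_nonneg s]
  have hs3 : ‖s • k‖ ≤ r := by
    have h1 : |s| ≤ r / (1 + ‖k‖) := hs.trans ((min_le_right _ _).trans (min_le_right _ _))
    rw [le_div_iff₀ (by positivity)] at h1
    rw [norm_smul, Real.norm_eq_abs]; nlinarith [abs_nonneg s]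
  have hτ : ∀ t ∈ Icc (0 : ℝ) 1, |t - t ^ 2 / 2| ≤ 1 := fun r hr =>
    abs_le.mpr ⟨by nlinarith [hr.1, hr.2], by nlinarith [hr.1, hr.2]⟩
  set q₁ := w₁ * B + p₁ * (C * φ 0) with hq₁
  set q₂ := w₂ * B ^ 2 + p₁ * (C * φ 0) * (w₁ * B)
    + (p₁ * (C * (φ₁ * B / 2)) + p₂ * (C * φ 0) ^ 2) with hq₂
  -- The moments of the clock are `∫(t - t²/2) = 1/3` and `∫(t - t²/2)² = 2/15`.
  have hpoly : ∫ t in (0 : ℝ)..1, (1 + s * q₁ * (t - t ^ 2 / 2) + s ^ 2 * q₂ * (t - t ^ 2 / 2) ^ 2)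
      = 1 + s * (q₁ / 3) + s ^ 2 * (2 / 15 * q₂) := by
    have hd : ∀ t : ℝ, HasDerivAt (fun t : ℝ => t + s * q₁ * (t ^ 2 / 2 - t ^ 3 / 6)
        + s ^ 2 * q₂ * (t ^ 3 / 3 - t ^ 4 / 4 + t ^ 5 / 20))
        (1 + s * q₁ * (t - t ^ 2 / 2) + s ^ 2 * q₂ * (t - t ^ 2 / 2) ^ 2) t := by
      intro t
      have h1 := ((hasDerivAt_pow 2 t).div_const 2).fun_sub ((hasDerivAt_pow 3 t).div_const 6)
      have h2 := (((hasDerivAt_pow 3 t).div_const 3).fun_sub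
        ((hasDerivAt_pow 4 t).div_const 4)).fun_add ((hasDerivAt_pow 5 t).div_const 20)
      refine (((hasDerivAt_id t).fun_add (h1.const_mul (s * q₁))).fun_add
        (h2.const_mul (s ^ 2 * q₂))).congr_deriv ?_
      norm_num
      ring
    rw [intervalIntegral.integral_eq_sub_of_hasDerivAt (fun t _ => hd t)
      (Continuous.intervalIntegrable (by fun_prop) _ _)]
    norm_num
    ring
  have hsplit : payoff φ P W ρ (s • k) - s * (q₁ / 3) - s ^ 2 * (2 / 15 * q₂)
      = ∫ t in (0 : ℝ)..1, (P (priceState φ ρ t (s • k)) * W (volState t (s • k))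
        - (1 + s * q₁ * (t - t ^ 2 / 2) + s ^ 2 * q₂ * (t - t ^ 2 / 2) ^ 2)) := by
    rw [intervalIntegral.integral_sub (hint _ hs3)
      (Continuous.intervalIntegrable (by fun_prop) _ _), hpoly, payoff]
    ring
  rw [hsplit]
  have := intervalIntegral.norm_integral_le_of_norm_le_const (a := (0 : ℝ)) (b := 1)
    (C := M * |s| ^ 3) (f := fun t => P (priceState φ ρ t (s • k)) * W (volState t (s • k))
        - (1 + s * q₁ * (t - t ^ 2 / 2) + s ^ 2 * q₂ * (t - t ^ 2 / 2) ^ 2)) fun t ht => ?_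
  · simpa using this
  rw [uIoc_of_le zero_le_one] at ht
  have ht' : t ∈ Icc (0 : ℝ) 1 := Ioc_subset_Icc_self ht
  have hsτ : |s * (t - t ^ 2 / 2)| ≤ |s| := by
    rw [abs_mul]; exact mul_le_of_le_one_right (abs_nonneg _) (hτ t ht')
  have h1 := hbound (s * (t - t ^ 2 / 2)) (hsτ.trans hs1)
  rw [priceState_smul_payoffGradient hδ hφ hρ hs2 ht', map_smul,
    volState_payoffGradient _ _ _ ht', Real.norm_eq_abs, smul_eq_mul]
  rw [← hB, ← hC]
  calc _ = _ := by
        congr 1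
        rw [show s * (B * (t - t ^ 2 / 2)) = B * (s * (t - t ^ 2 / 2)) by ring, hq₁, hq₂]
        ring
    _ ≤ M * |s * (t - t ^ 2 / 2)| ^ 3 := h1
    _ ≤ _ := by gcongr

end ControlSpace

/-! ### Absolutely continuous paths and local flows -/

theorem exists_lipschitzOnWith_of_hasDerivAt {f f' : ℝ → ℝ} {a b : ℝ}
    (hf : ∀ x ∈ Icc a b, HasDerivAt f (f' x) x) (hf' : ContinuousOn f' (Icc a b)) :
    ∃ K, LipschitzOnWith K f (Icc a b) := by
  obtain ⟨C, hC⟩ := isCompact_Icc.exists_bound_of_continuousOn hf'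
  refine ⟨Real.toNNReal C, (convex_Icc a b).lipschitzOnWith_of_nnnorm_hasDerivWithin_le
    (fun x hx => (hf x hx).hasDerivWithinAt) fun x hx => ?_⟩
  rw [← NNReal.coe_le_coe, coe_nnnorm]
  exact (hC x hx).trans (Real.le_coe_toNNReal C)

theorem LipschitzOnWith.comp_absolutelyContinuousOnInterval {f g : ℝ → ℝ} {K : NNReal}
    {s : Set ℝ} {a b : ℝ} (hf : LipschitzOnWith K f s)
    (hg : AbsolutelyContinuousOnInterval g a b) (hs : MapsTo g (uIcc a b) s) :
    AbsolutelyContinuousOnInterval (fun t => f (g t)) a b := by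
  rw [absolutelyContinuousOnInterval_iff] at hg ⊢
  intro ε hε
  obtain ⟨δ, hδ, h⟩ := hg (ε / (K + 1)) (by positivity)
  refine ⟨δ, hδ, fun E hE hEδ => ?_⟩
  have h1 := h E hE hEδ
  have hmem : ∀ i ∈ Finset.range E.1, (E.2 i).1 ∈ uIcc a b ∧ (E.2 i).2 ∈ uIcc a b :=
    fun i hi => hE.left i hi
  calc _ ≤ ∑ i ∈ Finset.range E.1, (K : ℝ) * dist (g (E.2 i).1) (g (E.2 i).2) :=
        Finset.sum_le_sum fun i hi =>
          hf.dist_le_mul _ (hs (hmem i hi).1) _ (hs (hmem i hi).2)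
    _ = K * ∑ i ∈ Finset.range E.1, dist (g (E.2 i).1) (g (E.2 i).2) := by
        rw [Finset.mul_sum]
    _ ≤ K * (ε / (K + 1)) := by gcongr
    _ < (K + 1) * (ε / (K + 1)) := by
        have : 0 < ε / ((K : ℝ) + 1) := by positivity
        nlinarith
    _ = ε := by field_simp

theorem AbsolutelyContinuousOnInterval.comp_of_hasDerivAt {f f' g : ℝ → ℝ} {a b c d : ℝ}
    (hg : AbsolutelyContinuousOnInterval g c d) (hs : MapsTo g (uIcc c d) (Icc a b))
    (hf : ∀ x ∈ Icc a b, HasDerivAt f (f' x) x) (hf' : ContinuousOn f' (Icc a b)) :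
    AbsolutelyContinuousOnInterval (fun t => f (g t)) c d := by
  obtain ⟨K, hK⟩ := exists_lipschitzOnWith_of_hasDerivAt hf hf'
  exact hK.comp_absolutelyContinuousOnInterval hg hs

/-- `B` is a primitive of `1 / p`, and `θ` is its inverse on `[-δ, δ]`. -/
structure IsLocalFlow (p B θ : ℝ → ℝ) (δ : ℝ) : Prop where
  continuous : Continuous p
  pos : ∀ v, 0 < p v
  hasDerivAt_primitive : ∀ v, HasDerivAt B (1 / p v) v
  injective : Function.Injective B
  primitive_zero : B 0 = 0
  flow_zero : θ 0 = 0
  right_inv : ∀ y, |y| ≤ δ → B (θ y) = y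
  hasDerivAt_flow : ∀ y, |y| ≤ δ → HasDerivAt θ (p (θ y)) y

namespace IsLocalFlow

variable {p B θ : ℝ → ℝ} {δ : ℝ}

/-- Injectivity of the primitive on the whole line means that `v` needs no a priori bound: smallness
of `B v` alone places it on the local flow. -/
theorem eq_flow (h : IsLocalFlow p B θ δ) {v y : ℝ} (hy : |y| ≤ δ) (hB : B v = y) : v = θ y :=
  h.injective (hB.trans (h.right_inv y hy).symm)

theorem absolutelyContinuous_flow (h : IsLocalFlow p B θ δ) {Y : ℝ → ℝ}
    (hY : AbsolutelyContinuousOnInterval Y 0 1) (hYδ : ∀ t ∈ Icc (0 : ℝ) 1, |Y t| ≤ δ) :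
    AbsolutelyContinuousOnInterval (fun t => θ (Y t)) 0 1 := by
  refine hY.comp_of_hasDerivAt (a := -δ) (b := δ) (f' := fun y => p (θ y)) (fun t ht => ?_)
    (fun y hy => h.hasDerivAt_flow y (abs_le.mpr hy)) fun y hy => ?_
  · rw [uIcc_of_le zero_le_one] at ht
    exact abs_le.mp (hYδ t ht)
  · exact (h.continuous.continuousAt.comp
      (h.hasDerivAt_flow y (abs_le.mpr hy)).continuousAt).continuousWithinAt

/-- Absolutely continuous paths are recovered from their logarithmic velocity. -/
theorem primitive_eq_integral (h : IsLocalFlow p B θ δ) {v β : ℝ → ℝ}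
    (hv : AbsolutelyContinuousOnInterval v 0 1) (hv0 : v 0 = 0)
    (hβ : ∀ᵐ t ∂(volume.restrict (Icc (0 : ℝ) 1)), deriv v t / p (v t) = β t)
    {t : ℝ} (ht : t ∈ Icc (0 : ℝ) 1) : B (v t) = ∫ s in (0 : ℝ)..t, β s := by
  obtain ⟨M, hM⟩ := hv.exists_bound
  have hac : AbsolutelyContinuousOnInterval (fun t => B (v t)) 0 1 :=
    hv.comp_of_hasDerivAt (a := -M) (b := M) (fun t ht => abs_le.mp (hM t ht))
      (fun x _ => h.hasDerivAt_primitive x)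
      ((continuous_const.div h.continuous fun x => (h.pos x).ne').continuousOn)
  have hsub : uIcc 0 t ⊆ uIcc (0 : ℝ) 1 := by
    rw [uIcc_of_le ht.1, uIcc_of_le zero_le_one]; exact Icc_subset_Icc_right ht.2
  have hint := (hac.mono hsub).integral_deriv_eq_sub
  rw [hv0, h.primitive_zero, sub_zero] at hint
  rw [← hint]
  refine intervalIntegral.integral_congr_ae ?_
  filter_upwards [UnitL2.ae_restrict_interval ht hβ, hv.ae_differentiableAt] with s hs1 hs2 hs
  have hd := (h.hasDerivAt_primitive (v s)).comp s
    (hs2 (hsub (uIoc_subset_uIcc hs))).hasDerivAt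
  have : deriv (fun t => B (v t)) s = 1 / p (v s) * deriv v s := hd.deriv
  rw [this, ← hs1 hs]
  ring

end IsLocalFlow

/-! ### Energy as the squared norm of the control -/

theorem lintegral_ofReal_sq (γ : UnitL2) :
    ∫⁻ t in Icc (0 : ℝ) 1, ENNReal.ofReal (γ t ^ 2) = ENNReal.ofReal (‖γ‖ ^ 2) := by
  have h1 : Integrable (fun t => γ t ^ 2) (volume.restrict (Icc (0 : ℝ) 1)) :=
    (Lp.memLp γ).integrable_sq
  rw [← ofReal_integral_eq_lintegral_ofReal h1 (ae_of_all _ fun t => sq_nonneg _),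
    ← real_inner_self_eq_norm_sq, L2.inner_def]
  congr 1
  refine integral_congr_ae (ae_of_all _ fun t => ?_)
  simp [pow_two]

theorem one_sub_sq_pos {ρ : ℝ} (h1 : -1 < ρ) (h2 : ρ < 1) : 0 < 1 - ρ ^ 2 := by nlinarith

section Energy

variable {η σ : ℝ → ℝ} {ρ S₀ V₀ K : ℝ} {g h : ℝ → ℝ}

/-- The controls driving the pair of paths `(g, h)`. -/
def IsDriver (η σ : ℝ → ℝ) (ρ : ℝ) (g h : ℝ → ℝ) (w : ControlSpace) : Prop :=
  (∀ᵐ t ∂(volume.restrict (Icc (0 : ℝ) 1)),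
    deriv g t / (η (Real.exp (g t)) * Real.sqrt (Real.exp (h t)))
      = ControlSpace.priceDriver ρ w t) ∧
  ∀ᵐ t ∂(volume.restrict (Icc (0 : ℝ) 1)), deriv h t / σ (Real.exp (h t)) = w.snd t

/-- Subtracting `ρβ` from the price driver leaves `√(1-ρ²)α`, whose square cancels the prefactor
`1/(1-ρ²)`. -/
theorem IsDriver.energyFunctional_eq {w : ControlSpace} (hw : IsDriver η σ ρ g h w)
    (hρ1 : -1 < ρ) (hρ2 : ρ < 1) :
    energyFunctional η σ ρ g h = ENNReal.ofReal (‖w‖ ^ 2 / 2) := by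
  have hρ := one_sub_sq_pos hρ1 hρ2
  have h1 : ∫⁻ t in Icc (0 : ℝ) 1, ENNReal.ofReal
        ((deriv g t / (η (Real.exp (g t)) * Real.sqrt (Real.exp (h t)))
          - ρ * deriv h t / σ (Real.exp (h t))) ^ 2)
      = ENNReal.ofReal (1 - ρ ^ 2) * ENNReal.ofReal (‖w.fst‖ ^ 2) := by
    rw [← lintegral_ofReal_sq, ← lintegral_const_mul' _ _ ENNReal.ofReal_ne_top]
    refine lintegral_congr_ae ?_
    filter_upwards [hw.1, hw.2, Lp.coeFn_add (ρ • w.snd) (Real.sqrt (1 - ρ ^ 2) • w.fst),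
      Lp.coeFn_smul ρ w.snd, Lp.coeFn_smul (Real.sqrt (1 - ρ ^ 2)) w.fst] with t h1 h2 h3 h4 h5
    rw [← ENNReal.ofReal_mul hρ.le, h1, mul_div_assoc, h2, ControlSpace.priceDriver_apply, h3,
      Pi.add_apply, h4, h5, Pi.smul_apply, Pi.smul_apply, smul_eq_mul, smul_eq_mul,
      add_sub_cancel_left, mul_pow, Real.sq_sqrt hρ.le]
  have h2 : ∫⁻ t in Icc (0 : ℝ) 1, ENNReal.ofReal ((deriv h t / σ (Real.exp (h t))) ^ 2)
      = ENNReal.ofReal (‖w.snd‖ ^ 2) := by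
    rw [← lintegral_ofReal_sq]
    refine lintegral_congr_ae ?_
    filter_upwards [hw.2] with t h2
    rw [h2]
  rw [energyFunctional, h1, h2, ← mul_assoc, ← ENNReal.ofReal_mul (by positivity),
    ← ENNReal.ofReal_mul (by positivity), ← ENNReal.ofReal_mul (by norm_num),
    ← ENNReal.ofReal_add (by positivity) (by positivity), ControlSpace.norm_sq_eq]
  congr 1
  field_simp

theorem memLp_two_of_lintegral_sq_ne_top {f : ℝ → ℝ}
    (hf : AEStronglyMeasurable f (volume.restrict (Icc (0 : ℝ) 1)))
    (h : ∫⁻ t in Icc (0 : ℝ) 1, ENNReal.ofReal (f t ^ 2) ≠ ∞) :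
    MemLp f 2 (volume.restrict (Icc (0 : ℝ) 1)) := by
  rw [memLp_two_iff_integrable_sq hf]
  exact (lintegral_ofReal_ne_top_iff_integrable (hf.pow 2) (ae_of_all _ fun t => sq_nonneg _)).mp h

/-- Both weights in the energy are positive, so finite energy makes each integral finite; this gives
`β ∈ L²`, then `α = (p - ρβ)/√(1-ρ²) ∈ L²`. -/
theorem exists_isDriver (hη : ContinuousOn η (Ioi 0)) (hσ : ContinuousOn σ (Ioi 0))
    (hρ1 : -1 < ρ) (hρ2 : ρ < 1) (hg : ContinuousOn g (Icc 0 1)) (hh : ContinuousOn h (Icc 0 1))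
    (hfin : energyFunctional η σ ρ g h ≠ ∞) : ∃ w, IsDriver η σ ρ g h w := by
  have hρ := one_sub_sq_pos hρ1 hρ2
  set p : ℝ → ℝ := fun t => deriv g t / (η (Real.exp (g t)) * Real.sqrt (Real.exp (h t))) with hp
  set b : ℝ → ℝ := fun t => deriv h t / σ (Real.exp (h t)) with hb
  have hcont : ∀ {f u : ℝ → ℝ}, ContinuousOn f (Ioi 0) → ContinuousOn u (Icc 0 1) →
      ContinuousOn (fun t => f (Real.exp (u t))) (Icc 0 1) := fun hf hu =>
    hf.comp (Real.continuous_exp.comp_continuousOn hu) fun t _ => Real.exp_pos _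
  have hbm : AEStronglyMeasurable b (volume.restrict (Icc (0 : ℝ) 1)) := by
    refine ((measurable_deriv h).aemeasurable.div ?_).aestronglyMeasurable
    exact (hcont hσ hh).aemeasurable measurableSet_Icc
  have hpm : AEStronglyMeasurable p (volume.restrict (Icc (0 : ℝ) 1)) := by
    refine ((measurable_deriv g).aemeasurable.div ?_).aestronglyMeasurable
    exact ((hcont hη hg).mul (hcont Real.continuous_sqrt.continuousOn hh)).aemeasurable
      measurableSet_Icc
  have h1 : ∫⁻ t in Icc (0 : ℝ) 1, ENNReal.ofReal ((p t - ρ * deriv h t / σ (Real.exp (h t))) ^ 2)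
      ≠ ∞ := by
    intro htop
    apply hfin
    rw [energyFunctional, htop, ENNReal.mul_top (by simpa using hρ), top_add]
  have h2 : ∫⁻ t in Icc (0 : ℝ) 1, ENNReal.ofReal (b t ^ 2) ≠ ∞ := by
    intro htop
    apply hfin
    rw [energyFunctional, htop, ENNReal.mul_top (by simp), add_top]
  have hbL := memLp_two_of_lintegral_sq_ne_top hbm h2
  have haL : MemLp (fun t => p t - ρ * b t) 2 (volume.restrict (Icc (0 : ℝ) 1)) := by
    refine memLp_two_of_lintegral_sq_ne_top (hpm.sub (hbm.const_mul ρ)) ?_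
    simpa only [hb, mul_div_assoc] using h1
  refine ⟨WithLp.toLp 2 ((Real.sqrt (1 - ρ ^ 2))⁻¹ • haL.toLp _, hbL.toLp _), ?_, ?_⟩
  · rw [ControlSpace.priceDriver_apply]
    change ∀ᵐ t ∂(volume.restrict (Icc (0 : ℝ) 1)), p t = (ρ • hbL.toLp _ +
      Real.sqrt (1 - ρ ^ 2) • (Real.sqrt (1 - ρ ^ 2))⁻¹ • haL.toLp _ : UnitL2) t
    rw [smul_inv_smul₀ (Real.sqrt_pos.mpr hρ).ne']
    filter_upwards [Lp.coeFn_add (ρ • hbL.toLp _) (haL.toLp _), Lp.coeFn_smul ρ (hbL.toLp _),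
      hbL.coeFn_toLp, haL.coeFn_toLp] with t h3 h4 h5 h6
    rw [h3, Pi.add_apply, h4, Pi.smul_apply, h5, h6, smul_eq_mul]
    ring
  · filter_upwards [hbL.coeFn_toLp] with t h5 using h5.symm

end Energy

/-! ### Correspondence between paths and controls -/

section Paths

open ControlSpace

/-- The volatility level `√V` in terms of the flow coordinate. -/
noncomputable def volFactor (V₀ : ℝ) (θ : ℝ → ℝ) (y : ℝ) : ℝ := Real.sqrt (V₀ * Real.exp (θ y))

/-- The normalized squared local volatility in terms of the flow coordinate. -/
noncomputable def localVolFactor (η : ℝ → ℝ) (S₀ : ℝ) (ζ : ℝ → ℝ) (z : ℝ) : ℝ :=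
  (η (S₀ * Real.exp (ζ z)) / η S₀) ^ 2

variable {η σ : ℝ → ℝ} {ρ S₀ V₀ K δ : ℝ} {A ζ B θ : ℝ → ℝ} {g h : ℝ → ℝ} {w : ControlSpace}

theorem exp_log_add {a : ℝ} (ha : 0 < a) (x : ℝ) :
    Real.exp (Real.log a + x) = a * Real.exp x := by
  rw [Real.exp_add, Real.exp_log ha]

theorem integral_eq_payoff (hS₀ : 0 < S₀) (hV₀ : 0 < V₀) (hη : 0 < η S₀)
    (hh : ∀ t ∈ Icc (0 : ℝ) 1, h t = Real.log V₀ + θ (volState t w))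
    (hg : ∀ t ∈ Icc (0 : ℝ) 1,
      g t = Real.log S₀ + ζ (priceState (volFactor V₀ θ) ρ t w)) :
    ∫ t in (0 : ℝ)..1, Real.exp (h t) * η (Real.exp (g t)) ^ 2
      = V₀ * η S₀ ^ 2 * (payoff (volFactor V₀ θ) (localVolFactor η S₀ ζ)
          (fun y => Real.exp (θ y)) ρ w + 1) := by
  rw [payoff, sub_add_cancel, ← intervalIntegral.integral_const_mul]
  refine intervalIntegral.integral_congr fun t ht => ?_
  rw [uIcc_of_le zero_le_one] at ht
  rw [hh t ht, hg t ht, exp_log_add hV₀, exp_log_add hS₀, localVolFactor]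
  field_simp

theorem ae_hasDerivAt_integral_unit {f : ℝ → ℝ} (hf : IntervalIntegrable f volume 0 1) :
    ∀ᵐ t ∂(volume.restrict (Icc (0 : ℝ) 1)),
      HasDerivAt (fun t => ∫ s in (0 : ℝ)..t, f s) (f t) t := by
  rw [ae_restrict_iff' measurableSet_Icc]
  filter_upwards [hf.ae_hasDerivAt_integral] with t ht htI
  exact ht (by rwa [uIcc_of_le zero_le_one]) 0 (by simp)

/-- The system is triangular: the equation for `h` is autonomous and integrates first; with `√(e^h)`
known and moved to the right-hand side, the equation for `g` becomes autonomous too. -/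
theorem paths_of_isDriver (hS₀ : 0 < S₀) (hV₀ : 0 < V₀)
    (hA : IsLocalFlow (fun u => η (S₀ * Real.exp u)) A ζ δ)
    (hB : IsLocalFlow (fun v => σ (V₀ * Real.exp v)) B θ δ)
    (hadm : IsAdmissiblePair η S₀ V₀ K g h) (hw : IsDriver η σ ρ g h w) (hwδ : ‖w‖ ≤ δ)
    (hz : ∀ t ∈ Icc (0 : ℝ) 1, |priceState (volFactor V₀ θ) ρ t w| ≤ δ) :
    (∀ t ∈ Icc (0 : ℝ) 1, h t = Real.log V₀ + θ (volState t w)) ∧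
    ∀ t ∈ Icc (0 : ℝ) 1, g t = Real.log S₀ + ζ (priceState (volFactor V₀ θ) ρ t w) := by
  have hshift : ∀ {u : ℝ → ℝ} (c : ℝ), AbsolutelyContinuousOnInterval u 0 1 →
      AbsolutelyContinuousOnInterval (fun t => u t - c) 0 1 := fun c hu =>
    hu.fun_sub (LipschitzWith.const c).lipschitzOnWith.absolutelyContinuousOnInterval
  have hexp : ∀ {a : ℝ}, 0 < a → ∀ x, a * Real.exp (x - Real.log a) = Real.exp x := by
    intro a ha x
    rw [Real.exp_sub, Real.exp_log ha]; field_simp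
  have hpath : ∀ t ∈ Icc (0 : ℝ) 1, h t = Real.log V₀ + θ (volState t w) := by
    intro t ht
    have := hB.primitive_eq_integral (hshift (Real.log V₀) hadm.ac_h) (by rw [hadm.h_zero, sub_self])
      (β := w.snd) (by
        filter_upwards [hw.2] with t ht
        rw [deriv_sub_const_fun, hexp hV₀]
        exact ht) ht
    rw [← volState_apply ht] at this
    have := hB.eq_flow ((abs_volState_le t w).trans hwδ) this
    linarith
  refine ⟨hpath, fun t ht => ?_⟩
  have := hA.primitive_eq_integral (hshift (Real.log S₀) hadm.ac_g) (by rw [hadm.g_zero, sub_self])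
    (β := fun s => volFactor V₀ θ (volState s w) * priceDriver ρ w s) (by
      filter_upwards [hw.1, ae_restrict_mem measurableSet_Icc] with t ht htI
      rw [deriv_sub_const_fun, hexp hS₀, ← ht, hpath t htI, exp_log_add hV₀, volFactor]
      have : Real.sqrt (V₀ * Real.exp (θ (volState t w))) ≠ 0 :=
        (Real.sqrt_pos.mpr (by positivity)).ne'
      field_simp) ht
  have := hA.eq_flow (hz t ht) this
  linarith

/-- The converse of `paths_of_isDriver`: the flows applied to the states give absolutely continuous
paths, and the chain rule returns the control almost everywhere. -/
theorem exists_paths_of_control (hS₀ : 0 < S₀) (hV₀ : 0 < V₀)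
    (hA : IsLocalFlow (fun u => η (S₀ * Real.exp u)) A ζ δ)
    (hB : IsLocalFlow (fun v => σ (V₀ * Real.exp v)) B θ δ)
    (hφ : ∀ w : ControlSpace, ‖w‖ ≤ δ →
      ContinuousOn (fun t => volFactor V₀ θ (volState t w)) (Icc 0 1)) (hwδ : ‖w‖ ≤ δ)
    (hz : ∀ t ∈ Icc (0 : ℝ) 1, |priceState (volFactor V₀ θ) ρ t w| ≤ δ) :
    ∃ g h : ℝ → ℝ, IsAdmissiblePair η S₀ V₀ (V₀ * η S₀ ^ 2 * (payoff (volFactor V₀ θ)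
        (localVolFactor η S₀ ζ) (fun y => Real.exp (θ y)) ρ w + 1)) g h ∧
      IsDriver η σ ρ g h w := by
  set Y : ℝ → ℝ := fun t => ∫ s in (0 : ℝ)..t, w.snd s with hY
  set Z : ℝ → ℝ := fun t => priceState (volFactor V₀ θ) ρ t w with hZ
  have hYvol : ∀ t ∈ Icc (0 : ℝ) 1, Y t = volState t w := fun t ht => (volState_apply ht w).symm
  have hYδ : ∀ t ∈ Icc (0 : ℝ) 1, |Y t| ≤ δ := fun t ht => by
    rw [hYvol t ht]; exact (abs_volState_le t w).trans hwδ
  have hYint := w.snd.intervalIntegrable_one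
  have hZint := (priceDriver ρ w).intervalIntegrable_mul (hφ w hwδ)
  have hYac : AbsolutelyContinuousOnInterval Y 0 1 :=
    hYint.absolutelyContinuousOnInterval_intervalIntegral (by simp)
  have hZac : AbsolutelyContinuousOnInterval Z 0 1 :=
    hZint.absolutelyContinuousOnInterval_intervalIntegral (by simp)
  have hconst : ∀ c : ℝ, AbsolutelyContinuousOnInterval (fun _ : ℝ => c) 0 1 := fun c =>
    (LipschitzWith.const c).lipschitzOnWith.absolutelyContinuousOnInterval
  have hη : 0 < η S₀ := by simpa using hA.pos 0
  refine ⟨fun t => Real.log S₀ + ζ (Z t), fun t => Real.log V₀ + θ (Y t), ⟨?_, ?_, ?_, ?_, ?_⟩,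
    ?_, ?_⟩
  · exact (hconst _).fun_add (hA.absolutelyContinuous_flow hZac hz)
  · exact (hconst _).fun_add (hB.absolutelyContinuous_flow hYac hYδ)
  · simp [hZ, priceState, hA.flow_zero]
  · simp [hY, hB.flow_zero]
  · exact integral_eq_payoff hS₀ hV₀ hη (fun t ht => by rw [hYvol t ht]) fun t _ => rfl
  · filter_upwards [ae_hasDerivAt_integral_unit hZint, ae_restrict_mem measurableSet_Icc]
      with t ht htI
    have hd := (((hA.hasDerivAt_flow (Z t) (hz t htI)).comp t ht).const_add (Real.log S₀)).deriv
    simp only [Function.comp_def] at hd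
    have hpos := hA.pos (ζ (Z t))
    have hs : 0 < Real.sqrt (V₀ * Real.exp (θ (volState t w))) :=
      Real.sqrt_pos.mpr (by positivity)
    rw [exp_log_add hS₀, exp_log_add hV₀, hYvol t htI, div_eq_iff (by positivity)]
    refine Eq.trans hd ?_
    rw [volFactor]
    ring
  · filter_upwards [ae_hasDerivAt_integral_unit hYint, ae_restrict_mem measurableSet_Icc]
      with t ht htI
    have hd := (((hB.hasDerivAt_flow (Y t) (hYδ t htI)).comp t ht).const_add (Real.log V₀)).deriv
    simp only [Function.comp_def] at hd
    have hpos := hB.pos (θ (Y t))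
    rw [exp_log_add hV₀, div_eq_iff hpos.ne']
    refine Eq.trans hd ?_
    ring

end Paths

/-! ### The rate function as a constrained minimum -/

section RateFunction

open ControlSpace

variable {η σ : ℝ → ℝ} {ρ S₀ V₀ δ L : ℝ} {A ζ B θ : ℝ → ℝ} {φ₁ p₁ p₂ w₁ w₂ : ℝ}

/-- The rate function near the money as a constrained minimum over the Hilbert space of controls,
with its expansion in the payoff level `c` and the first order behaviour of optimal paths. -/
theorem exists_rateFunction_expansion (hS₀ : 0 < S₀) (hV₀ : 0 < V₀)
    (hρ1 : -1 < ρ) (hρ2 : ρ < 1)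
    (hη : ContinuousOn η (Ioi 0)) (hσ : ContinuousOn σ (Ioi 0))
    (hδ : 0 < δ)
    (hA : IsLocalFlow (fun u => η (S₀ * Real.exp u)) A ζ δ)
    (hB : IsLocalFlow (fun v => σ (V₀ * Real.exp v)) B θ δ)
    (hφ : QuadControl (volFactor V₀ θ) (φ₁ • ContinuousLinearMap.id ℝ ℝ) δ L)
    (hP : QuadControl (localVolFactor η S₀ ζ) (p₁ • ContinuousLinearMap.id ℝ ℝ) δ L)
    (hW : QuadControl (fun y => Real.exp (θ y)) (w₁ • ContinuousLinearMap.id ℝ ℝ) δ L)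
    (hP' : HasQuadExpansion (localVolFactor η S₀ ζ) 1 p₁ p₂)
    (hW' : HasQuadExpansion (fun y => Real.exp (θ y)) 1 w₁ w₂)
    {φ₀ a b B₁ C₁ κ q : ℝ} (hφ₀ : φ₀ = volFactor V₀ θ 0) (ha : a = p₁ * φ₀) (hb : b = w₁)
    (hB₁ : B₁ = a * ρ + b) (hC₁ : C₁ = a + ρ * b)
    (hκ : κ = (a ^ 2 + 2 * a * b * ρ + b ^ 2) / 3) (hκ0 : 0 < κ)
    (hq : q = 2 / 15 * (w₂ * B₁ ^ 2 + p₁ * (C₁ * φ₀) * (w₁ * B₁)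
      + (p₁ * (C₁ * (φ₁ * B₁ / 2)) + p₂ * (C₁ * φ₀) ^ 2))) :
    ∃ ε > 0, ∃ M, 0 ≤ M ∧ ∀ c : ℝ, |c| ≤ ε →
      rateFunction η σ ρ S₀ V₀ (V₀ * η S₀ ^ 2 * (c + 1)) ≠ ∞ ∧
      |(rateFunction η σ ρ S₀ V₀ (V₀ * η S₀ ^ 2 * (c + 1))).toReal
        - (c ^ 2 / κ - 2 * q * c ^ 3 / κ ^ 3) / 2| ≤ M * c ^ 4 ∧
      (∃ g h : ℝ → ℝ, IsOptimalPair η σ ρ S₀ V₀ (V₀ * η S₀ ^ 2 * (c + 1)) g h) ∧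
      ∀ g h : ℝ → ℝ, IsOptimalPair η σ ρ S₀ V₀ (V₀ * η S₀ ^ 2 * (c + 1)) g h →
        ∀ t ∈ Icc (0 : ℝ) 1, ∃ y z : ℝ,
          h t = Real.log V₀ + θ y ∧ g t = Real.log S₀ + ζ z ∧
          |y - c / κ * (B₁ * (t - t ^ 2 / 2))| ≤ M * c ^ 2 ∧
          |z - c / κ * (φ₀ * (C₁ * (t - t ^ 2 / 2)))| ≤ M * c ^ 2 := by
  have hρ : |ρ| ≤ 1 := abs_le.mpr ⟨hρ1.le, hρ2.le⟩
  have hη0 : 0 < η S₀ := by simpa using hA.pos 0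
  set φ := volFactor V₀ θ with hφdef
  set P := localVolFactor η S₀ ζ with hPdef
  set W : ℝ → ℝ := fun y => Real.exp (θ y) with hWdef
  set k := payoffGradient ρ a b with hk
  have hkκ : ‖k‖ ^ 2 = κ := by rw [hk, norm_payoffGradient_sq hρ, hκ]
  have hk0 : k ≠ 0 := by
    intro h0
    rw [h0, norm_zero] at hkκ
    norm_num at hkκ
    linarith
  have hknorm : 0 < ‖k‖ := norm_pos_iff.mpr hk0
  obtain ⟨r₁, hr₁, hr₁δ, hzδ, hzQ, M₁, hG₁⟩ := exists_quadControl_payoff (ρ := ρ) hδ hφ hP hW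
    (by simp [hPdef, localVolFactor, hA.flow_zero, hη0.ne'])
    (by simp [hWdef, hB.flow_zero]) hρ (l := innerSL ℝ k) (fun v => by
      rw [innerSL_apply_apply, hk, inner_payoffGradient, ha, hb, hφ₀])
  have hint : ∀ w : ControlSpace, ‖w‖ ≤ r₁ → IntervalIntegrable
      (fun t => P (priceState φ ρ t w) * W (volState t w)) volume 0 1 := fun w hw =>
    intervalIntegrable_payoff hδ.le hφ hP hW (hw.trans hr₁δ) (hzδ w hw)
  obtain ⟨s₀, hs₀, C, hC, hray⟩ := exists_payoff_ray_expansion hδ hr₁ hφ hP' hW' hρ hint a b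
  have hs₀k : 0 < s₀ * ‖k‖ := by positivity
  -- Points `s • k` of this ball have `|s| ≤ s₀`, where the ray expansion is valid.
  set r := min r₁ (s₀ * ‖k‖) with hr
  have hr0 : 0 < r := lt_min hr₁ hs₀k
  have hrr : r ≤ r₁ := min_le_left _ _
  have hG := hG₁.mono hrr le_rfl
  have hL : 0 ≤ L := hφ.nonneg hδ.le
  have hray' : ∀ s : ℝ, ‖s • k‖ ≤ r →
      |payoff φ P W ρ (s • k) - s * ‖k‖ ^ 2 - s ^ 2 * q| ≤ C * |s| ^ 3 := by
    intro s hs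
    have hs' : |s| ≤ s₀ := by
      have h1 : |s| * ‖k‖ ≤ s₀ * ‖k‖ := by
        rw [← Real.norm_eq_abs, ← norm_smul]; exact hs.trans (min_le_right _ _)
      exact le_of_mul_le_mul_right h1 hknorm
    have := hray s hs'
    rw [← hB₁, ← hC₁, ← hφ₀, ← hq] at this
    rw [hkκ, hκ]
    convert this using 4
    rw [hB₁, hC₁, ha, hb]; ring
  obtain ⟨ε, hε, M, hM, hmain⟩ := hG.constrained_minimum hr0 hk0 hC hray'
  rw [hkκ] at hmain
  refine ⟨ε, hε, M + 16 * L * M ^ 2 + |φ₀| * (2 * M), by positivity, fun c hc => ?_⟩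
  obtain ⟨w, hwr, hwG, hwmin, hwexp, hwM, hwclose⟩ := hmain c hc
  set Kc := V₀ * η S₀ ^ 2 * (c + 1) with hKc
  have hKpos : V₀ * η S₀ ^ 2 ≠ 0 := by positivity
  have hφc : ∀ w : ControlSpace, ‖w‖ ≤ δ →
      ContinuousOn (fun t => φ (volState t w)) (Icc 0 1) := fun w hw =>
    continuousOn_comp_volState hφ hδ.le hw
  -- The local minimizer is global: a pair with no more energy than `w` has a control no longer than
  -- `w`, hence in the ball where the reduction to `payoff = c` holds.
  have hdriver : ∀ g h : ℝ → ℝ, IsAdmissiblePair η S₀ V₀ Kc g h →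
      energyFunctional η σ ρ g h ≤ ENNReal.ofReal (‖w‖ ^ 2 / 2) →
      ∃ w', IsDriver η σ ρ g h w' ∧ ‖w'‖ ≤ ‖w‖ ∧ payoff φ P W ρ w' = c ∧
        (∀ t ∈ Icc (0 : ℝ) 1, h t = Real.log V₀ + θ (volState t w')) ∧
        ∀ t ∈ Icc (0 : ℝ) 1, g t = Real.log S₀ + ζ (priceState φ ρ t w') := by
    intro g h hadm hen
    have hcont : ∀ {u : ℝ → ℝ}, AbsolutelyContinuousOnInterval u 0 1 →
        ContinuousOn u (Icc 0 1) := fun hu => by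
      simpa [uIcc_of_le zero_le_one] using hu.continuousOn
    obtain ⟨w', hw'⟩ := exists_isDriver hη hσ hρ1 hρ2 (hcont hadm.ac_g) (hcont hadm.ac_h)
      (ne_top_of_le_ne_top ENNReal.ofReal_ne_top hen)
    have hle : ‖w'‖ ≤ ‖w‖ := by
      rw [hw'.energyFunctional_eq hρ1 hρ2, ENNReal.ofReal_le_ofReal_iff (by positivity)] at hen
      exact le_of_sq_le_sq (by linarith) (norm_nonneg _)
    have hw'r : ‖w'‖ ≤ r₁ := (hle.trans hwr).trans hrr
    obtain ⟨hh, hg⟩ := paths_of_isDriver hS₀ hV₀ hA hB hadm hw' (hw'r.trans hr₁δ) (hzδ w' hw'r)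
    refine ⟨w', hw', hle, ?_, hh, hg⟩
    have := (integral_eq_payoff hS₀ hV₀ hη0 hh hg).symm.trans hadm.integral_eq
    rw [hKc] at this
    have := mul_left_cancel₀ hKpos this
    linarith
  obtain ⟨g₀, h₀, hadm₀, hdr₀⟩ := exists_paths_of_control (ρ := ρ) hS₀ hV₀ hA hB hφc
    ((hwr.trans hrr).trans hr₁δ) (hzδ w (hwr.trans hrr))
  rw [hwG] at hadm₀
  have hrate : rateFunction η σ ρ S₀ V₀ Kc = ENNReal.ofReal (‖w‖ ^ 2 / 2) := by
    refine le_antisymm ?_ ?_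
    · rw [← hdr₀.energyFunctional_eq hρ1 hρ2]
      exact iInf_le_of_le g₀ (iInf_le_of_le h₀ (iInf_le _ hadm₀))
    · refine le_iInf fun g => le_iInf fun h => le_iInf fun hadm => ?_
      by_contra! hlt
      obtain ⟨w', hw', hle, hw'G, -⟩ := hdriver g h hadm hlt.le
      have h1 := hwmin w' (hle.trans hwr) hw'G
      rw [hw'.energyFunctional_eq hρ1 hρ2, le_antisymm hle h1] at hlt
      exact lt_irrefl _ hlt
  have hc2 : 0 ≤ c ^ 2 := sq_nonneg c
  have hc4 : 0 ≤ c ^ 4 := by positivity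
  have hM1 : 0 ≤ 16 * L * M ^ 2 := by positivity
  have hM2 : 0 ≤ |φ₀| * (2 * M) := by positivity
  refine ⟨by rw [hrate]; exact ENNReal.ofReal_ne_top, ?_,
    ⟨g₀, h₀, hadm₀, by rw [hrate, hdr₀.energyFunctional_eq hρ1 hρ2]⟩, fun g h hopt t ht => ?_⟩
  · rw [hrate, ENNReal.toReal_ofReal (by positivity), ← sub_div, abs_div, abs_two]
    have : M * c ^ 4 ≤ (M + 16 * L * M ^ 2 + |φ₀| * (2 * M)) * c ^ 4 :=
      mul_le_mul_of_nonneg_right (by linarith) hc4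
    have : 0 ≤ M * c ^ 4 := by positivity
    linarith
  · obtain ⟨w', hw', hle, hw'G, hh, hg⟩ := hdriver g h hopt.1 (by rw [hopt.2, hrate])
    have hclose := hwclose w' (hle.trans hwr) hw'G hle
    refine ⟨volState t w', priceState φ ρ t w', hh t ht, hg t ht, ?_, ?_⟩
    · have e : volState t w' - c / κ * (B₁ * (t - t ^ 2 / 2))
          = volState t (w' - (c / κ) • k) := by
        rw [map_sub, map_smul, hk, volState_payoffGradient _ _ _ ht, smul_eq_mul, ← hB₁]
      rw [e]
      exact ((abs_volState_le t _).trans hclose).trans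
        (mul_le_mul_of_nonneg_right (by linarith) hc2)
    · have hw'r₁ : ‖w'‖ ≤ r₁ := (hle.trans hwr).trans hrr
      have h1 := (hzQ t ht).lin w' 0 hw'r₁ (by simpa using hr₁.le)
      rw [priceState_zero φ ρ ht, sub_zero, sub_zero, norm_zero, add_zero, mul_assoc,
        ← pow_two] at h1
      have hφ₀' : φ 0 = φ₀ := hφ₀.symm
      -- The nonlinear part of the price state is `O(‖w'‖²) = O(c²)`; its linear part is evaluated
      -- at `w' - (c/κ)k`, also `O(c²)`.
      have e : priceState φ ρ t w' - c / κ * (φ₀ * (C₁ * (t - t ^ 2 / 2)))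
          = (priceState φ ρ t w' - (φ 0 • (UnitL2.primitive t).comp (priceDriver ρ)) w')
            + φ₀ * UnitL2.primitive t (priceDriver ρ (w' - (c / κ) • k)) := by
        rw [map_sub, map_smul, hk, priceDriver_payoffGradient hρ, map_sub, map_smul, map_smul,
          UnitL2.primitive_ramp ht, ← hC₁, hφ₀']
        simp only [FunLike.coe_smul, Pi.smul_apply, ContinuousLinearMap.comp_apply, smul_eq_mul]
        ring
      rw [e]
      have h2 : ‖w'‖ ≤ M * |c| := hle.trans hwM
      calc _ ≤ _ := abs_add_le _ _
        _ ≤ 16 * L * ‖w'‖ ^ 2 + |φ₀| * (2 * ‖w' - (c / κ) • k‖) := by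
          rw [abs_mul φ₀]
          gcongr
          exact (UnitL2.abs_primitive_le t _).trans (norm_priceDriver_le hρ _)
        _ ≤ 16 * L * (M * |c|) ^ 2 + |φ₀| * (2 * (M * c ^ 2)) := by gcongr
        _ = (16 * L * M ^ 2 + |φ₀| * (2 * M)) * c ^ 2 := by rw [mul_pow, sq_abs]; ring
        _ ≤ _ := mul_le_mul_of_nonneg_right (by linarith) hc2

end RateFunction

/-! ### Logarithmic coordinates, change of level and the final algebra -/

theorem HasQuadExpansion.eq_zero_apply {F : ℝ → ℝ} {a₀ a₁ a₂ : ℝ}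
    (h : HasQuadExpansion F a₀ a₁ a₂) : F 0 = a₀ := by
  obtain ⟨r, hr, C, hC, hb⟩ := h.exists_bound
  have := hb 0 (by simpa using hr.le)
  simpa [sub_eq_zero] using this

theorem HasQuadExpansion.hasDerivAt {F : ℝ → ℝ} {a₀ a₁ a₂ : ℝ}
    (h : HasQuadExpansion F a₀ a₁ a₂) : HasDerivAt F a₁ 0 := by
  rw [hasDerivAt_iff_isLittleO, h.eq_zero_apply]
  have h1 : (fun y : ℝ => F y - (a₀ + a₁ * y + a₂ * y ^ 2) + a₂ * y ^ 2)
      =O[𝓝 0] fun y : ℝ => y ^ 2 :=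
    (h.trans (isBigO_pow_of_le (by norm_num))).add ((isBigO_refl _ _).const_mul_left a₂)
  have h2 : (fun y : ℝ => y ^ 2) =o[𝓝 0] fun y : ℝ => y ^ 1 := isLittleO_pow_pow (by norm_num)
  simp only [pow_one] at h2
  refine (h1.trans_isLittleO h2).congr (fun y => ?_) fun y => by simp
  simp only [sub_zero, smul_eq_mul]
  ring

theorem hasQuadExpansion_of_log {f : ℝ → ℝ} {x₀ a₀ a₁ a₂ : ℝ} (hx₀ : 0 < x₀)
    (h : (fun x : ℝ => f x - (a₀ + a₁ * Real.log (x / x₀) + a₂ * Real.log (x / x₀) ^ 2))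
      =O[𝓝 x₀] fun x : ℝ => Real.log (x / x₀) ^ 3) :
    HasQuadExpansion (fun u => f (x₀ * Real.exp u)) a₀ a₁ a₂ := by
  have ht : Tendsto (fun u : ℝ => x₀ * Real.exp u) (𝓝 0) (𝓝 x₀) := by
    have : Tendsto (fun u : ℝ => x₀ * Real.exp u) (𝓝 0) (𝓝 (x₀ * Real.exp 0)) :=
      Continuous.tendsto (by fun_prop) 0
    simpa using this
  have hlog : ∀ u : ℝ, Real.log (x₀ * Real.exp u / x₀) = u := fun u => by
    rw [mul_div_cancel_left₀ _ hx₀.ne', Real.log_exp]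
  have := h.comp_tendsto ht
  simp only [Function.comp_def, hlog] at this
  exact this

theorem exists_isLocalFlow {p : ℝ → ℝ} (hp : ContDiff ℝ 2 p) (hpos : ∀ v, 0 < p v) :
    ∃ B θ : ℝ → ℝ, ContDiffAt ℝ 2 θ 0 ∧ θ 0 = 0 ∧ (∀ᶠ y in 𝓝 0, HasDerivAt θ (p (θ y)) y) ∧
      ∃ δ > 0, ∀ δ' ≤ δ, IsLocalFlow p B θ δ' := by
  obtain ⟨B, θ, hBd, hmono, hB0, hθ0, hθC, hev⟩ := exists_local_flow hp hpos
  obtain ⟨δ, hδ, hball⟩ := Metric.nhds_basis_closedBall.mem_iff.mp hev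
  have hmem : ∀ y : ℝ, |y| ≤ δ → B (θ y) = y ∧ HasDerivAt θ (p (θ y)) y := fun y hy =>
    hball (a := y) (by simpa using hy)
  exact ⟨B, θ, hθC, hθ0, hev.mono fun y hy => hy.2, δ, hδ, fun δ' hδ' =>
    ⟨hp.continuous, hpos, hBd, hmono.injective, hB0, hθ0,
      fun y hy => (hmem y (hy.trans hδ')).1, fun y hy => (hmem y (hy.trans hδ')).2⟩⟩

theorem contDiff_comp_mul_exp {f : ℝ → ℝ} (hf : ContDiffOn ℝ 2 f (Ioi 0)) {x₀ : ℝ}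
    (hx₀ : 0 < x₀) : ContDiff ℝ 2 fun u => f (x₀ * Real.exp u) := by
  rw [← contDiffOn_univ]
  exact hf.comp (contDiff_const.mul Real.contDiff_exp).contDiffOn fun u _ =>
    mul_pos hx₀ (Real.exp_pos u)

theorem hasDerivAt_comp_mul_exp {f : ℝ → ℝ} (hf : ContDiffOn ℝ 2 f (Ioi 0)) {x₀ : ℝ}
    (hx₀ : 0 < x₀) : HasDerivAt (fun u => f (x₀ * Real.exp u)) (x₀ * deriv f x₀) 0 := by
  have h1 : HasDerivAt f (deriv f x₀) (x₀ * Real.exp 0) := by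
    rw [Real.exp_zero, mul_one]
    exact ((hf.contDiffAt (Ioi_mem_nhds hx₀)).differentiableAt (by norm_num)).hasDerivAt
  have h2 : HasDerivAt (fun u => x₀ * Real.exp u) x₀ 0 := by
    simpa using (Real.hasDerivAt_exp 0).const_mul x₀
  exact (h1.comp 0 h2).congr_deriv (mul_comm _ _)

/-- Change of variable from the payoff level `c = eˣ - 1` to the log-moneyness. -/
theorem isBigO_comp_exp_sub_one (α β : ℝ) :
    (fun x : ℝ => α * (Real.exp x - 1) ^ 2 + β * (Real.exp x - 1) ^ 3
      - (α * x ^ 2 + (α + β) * x ^ 3)) =O[𝓝 0] fun x : ℝ => x ^ 4 := by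
  have h3 : (fun x : ℝ => Real.exp x - 1 - x - x ^ 2 / 2) =O[𝓝 0] fun x : ℝ => x ^ 3 :=
    Real.hasQuadExpansion_exp.congr_left fun x => by ring
  have h2 : (fun x : ℝ => Real.exp x - 1 - x) =O[𝓝 0] fun x : ℝ => x ^ 2 :=
    ((h3.trans (isBigO_pow_of_le (by norm_num))).add
      ((isBigO_refl _ _).const_mul_left (1 / 2))).congr_left fun x => by ring
  have h1 : (fun x : ℝ => Real.exp x - 1) =O[𝓝 0] fun x : ℝ => x ^ 1 :=
    ((h2.trans (isBigO_pow_of_le (by norm_num))).add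
      (by simpa using isBigO_refl (fun x : ℝ => x) (𝓝 0))).congr_left fun x => by ring
  have hx1 : (fun x : ℝ => x) =O[𝓝 0] fun x : ℝ => x ^ 1 := by
    simpa using isBigO_refl (fun x : ℝ => x) (𝓝 0)
  have hx2 : (fun x : ℝ => x ^ 2 / 2) =O[𝓝 0] fun x : ℝ => x ^ 1 :=
    ((isBigO_pow_of_le (m := 1) (n := 2) (by norm_num)).const_mul_left (1 / 2)).congr_left
      fun x => by ring
  -- With `E = eˣ - 1`, `e1` is the factorization of `E² - (x + x²/2)²` and `e2` that of `E³ - x³`;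
  -- the surplus `x⁴/4` in the first square explains `α / 4` below.
  have e1 := h3.mul ((h1.add hx1).add hx2)
  have e2 := h2.mul (((h1.mul h1).add (h1.mul hx1)).add (hx1.mul hx1))
  simp only [← pow_add] at e1 e2
  refine (((e1.const_mul_left α).add (e2.const_mul_left β)).add
    ((isBigO_refl (fun x : ℝ => x ^ 4) (𝓝 0)).const_mul_left (α / 4))).congr_left fun x => ?_
  ring

theorem isBigO_exp_sub_one_sub : (fun x : ℝ => Real.exp x - 1 - x) =O[𝓝 0] fun x : ℝ => x ^ 2 := by
  refine ((Real.hasQuadExpansion_exp.trans (isBigO_pow_of_le (m := 2) (by norm_num))).add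
      ((isBigO_refl _ _).const_mul_left (1 / 2))).congr_left fun x => ?_
  ring

/-- A flow evaluated at a state `y = x m + O(x²)` is `p₀ x m + O(x²)`. -/
theorem flow_first_order {θ : ℝ → ℝ} {p₀ p₁ r C : ℝ} (hC : 0 ≤ C)
    (hθ : ∀ y : ℝ, |y| ≤ r → |θ y - (0 + p₀ * y + p₁ * y ^ 2)| ≤ C * |y| ^ 3) {N : ℝ} (hN : 0 ≤ N) :
    ∃ M, ∀ x m y : ℝ, |x| ≤ 1 → |m| ≤ N → |y - x * m| ≤ N * x ^ 2 → 2 * N * |x| ≤ r →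
      |θ y - x * (p₀ * m)| ≤ M * x ^ 2 := by
  refine ⟨|p₀| * N + |p₁| * (2 * N) ^ 2 + C * (2 * N) ^ 3, fun x m y hx hm hy hr => ?_⟩
  have hx0 := abs_nonneg x
  have hx2 : x ^ 2 ≤ |x| := by rw [← sq_abs]; nlinarith
  have hx3 : |x| ^ 3 ≤ x ^ 2 := by rw [← sq_abs x]; nlinarith [sq_nonneg |x|]
  have hy1 : |y| ≤ 2 * N * |x| := by
    have e : y = (y - x * m) + x * m := by ring
    calc |y| ≤ |y - x * m| + |x * m| := by
          conv_lhs => rw [e]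
          exact abs_add_le _ _
      _ ≤ N * x ^ 2 + |x| * N := by rw [abs_mul x m]; gcongr
      _ ≤ N * |x| + |x| * N := by gcongr
      _ = _ := by ring
  have hy2 : y ^ 2 ≤ (2 * N) ^ 2 * x ^ 2 := by
    rw [← sq_abs y, ← sq_abs x, ← mul_pow]; gcongr
  have hy3 : |y| ^ 3 ≤ (2 * N) ^ 3 * x ^ 2 := by
    calc |y| ^ 3 ≤ (2 * N * |x|) ^ 3 := by gcongr
      _ = (2 * N) ^ 3 * |x| ^ 3 := by ring
      _ ≤ _ := by gcongr
  have e : θ y - x * (p₀ * m) = (θ y - (0 + p₀ * y + p₁ * y ^ 2)) + p₀ * (y - x * m)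
      + p₁ * y ^ 2 := by ring
  rw [e]
  calc _ ≤ |θ y - (0 + p₀ * y + p₁ * y ^ 2)| + |p₀ * (y - x * m)| + |p₁ * y ^ 2| :=
        abs_add_three _ _ _
    _ = |θ y - (0 + p₀ * y + p₁ * y ^ 2)| + |p₀| * |y - x * m| + |p₁| * y ^ 2 := by
        rw [abs_mul, abs_mul, abs_of_nonneg (sq_nonneg y)]
    _ ≤ C * ((2 * N) ^ 3 * x ^ 2) + |p₀| * (N * x ^ 2) + |p₁| * ((2 * N) ^ 2 * x ^ 2) := by
        gcongr
        exact (hθ y (hy1.trans hr)).trans (by gcongr)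
    _ = _ := by ring

theorem abs_sub_sq_half_le_one {t : ℝ} (ht : t ∈ Icc (0 : ℝ) 1) : |t - t ^ 2 / 2| ≤ 1 :=
  abs_le.mpr ⟨by nlinarith [ht.1, ht.2], by nlinarith [ht.1, ht.2]⟩

theorem sq_le_of_abs_sub_le {C c x : ℝ} (hC : 0 ≤ C) (hx : |x| ≤ 1)
    (h : |c - x| ≤ C * x ^ 2) : c ^ 2 ≤ (1 + C) ^ 2 * x ^ 2 := by
  have hx2 : x ^ 2 ≤ |x| := by rw [← sq_abs]; nlinarith [abs_nonneg x]
  have hcx : |c| ≤ (1 + C) * |x| := by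
    calc |c| = |x + (c - x)| := by congr 1; ring
      _ ≤ |x| + |c - x| := abs_add_le _ _
      _ ≤ |x| + C * |x| := by
        gcongr
        exact h.trans (by gcongr)
      _ = _ := by ring
  rw [← sq_abs c, ← sq_abs x, ← mul_pow]
  gcongr

/-- A first-order expansion in the level `c = x + O(x²)` is one in `x`. -/
theorem first_order_change_of_level {M C m₀ κ c x τ u v : ℝ} (hκ : 0 < κ) (hM : 0 ≤ M)
    (hC : 0 ≤ C) (hm₀ : 0 ≤ m₀) (hτ : |τ| ≤ 1) (hcx : |c - x| ≤ C * x ^ 2)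
    (hc : c ^ 2 ≤ (1 + C) ^ 2 * x ^ 2) (hv : |v| / κ ≤ m₀)
    (hu : |u - c / κ * (v * τ)| ≤ M * c ^ 2) :
    |v * τ / κ| ≤ M * (1 + C) ^ 2 + C * m₀ + m₀ ∧
      |u - x * (v * τ / κ)| ≤ (M * (1 + C) ^ 2 + C * m₀ + m₀) * x ^ 2 := by
  have hm : |v * τ / κ| ≤ m₀ := by
    rw [abs_div, abs_mul, abs_of_pos hκ]
    refine le_trans ?_ hv
    gcongr
    exact mul_le_of_le_one_right (abs_nonneg _) hτ
  constructor
  · have : 0 ≤ M * (1 + C) ^ 2 + C * m₀ := by positivity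
    linarith
  · have e : u - x * (v * τ / κ) = (u - c / κ * (v * τ)) + (c - x) * (v * τ / κ) := by ring
    rw [e]
    calc _ ≤ _ := abs_add_le _ _
      _ ≤ M * ((1 + C) ^ 2 * x ^ 2) + C * x ^ 2 * m₀ := by
        rw [abs_mul (c - x)]
        refine add_le_add (hu.trans (by gcongr)) ?_
        gcongr
      _ = (M * (1 + C) ^ 2 + C * m₀) * x ^ 2 := by ring
      _ ≤ _ := mul_le_mul_of_nonneg_right (by linarith) (sq_nonneg x)

/-- With `κ = D/3`, half of `c²/κ - 2qc³/κ³` is `3c²/(2D) - 27qc³/D³`. Inserting `c = x + x²/2 +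
O(x³)` makes the cubic coefficient `3/(2D) - 27q/D³ = -3(90q - 5D²)/(10D³)`. -/
theorem cubic_coefficient_eq {ρ V₀ s η₀ η₁ η₂ σ₀ σ₁ D β₀ β₁ β₂ a B₁ C₁ q : ℝ}
    (hs : s ^ 2 = V₀)
    (hD : D = σ₀ ^ 2 + 4 * ρ * σ₀ * s * η₁ + 4 * η₁ ^ 2 * V₀)
    (hβ₀ : β₀ = 16 * η₁ ^ 2 * V₀ ^ 2 * (η₁ ^ 2 + 6 * η₀ * η₂))
    (hβ₁ : β₁ = 8 * η₁ * ρ * V₀ * (3 * η₁ * ρ * σ₁ + 7 * η₁ ^ 2 * s + 12 * η₀ * η₂ * s))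
    (hβ₂ : β₂ = 4 * (6 * η₁ * ρ * σ₁ * s + 6 * η₀ * η₂ * ρ ^ 2 * V₀
      + η₁ ^ 2 * (5 + 7 * ρ ^ 2) * V₀))
    (ha : a = 2 * η₁ * s) (hB₁ : B₁ = a * ρ + σ₀) (hC₁ : C₁ = a + ρ * σ₀)
    (hq : q = 2 / 15 * ((σ₀ * σ₁ / 2 + σ₀ ^ 2 / 2) * B₁ ^ 2 + 2 * η₁ * (C₁ * s) * (σ₀ * B₁)
      + (2 * η₁ * (C₁ * (s * σ₀ / 2 * B₁ / 2))
        + (2 * η₁ ^ 2 + 2 * η₀ * η₂) * (C₁ * s) ^ 2))) :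
    σ₀ ^ 4 + 2 * σ₀ ^ 3 * (3 * σ₁ + 7 * η₁ * ρ * s) + β₂ * σ₀ ^ 2 + β₁ * σ₀ + β₀
      = 90 * q - 5 * D ^ 2 := by
  rw [hβ₀, hβ₁, hβ₂, hq, hD, hC₁, hB₁, ha, ← hs]
  ring

/-- Completing the square in `σ₀` leaves `(1-ρ²)(2√V₀ η₁)²`; if that vanishes, the square is `σ₀²`.
-/
theorem denominator_pos {ρ V₀ η₁ σ₀ D : ℝ} (hσ₀ : 0 < σ₀) (hV₀ : 0 < V₀) (hρ : 0 < 1 - ρ ^ 2)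
    (hD : D = σ₀ ^ 2 + 4 * ρ * σ₀ * Real.sqrt V₀ * η₁ + 4 * η₁ ^ 2 * V₀) : 0 < D := by
  have e : D = (σ₀ + 2 * ρ * (Real.sqrt V₀ * η₁)) ^ 2
      + (1 - ρ ^ 2) * (2 * (Real.sqrt V₀ * η₁)) ^ 2 := by
    have := Real.sq_sqrt hV₀.le
    rw [hD]
    linear_combination (-4 * η₁ ^ 2) * this
  rw [e]
  rcases eq_or_ne (Real.sqrt V₀ * η₁) 0 with h0 | h0
  · rw [h0]
    simp only [mul_zero, add_zero, ne_eq, OfNat.ofNat_ne_zero, not_false_eq_true, zero_pow]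
    positivity
  · positivity

/-! ### The main theorem -/

theorem proposition6
    (η σ : ℝ → ℝ)
    (hη_pos : ∀ s : ℝ, 0 < s → 0 < η s) (hσ_pos : ∀ v : ℝ, 0 < v → 0 < σ v)
    (hη_C2 : ContDiffOn ℝ 2 η (Ioi 0)) (hσ_C2 : ContDiffOn ℝ 2 σ (Ioi 0))
    (S₀ V₀ ρ : ℝ) (hS₀ : 0 < S₀) (hV₀ : 0 < V₀) (hρ_gt : -1 < ρ) (hρ_lt : ρ < 1)
    (η₀ η₁ η₂ σ₀ σ₁ σ₂ : ℝ)
    (hη₀ : η₀ = η S₀) (hη₁ : η₁ = S₀ * deriv η S₀)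
    (hσ₀ : σ₀ = σ V₀) (hσ₁ : σ₁ = V₀ * deriv σ V₀)
    (hη_exp : (fun S : ℝ => η S -
        (η₀ + η₁ * Real.log (S / S₀) + η₂ * Real.log (S / S₀) ^ 2))
      =O[𝓝 S₀] (fun S : ℝ => Real.log (S / S₀) ^ 3))
    (hσ_exp : (fun V : ℝ => σ V -
        (σ₀ + σ₁ * Real.log (V / V₀) + σ₂ * Real.log (V / V₀) ^ 2))
      =O[𝓝 V₀] (fun V : ℝ => Real.log (V / V₀) ^ 3))
    (D β₀ β₁ β₂ : ℝ)
    (hD : D = σ₀ ^ 2 + 4 * ρ * σ₀ * Real.sqrt V₀ * η₁ + 4 * η₁ ^ 2 * V₀)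
    (hβ₀ : β₀ = 16 * η₁ ^ 2 * V₀ ^ 2 * (η₁ ^ 2 + 6 * η₀ * η₂))
    (hβ₁ : β₁ = 8 * η₁ * ρ * V₀ *
      (3 * η₁ * ρ * σ₁ + 7 * η₁ ^ 2 * Real.sqrt V₀ + 12 * η₀ * η₂ * Real.sqrt V₀))
    (hβ₂ : β₂ = 4 * (6 * η₁ * ρ * σ₁ * Real.sqrt V₀ + 6 * η₀ * η₂ * ρ ^ 2 * V₀
      + η₁ ^ 2 * (5 + 7 * ρ ^ 2) * V₀))
    (g₁ h₁ : ℝ → ℝ)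
    (hg₁ : ∀ t : ℝ, g₁ t = 3 / 2 *
      ((2 * η₁ * Real.sqrt V₀ + ρ * σ₀) * Real.sqrt V₀ * η₀ / D) * (2 * t - t ^ 2))
    (hh₁ : ∀ t : ℝ, h₁ t = 3 / 2 *
      (σ₀ * (σ₀ + 2 * η₁ * ρ * Real.sqrt V₀) / D) * (2 * t - t ^ 2)) :
    -- the denominator is positive
    0 < D ∧
    -- the rate function is finite near the money and has the stated expansion
    (∀ᶠ x : ℝ in 𝓝 0, rateFunction η σ ρ S₀ V₀ (V₀ * η S₀ ^ 2 * Real.exp x) ≠ ∞) ∧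
    (fun x : ℝ =>
        (rateFunction η σ ρ S₀ V₀ (V₀ * η S₀ ^ 2 * Real.exp x)).toReal -
          (3 / (2 * D) * x ^ 2
            - 3 / (10 * D ^ 3) *
              (σ₀ ^ 4 + 2 * σ₀ ^ 3 * (3 * σ₁ + 7 * η₁ * ρ * Real.sqrt V₀)
                + β₂ * σ₀ ^ 2 + β₁ * σ₀ + β₀) * x ^ 3))
      =O[𝓝 0] (fun x : ℝ => x ^ 4) ∧
    -- near the money optimal paths exist, and all of them have the stated expansion,
    -- uniformly in `t ∈ [0,1]`
    (∀ᶠ x : ℝ in 𝓝 0, ∃ g h : ℝ → ℝ,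
      IsOptimalPair η σ ρ S₀ V₀ (V₀ * η S₀ ^ 2 * Real.exp x) g h) ∧
    (∃ C : ℝ, ∀ᶠ x : ℝ in 𝓝 0, ∀ g h : ℝ → ℝ,
      IsOptimalPair η σ ρ S₀ V₀ (V₀ * η S₀ ^ 2 * Real.exp x) g h →
        ∀ t ∈ Icc (0 : ℝ) 1,
          |g t - (Real.log S₀ + x * g₁ t)| ≤ C * x ^ 2 ∧
          |h t - (Real.log V₀ + x * h₁ t)| ≤ C * x ^ 2) := by
  have hη0 : 0 < η₀ := hη₀ ▸ hη_pos S₀ hS₀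
  have hσ0 : 0 < σ₀ := hσ₀ ▸ hσ_pos V₀ hV₀
  have hρ2 := one_sub_sq_pos hρ_gt hρ_lt
  have hsV : 0 < Real.sqrt V₀ := Real.sqrt_pos.mpr hV₀
  have hsV2 : Real.sqrt V₀ ^ 2 = V₀ := Real.sq_sqrt hV₀.le
  have hDpos := denominator_pos hσ0 hV₀ hρ2 hD
  refine ⟨hDpos, ?_⟩
  have hpη := contDiff_comp_mul_exp hη_C2 hS₀
  have hpσ := contDiff_comp_mul_exp hσ_C2 hV₀
  obtain ⟨A, ζ, hζC, hζ0, hζd, δ₁, hδ₁, hA⟩ :=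
    exists_isLocalFlow hpη fun u => hη_pos _ (by positivity)
  obtain ⟨B, θ, hθC, hθ0, hθd, δ₂, hδ₂, hB⟩ :=
    exists_isLocalFlow hpσ fun u => hσ_pos _ (by positivity)
  have hζexp : HasQuadExpansion ζ 0 η₀ (η₀ * η₁ / 2) := by
    have := hasQuadExpansion_flow hpη (hasDerivAt_comp_mul_exp hη_C2 hS₀) hζ0 hζd
    simpa only [Real.exp_zero, mul_one, ← hη₀, ← hη₁] using this
  have hθexp : HasQuadExpansion θ 0 σ₀ (σ₀ * σ₁ / 2) := by
    have := hasQuadExpansion_flow hpσ (hasDerivAt_comp_mul_exp hσ_C2 hV₀) hθ0 hθd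
    simpa only [Real.exp_zero, mul_one, ← hσ₀, ← hσ₁] using this
  have hζt : Tendsto ζ (𝓝 0) (𝓝 0) := by simpa [hζ0] using hζC.continuousAt.tendsto
  have hθt : Tendsto θ (𝓝 0) (𝓝 0) := by simpa [hθ0] using hθC.continuousAt.tendsto
  have hW' : HasQuadExpansion (fun y => Real.exp (θ y)) 1 σ₀ (σ₀ * σ₁ / 2 + σ₀ ^ 2 / 2) := by
    have := Real.hasQuadExpansion_exp.comp hθexp hθt
    convert this using 1 <;> ring
  -- The only place where `η₂` enters: the flow `ζ` to second order involves just `η₀` and `η₁`.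
  have hP' : HasQuadExpansion (localVolFactor η S₀ ζ) 1 (2 * η₁)
      (2 * η₁ ^ 2 + 2 * η₀ * η₂) := by
    have h1 := ((hasQuadExpansion_of_log hS₀ hη_exp).comp hζexp hζt).const_mul η₀⁻¹
    have h2 := h1.mul h1
    have e : localVolFactor η S₀ ζ
        = fun y => η₀⁻¹ * η (S₀ * Real.exp (ζ y)) * (η₀⁻¹ * η (S₀ * Real.exp (ζ y))) := by
      funext y; rw [localVolFactor, ← hη₀]; field_simp
    rw [e]
    convert h2 using 1 <;> field_simp <;> ring
  have hWC : ContDiffAt ℝ 2 (fun y => Real.exp (θ y)) 0 := hθC.exp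
  have hPC : ContDiffAt ℝ 2 (localVolFactor η S₀ ζ) 0 :=
    ((hpη.contDiffAt.comp 0 hζC).div_const (η S₀)).pow 2
  have hφC : ContDiffAt ℝ 2 (volFactor V₀ θ) 0 :=
    (contDiffAt_const.mul hWC).sqrt (by positivity)
  have hφ0 : volFactor V₀ θ 0 = Real.sqrt V₀ := by simp [volFactor, hθ0]
  have hφd : HasDerivAt (volFactor V₀ θ) (Real.sqrt V₀ * σ₀ / 2) 0 := by
    have := (hW'.hasDerivAt.const_mul V₀).sqrt (by positivity)
    refine this.congr_deriv ?_
    rw [hθ0, Real.exp_zero, mul_one]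
    nth_rewrite 1 [← hsV2]
    field_simp
  obtain ⟨r₁, hr₁, L₁, hφQ⟩ := hφC.exists_quadControl hφd
  obtain ⟨r₂, hr₂, L₂, hPQ⟩ := hPC.exists_quadControl hP'.hasDerivAt
  obtain ⟨r₃, hr₃, L₃, hWQ⟩ := hWC.exists_quadControl hW'.hasDerivAt
  set δ := min (min δ₁ δ₂) (min r₁ (min r₂ r₃)) with hδ
  have hδ0 : 0 < δ := by positivity
  set L := max L₁ (max L₂ L₃) with hL
  set b : ℝ := σ₀
  set a := 2 * η₁ * Real.sqrt V₀ with ha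
  set B₁ := a * ρ + b with hB₁
  set C₁ := a + ρ * b with hC₁
  have hκ : D / 3 = (a ^ 2 + 2 * a * b * ρ + b ^ 2) / 3 := by
    rw [hD, ha, mul_pow, hsV2]; ring
  set q := 2 / 15 * ((σ₀ * σ₁ / 2 + σ₀ ^ 2 / 2) * B₁ ^ 2
      + 2 * η₁ * (C₁ * Real.sqrt V₀) * (σ₀ * B₁)
      + (2 * η₁ * (C₁ * (Real.sqrt V₀ * σ₀ / 2 * B₁ / 2))
        + (2 * η₁ ^ 2 + 2 * η₀ * η₂) * (C₁ * Real.sqrt V₀) ^ 2)) with hq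
  obtain ⟨ε, hε, M, hM, hmain⟩ := exists_rateFunction_expansion hS₀ hV₀ hρ_gt hρ_lt
    hη_C2.continuousOn hσ_C2.continuousOn hδ0
    (hA δ ((min_le_left _ _).trans (min_le_left _ _)))
    (hB δ ((min_le_left _ _).trans (min_le_right _ _)))
    (hφQ.mono ((min_le_right _ _).trans (min_le_left _ _)) (le_max_left _ _))
    (hPQ.mono ((min_le_right _ _).trans ((min_le_right _ _).trans (min_le_left _ _)))
      ((le_max_left _ _).trans (le_max_right _ _)))
    (hWQ.mono ((min_le_right _ _).trans ((min_le_right _ _).trans (min_le_right _ _)))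
      ((le_max_right _ _).trans (le_max_right _ _)))
    hP' hW' hφ0.symm ha rfl hB₁ hC₁ hκ (by positivity) hq
  have hct : Tendsto (fun x : ℝ => |Real.exp x - 1|) (𝓝 0) (𝓝 0) := by
    have : Tendsto (fun x : ℝ => |Real.exp x - 1|) (𝓝 0) (𝓝 |Real.exp 0 - 1|) :=
      Continuous.tendsto (by fun_prop) 0
    simpa using this
  have hev : ∀ᶠ x : ℝ in 𝓝 0, |Real.exp x - 1| ≤ ε :=
    (hct.eventually_lt_const hε).mono fun x hx => hx.le
  replace hmain := fun (x : ℝ) (hx : |Real.exp x - 1| ≤ ε) => by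
    have := hmain (Real.exp x - 1) hx
    rwa [sub_add_cancel] at this
  refine ⟨hev.mono fun x hx => (hmain x hx).1, ?_, hev.mono fun x hx => (hmain x hx).2.2.1, ?_⟩
  · have h1 : (fun x : ℝ => (rateFunction η σ ρ S₀ V₀ (V₀ * η S₀ ^ 2 * Real.exp x)).toReal
        - ((Real.exp x - 1) ^ 2 / (D / 3) - 2 * q * (Real.exp x - 1) ^ 3 / (D / 3) ^ 3) / 2)
        =O[𝓝 0] fun x : ℝ => x ^ 4 := by
      have hc : (fun x : ℝ => Real.exp x - 1) =O[𝓝 0] fun x : ℝ => x := by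
        have := (Real.hasDerivAt_exp 0).differentiableAt.isBigO_sub
        simpa using this
      refine IsBigO.trans ?_ (hc.pow 4)
      refine IsBigO.of_bound M ?_
      filter_upwards [hev] with x hx
      rw [Real.norm_eq_abs, Real.norm_eq_abs, abs_of_nonneg (by positivity : 0 ≤ (Real.exp x - 1) ^ 4)]
      exact (hmain x hx).2.1
    have hcoef := cubic_coefficient_eq hsV2 hD hβ₀ hβ₁ hβ₂ ha hB₁ hC₁ hq
    refine (h1.add (isBigO_comp_exp_sub_one (3 / (2 * D)) (-(27 * q / D ^ 3)))).congr_left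
      fun x => ?_
    rw [hcoef]
    field_simp
    ring
  · obtain ⟨rζ, hrζ, Cζ, hCζ, hζb⟩ := hζexp.exists_bound
    obtain ⟨rθ, hrθ, Cθ, hCθ, hθb⟩ := hθexp.exists_bound
    obtain ⟨C₂, hC₂, hexp2⟩ := isBigO_exp_sub_one_sub.exists_pos
    -- A common bound for the first-order slopes of the two states, so that one `N` serves both
    -- flows uniformly in `t`.
    set m₀ := (|B₁| + |Real.sqrt V₀ * C₁|) / (D / 3) with hm₀
    have hm₀0 : 0 ≤ m₀ := by positivity
    set N := M * (1 + C₂) ^ 2 + C₂ * m₀ + m₀ with hN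
    have hN0 : 0 ≤ N := by positivity
    obtain ⟨Mζ, hMζ⟩ := flow_first_order hCζ hζb hN0
    obtain ⟨Mθ, hMθ⟩ := flow_first_order hCθ hθb hN0
    refine ⟨max Mζ Mθ, ?_⟩
    have habs : Tendsto (fun x : ℝ => |x|) (𝓝 0) (𝓝 0) := by simpa using (continuous_abs.tendsto (0 : ℝ))
    have hlin : Tendsto (fun x : ℝ => 2 * N * |x|) (𝓝 0) (𝓝 0) := by
      simpa using habs.const_mul (2 * N)
    filter_upwards [hev, hexp2.bound, habs.eventually_lt_const one_pos,
      hlin.eventually_lt_const hrζ, hlin.eventually_lt_const hrθ] with x hx hx2 hx1 hxζ hxθ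
    intro g h hopt t ht
    obtain ⟨y, z, hy, hz, hyc, hzc⟩ := (hmain x hx).2.2.2 g h hopt t ht
    set c := Real.exp x - 1 with hc
    rw [Real.norm_eq_abs, Real.norm_eq_abs, abs_of_nonneg (sq_nonneg x)] at hx2
    have hc2 := sq_le_of_abs_sub_le hC₂.le hx1.le hx2
    have hτ := abs_sub_sq_half_le_one ht
    have hx20 := sq_nonneg x
    have hmove := fun u v => first_order_change_of_level (κ := D / 3) (u := u) (v := v)
      (by positivity) hM hC₂.le hm₀0 hτ hx2 hc2
    obtain ⟨hy1, hy2⟩ := hmove y B₁ (by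
      rw [hm₀]; gcongr; linarith [abs_nonneg (Real.sqrt V₀ * C₁)]) hyc
    obtain ⟨hz1, hz2⟩ := hmove z (Real.sqrt V₀ * C₁) (by
      rw [hm₀]; gcongr; linarith [abs_nonneg B₁]) (by rw [mul_assoc (Real.sqrt V₀)]; exact hzc)
    have hθx := hMθ x _ y hx1.le hy1 hy2 hxθ.le
    have hζx := hMζ x _ z hx1.le hz1 hz2 hxζ.le
    constructor
    · have e : g t - (Real.log S₀ + x * g₁ t)
          = ζ z - x * (η₀ * (Real.sqrt V₀ * C₁ * (t - t ^ 2 / 2) / (D / 3))) := by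
        rw [hz, hg₁, hC₁, ha]; field_simp; ring
      rw [e]
      exact hζx.trans (mul_le_mul_of_nonneg_right (le_max_left _ _) hx20)
    · have e : h t - (Real.log V₀ + x * h₁ t)
          = θ y - x * (σ₀ * (B₁ * (t - t ^ 2 / 2) / (D / 3))) := by
        rw [hy, hh₁, hB₁, ha]; field_simp; ring
      rw [e]
      exact hθx.trans (mul_le_mul_of_nonneg_right (le_max_right _ _) hx20)
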